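/- **Definitions.** A *disk pattern* is a collection of closed disks (of positive radius) in which no disk has its boundary contained in the union of two other disks and no disk is the Hausdorff limit of a sequence of distinct disks of the collection. Its *contact graph* has one vertex $v$ for each disk $P(v)$, and an edge $[u,v]$ whenever the distinct disks $P(u),P(v)$ intersect. The *dihedral angle* of two intersecting disks $D_1,D_2$ is the angle in $[0,\pi)$ between the clockwise tangent of $\partial D_1$ and the counterclockwise tangent of $\partial D_2$ at a point of $\partial D_1\cap\partial D_2$. A *disk triangulation graph* is the one-skeleton of a (simplicial) triangulation of the open topological disk. Given a graph $G=(V,E)$ and $\Theta:E\to[0,\pi/2]$, let $\tilde G$ be obtained from $G$ as follows: whenever $v_0,v_1,v_2,v_3$ is a simple loop of $G$ whose four edges all have $\Theta=\pi/2$, and $[v_0,v_2]\in E$ with $\Theta([v_0,v_2])=0$, add the edge $[v_1,v_3]$ if it is not already in $G$. Put $\tilde\Theta=\Theta$ on $E$ and $\tilde\Theta=0$ on the added edges. A disk pattern $P=\{P(v)\}_{v\in V}$ *realizes* $(G,\Theta)$ if its contact graph is $\tilde G$ (with $v$ corresponding to $P(v)$) and its dihedral angle function is $\tilde\Theta$.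 The pattern is *locally finite* in a domain $\Omega$ if all its disks are contained in $\Omega$ and every compact subset of $\Omega$ meets only finitely many of them. Let $U=\{z\in\mathbb C:|z|<1\}$ with its hyperbolic metric. **Theorem.** Let $G=(V,E)$ be a disk triangulation graph and let $\Theta:E\to[0,\pi/2]$ be a function satisfying (C1) if a loop of $G$ formed by three edges $e_1,e_2,e_3$ separates the vertices of $G$ (that is, some two vertices not on the loop cannot be joined by a path in $G$ avoiding the loop), then $\Theta(e_1)+\Theta(e_2)+\Theta(e_3)<\pi$. Let $P$ and $P^*$ be disk patterns in $U$ which realize $(G,\Theta)$, and assume that both $P$ and $P^*$ are locally finite in $U$. Then there is a hyperbolic isometry $f:U\to U$ such that $P^*=f(P)$; more precisely, $P^*(v)=f(P(v))$ for every $v\in V$. -/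

import Mathlib

namespace DiskPatterns

/-! ### Triangulations of the open disk -/

/-- The geometric realization of an abstract simplicial complex `K` with vertex set `V`, in
barycentric coordinates: the functions `x : V → ℝ`, `x ≥ 0`, that vanish outside some simplex and
have total mass `1`. It is topologized as a subspace of the product `V → ℝ`; when every vertex lies
in only finitely many simplices this is the usual (weak, equivalently metric) topology. -/
def realization {V : Type*} (K : AbstractSimplicialComplex V) : Set (V → ℝ) :=
  {x | (∀ v, 0 ≤ x v) ∧ ∃ s ∈ K.faces, (∀ v, v ∉ s → x v = 0) ∧ ∑ v ∈ s, x v = 1}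

/-- `K` is a triangulation of the open topological disk: a locally finite simplicial complex whose
realization is homeomorphic to the open unit disk. -/
def IsDiskTriangulation {V : Type*} (K : AbstractSimplicialComplex V) : Prop :=
  (∀ v : V, {s | s ∈ K.faces ∧ v ∈ s}.Finite) ∧
    Nonempty (realization K ≃ₜ Metric.ball (0 : ℂ) 1)

/-- `G` is the one-skeleton of a triangulation of the open topological disk. -/
def IsDiskTriangulationGraph {V : Type*} (G : SimpleGraph V) : Prop :=
  ∃ K : AbstractSimplicialComplex V, IsDiskTriangulation K ∧
    ∀ u v : V, G.Adj u v ↔ u ≠ v ∧ ∃ s ∈ K.faces, (s : Set V) = {u, v}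

/-! ### Disk patterns -/

/-- A closed disk in the plane, of positive radius. -/
@[ext]
structure ClosedDisk where
  center : ℂ
  radius : ℝ
  radius_pos : 0 < radius

/-- The closed disk as a set of points. -/
def ClosedDisk.carrier (D : ClosedDisk) : Set ℂ := Metric.closedBall D.center D.radius

/-- The boundary circle of a closed disk. -/
def ClosedDisk.boundary (D : ClosedDisk) : Set ℂ := Metric.sphere D.center D.radius

/-- The counterclockwise tangent vector to the boundary circle of `D` at its point `z`. -/
noncomputable def ClosedDisk.ccwTangent (D : ClosedDisk) (z : ℂ) : ℂ := Complex.I * (z - D.center)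

/-- `θ` is the dihedral angle of `D₁` and `D₂`: the boundary circles meet, and `θ` is the angle
between the clockwise tangent of `∂D₁` and the counterclockwise tangent of `∂D₂` at a common point.
(Two circles meet at the same angle at all their common points.) -/
def HasDihedralAngle (D₁ D₂ : ClosedDisk) (θ : ℝ) : Prop :=
  ∃ z ∈ D₁.boundary ∩ D₂.boundary,
    InnerProductGeometry.angle (-(D₁.ccwTangent z)) (D₂.ccwTangent z) = θ

/-- A collection of distinct closed disks, indexed by `V`, is a disk pattern if no disk has its
boundary contained in the union of two other disks, and no disk is the Hausdorff limit of a
sequence of distinct disks of the collection. -/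
structure IsDiskPattern {V : Type*} (P : V → ClosedDisk) : Prop where
  injective : Function.Injective P
  not_covered : ∀ u v w : V, u ≠ v → u ≠ w → v ≠ w →
    ¬ (P u).boundary ⊆ (P v).carrier ∪ (P w).carrier
  not_limit : ∀ (u : V) (s : ℕ → V), Function.Injective s →
    ¬ Filter.Tendsto (fun n => Metric.hausdorffDist (P (s n)).carrier (P u).carrier)
      Filter.atTop (nhds 0)

/-- The contact graph: vertices are the disks, edges join the distinct disks that intersect. -/
def contactGraph {V : Type*} (P : V → ClosedDisk) : SimpleGraph V where
  Adj u v := u ≠ v ∧ ((P u).carrier ∩ (P v).carrier).Nonempty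
  symm := ⟨fun u v h => ⟨h.1.symm, by rw [Set.inter_comm]; exact h.2⟩⟩
  loopless := ⟨fun _ h => h.1 rfl⟩

/-- The pattern is locally finite in `Ω`: all its disks lie in `Ω`, and every compact subset of `Ω`
meets only finitely many of them. -/
def IsLocallyFiniteIn {V : Type*} (P : V → ClosedDisk) (Ω : Set ℂ) : Prop :=
  (∀ v, (P v).carrier ⊆ Ω) ∧
    ∀ K : Set ℂ, K ⊆ Ω → IsCompact K → {v | ((P v).carrier ∩ K).Nonempty}.Finite

/-! ### Realizing the data `(G, Θ)` -/

/-- The vertices `a, c, b, d` form a simple loop of `G`, all four edges have angle `π / 2`, and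
the diagonal `[c, d]` is an edge of `G` with angle `0`: then `[a, b]` is the other reducible
edge. -/
def IsOtherReducible {V : Type*} (G : SimpleGraph V) (Θ : Sym2 V → ℝ) (a b : V) : Prop :=
  a ≠ b ∧ ∃ c d : V,
    (G.Adj a c ∧ Θ s(a, c) = Real.pi / 2) ∧ (G.Adj c b ∧ Θ s(c, b) = Real.pi / 2) ∧
    (G.Adj b d ∧ Θ s(b, d) = Real.pi / 2) ∧ (G.Adj d a ∧ Θ s(d, a) = Real.pi / 2) ∧
    (G.Adj c d ∧ Θ s(c, d) = 0)

/-- The graph `G̃`, obtained from `G` by adding the missing reducible edges. -/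
def completedGraph {V : Type*} (G : SimpleGraph V) (Θ : Sym2 V → ℝ) : SimpleGraph V where
  Adj a b := G.Adj a b ∨ IsOtherReducible G Θ a b
  symm := ⟨by
    rintro a b (h | ⟨hab, c, d, h1, h2, h3, h4, h5⟩)
    · exact Or.inl h.symm
    · refine Or.inr ⟨hab.symm, c, d, ?_, ?_, ?_, ?_, h5⟩
      · exact ⟨h2.1.symm, by rw [Sym2.eq_swap]; exact h2.2⟩
      · exact ⟨h1.1.symm, by rw [Sym2.eq_swap]; exact h1.2⟩
      · exact ⟨h4.1.symm, by rw [Sym2.eq_swap]; exact h4.2⟩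
      · exact ⟨h3.1.symm, by rw [Sym2.eq_swap]; exact h3.2⟩⟩
  loopless := ⟨by
    rintro a (h | h)
    · exact G.loopless.irrefl a h
    · exact h.1 rfl⟩

open Classical in
/-- The function `Θ̃` on the edges of `G̃`: it is `Θ` on the edges of `G` and `0` on the added
edges. -/
noncomputable def completedAngle {V : Type*} (G : SimpleGraph V) (Θ : Sym2 V → ℝ) (e : Sym2 V) :
    ℝ :=
  if e ∈ G.edgeSet then Θ e else 0

/-- `P` is a disk pattern that realizes `(G, Θ)`, with `P v` the disk of the vertex `v`: the
contact graph is `G̃` and the dihedral angle function is `Θ̃`. Only the values of `Θ` on the edges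
of `G` matter. -/
structure Realizes {V : Type*} (P : V → ClosedDisk) (G : SimpleGraph V) (Θ : Sym2 V → ℝ) :
    Prop where
  isDiskPattern : IsDiskPattern P
  contactGraph_eq : contactGraph P = completedGraph G Θ
  dihedralAngle : ∀ u v : V, (contactGraph P).Adj u v →
    HasDihedralAngle (P u) (P v) (completedAngle G Θ s(u, v))

/-- A set `S` of vertices separates the vertices of `G`: there are two vertices outside `S` such
that any path joining them meets `S`. -/
def SeparatesVertices {V : Type*} (G : SimpleGraph V) (S : Set V) : Prop :=
  ∃ x y : V, x ∉ S ∧ y ∉ S ∧ ∀ p : G.Walk x y, ∃ u ∈ p.support, u ∈ S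

/-- If a loop formed by three edges of `G` separates the vertices of `G`, then the sum of the three
angles is less than `π`. -/
def SeparatingTriangleCondition {V : Type*} (G : SimpleGraph V) (Θ : Sym2 V → ℝ) : Prop :=
  ∀ a b c : V, G.Adj a b → G.Adj b c → G.Adj c a → SeparatesVertices G {a, b, c} →
    Θ s(a, b) + Θ s(b, c) + Θ s(c, a) < Real.pi

/-! ### The hyperbolic plane -/

/-- The hyperbolic distance of the Poincaré disk `{|z| < 1}` (curvature `-1`). -/
noncomputable def hypDist (z w : ℂ) : ℝ :=
  2 * Real.arsinh (‖z - w‖ / Real.sqrt ((1 - ‖z‖ ^ 2) * (1 - ‖w‖ ^ 2)))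

/-- `f` restricts to a hyperbolic isometry of the unit disk onto itself. -/
def IsHyperbolicIsometry (f : ℂ → ℂ) : Prop :=
  Set.BijOn f (Metric.ball 0 1) (Metric.ball 0 1) ∧
    ∀ z ∈ Metric.ball (0 : ℂ) 1, ∀ w ∈ Metric.ball (0 : ℂ) 1,
      hypDist (f z) (f w) = hypDist z w

end DiskPatterns

namespace DiskPatterns

open Set Metric

/-! ### Plane topology -/

/-! The theorem is a discrete Schwarz–Pick lemma followed by a developing argument. A disk is
measured by the geodesic curvature `curv` of its boundary circle in U (the hyperbolic cotangent of
its hyperbolic radius when it lies in U), a pair of disks by the inversive product `invProd`. For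
intersecting disks the latter is the cosine of the dihedral angle, so P and P* have the same
inversive products along the edges of G. In ℝ^{2,1} a disk becomes the vector `ClosedDisk.vec`, and
the product of two such vectors is `invProd` plus the product of the curvatures
(`ClosedDisk.mink_vec`).

Curvatures agree. Enlarge P by a factor r > 1; only finitely many disks remain in U. If one of them
had larger curvature k than its partner's curvature k* in P*, choose the disk u that maximizes (k² -
1)/(k*² - 1). In the frame of the hyperbolic center of u, the time coordinates of the neighbors are
then smaller than in P*; neighbors that stick out of U cause no trouble, since they have |k| ≤ 1.
The angle between two neighbors decreases strictly in these coordinates, because all inversive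
products involved are nonnegative (`IsConfig.arg_lt`), so all angles at u are larger than in P*. But
they add up to exactly 2π in P* and to at most 2π in the enlarged P, a contradiction
(`IsPacking.curv_le`). Letting r tend to 1 and exchanging the patterns gives equality.

The angle sums come from Euclidean geometry. Segments joining the centers of adjacent disks form a
straight drawing of G, in which the neighbors wind once around each vertex (`IsFlower.sum_arg`). A
Lorentz boost carries the Euclidean frame to the hyperbolic one, and consecutive directions never
coincide on the way, so the total turning stays 2π. Two segments could cross only if the disks were
tangent and orthogonal in a pattern that (C1) turns into four faces of a tetrahedron, impossible in
the plane (`not_tetrahedron`). This and the other facts on plane triangulations are proved with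
continuous logarithms.

Equal curvatures and angles give equal Gram matrices. The isometry of ℝ^{2,1} that matches one face
then matches the next neighbor in each flower and, along walks, every disk
(`IsPacking.exists_isometry`). -/

theorem exists_log_of_homotopy {S : Type*} [TopologicalSpace S] (F : C(unitInterval × S, ℂ))
    (hF : ∀ x, F x ≠ 0) (c : ℂ) (h0 : ∀ s, F (0, s) = c) :
    ∃ L : C(S, ℂ), ∀ s, Complex.exp (L s) = F (1, s) := by
  let H : C(unitInterval × S, {z : ℂ // z ≠ 0}) := ⟨fun x => ⟨F x, hF x⟩, by fun_prop⟩
  have H0 : ∀ s, H (0, s) =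
      (fun z : ℂ ↦ (⟨_, z.exp_ne_zero⟩ : {z : ℂ // z ≠ 0}))
        ((ContinuousMap.const S (Complex.log c)) s) := by
    intro s
    apply Subtype.ext
    have hc : c ≠ 0 := h0 s ▸ hF (0, s)
    simp [H, h0, Complex.exp_log hc]
  let G := Complex.isCoveringMap_exp.liftHomotopy H _ H0
  refine ⟨⟨fun s => G (1, s), by fun_prop⟩, fun s => ?_⟩
  have := congrFun (Complex.isCoveringMap_exp.liftHomotopy_lifts H _ H0) (1, s)
  exact congrArg Subtype.val this

/-- Two values differ by an integer multiple of 2πi, and the integer depends continuously on the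
point of a connected space; otherwise it would pass through a half. -/
theorem eq_of_continuous_of_exp_eq {X : Type*} [TopologicalSpace X] [PreconnectedSpace X]
    {f : X → ℂ} (hf : Continuous f) (c : ℂ) (h : ∀ x, Complex.exp (f x) = c) (x y : X) :
    f x = f y := by
  let g : X → ℝ := fun t => ((f t - f x) / (2 * Real.pi * Complex.I)).re
  have hg : Continuous g := by
    have : Continuous fun t => (f t - f x) / (2 * Real.pi * Complex.I) := by fun_prop
    exact Complex.continuous_re.comp this
  have key : ∀ t, ∃ n : ℤ, f t - f x = n * (2 * Real.pi * Complex.I) := by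
    intro t
    obtain ⟨n, hn⟩ := Complex.exp_eq_exp_iff_exists_int.1 ((h t).trans (h x).symm)
    exact ⟨n, by rw [hn]; ring⟩
  have hne : (2 * Real.pi * Complex.I : ℂ) ≠ 0 := Complex.two_pi_I_ne_zero
  have hgn : ∀ t (n : ℤ), f t - f x = n * (2 * Real.pi * Complex.I) → g t = n := by
    intro t n hn
    simp only [g, hn, mul_div_assoc, div_self hne]
    simp
  have hr : IsPreconnected (range g) := isPreconnected_range hg
  have hx : g x = 0 := by simp [g]
  obtain ⟨n, hn⟩ := key y
  have hy := hgn y n hn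
  by_contra hxy
  have hn0 : n ≠ 0 := by
    rintro rfl
    apply hxy
    simp only [Int.cast_zero, zero_mul] at hn
    exact (sub_eq_zero.1 hn).symm
  have hmem : ∀ r : ℝ, (r ∈ Icc (g x) (g y) ∨ r ∈ Icc (g y) (g x)) → ∃ m : ℤ, r = m := by
    intro r hr'
    have : r ∈ range g := by
      rcases hr' with h | h
      · exact hr.ordConnected.out (mem_range_self x) (mem_range_self y) h
      · exact hr.ordConnected.out (mem_range_self y) (mem_range_self x) h
    obtain ⟨t, rfl⟩ := this
    obtain ⟨m, hm⟩ := key t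
    exact ⟨m, hgn t m hm⟩
  rcases lt_or_gt_of_ne hn0 with hlt | hgt
  · have : (n : ℝ) ≤ -1 := by exact_mod_cast Int.le_sub_one_of_lt hlt
    obtain ⟨m, hm⟩ := hmem (-1 / 2) (Or.inr ⟨by linarith, by linarith⟩)
    have h2 : ((-1 : ℤ) : ℝ) = ((2 * m : ℤ) : ℝ) := by push_cast; linarith
    have := Int.cast_injective h2
    omega
  · have : (1 : ℝ) ≤ n := by exact_mod_cast hgt
    obtain ⟨m, hm⟩ := hmem (1 / 2) (Or.inl ⟨by linarith, by linarith⟩)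
    have h2 : ((1 : ℤ) : ℝ) = ((2 * m : ℤ) : ℝ) := by push_cast; linarith
    have := Int.cast_injective h2
    omega

/-- Along the circle a logarithm minus iθ would be constant, although θ grows by 2π in one turn. -/
theorem no_log_on_sphere {p : ℂ} {r : ℝ} (hr : 0 < r) {L : ℂ → ℂ}
    (hL : ContinuousOn L (sphere p r)) (h : ∀ z ∈ sphere p r, Complex.exp (L z) = z - p) :
    False := by
  have hmem : ∀ θ : ℝ, p + r * Complex.exp (θ * Complex.I) ∈ sphere p r := by
    intro θ
    simp [Complex.norm_exp_ofReal_mul_I, abs_of_pos hr]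
  have hc : Continuous fun θ : ℝ => L (p + r * Complex.exp (θ * Complex.I)) - θ * Complex.I := by
    refine Continuous.sub ?_ (by fun_prop)
    exact hL.comp_continuous (by fun_prop) hmem
  have := eq_of_continuous_of_exp_eq hc r (by
    intro θ
    rw [Complex.exp_sub, h _ (hmem θ)]
    have := Complex.exp_ne_zero (θ * Complex.I)
    field_simp
    ring) 0 (2 * Real.pi)
  have h2 := Complex.exp_two_pi_mul_I
  push_cast at this
  rw [h2] at this
  simp only [zero_mul, Complex.exp_zero, mul_one, sub_zero] at this
  exact Complex.two_pi_I_ne_zero (by linear_combination this)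

theorem exists_log_slit {z : ℂ} (hz : ‖z‖ < 1) : 1 + z ∈ Complex.slitPlane := by
  left
  have := Complex.abs_re_le_norm z
  have := abs_le.1 this
  simp
  linarith

/-- On the circle z - w = z(1 - w/z), and the second factor has a principal logarithm because |w/z|
< 1. This reduces the claim to w = 0. -/
theorem no_log_sub_on_sphere {w : ℂ} {r : ℝ} (hr : ‖w‖ < r) {L : ℂ → ℂ}
    (hL : ContinuousOn L (sphere 0 r))
    (h : ∀ z ∈ sphere (0 : ℂ) r, Complex.exp (L z) = z - w) : False := by
  have hr0 : 0 < r := (norm_nonneg w).trans_lt hr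
  have hnz : ∀ z ∈ sphere (0 : ℂ) r, z ≠ 0 := by
    rintro z hz rfl
    simp at hz
    linarith
  have hs : ∀ z ∈ sphere (0 : ℂ) r, 1 + -(w / z) ∈ Complex.slitPlane := by
    intro z hz
    apply exists_log_slit
    have : ‖z‖ = r := by simpa using hz
    rw [norm_neg, norm_div, this, div_lt_one hr0]
    exact hr
  apply no_log_on_sphere (p := 0) (r := r) hr0
    (L := fun z => L z - Complex.log (1 + -(w / z)))
  · refine hL.sub ?_
    refine ContinuousOn.clog ?_ hs
    refine continuousOn_const.add (ContinuousOn.neg ?_)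
    exact continuousOn_const.div continuousOn_id hnz
  · intro z hz
    have h1 := hnz z hz
    have h2 := Complex.slitPlane_ne_zero (hs z hz)
    rw [Complex.exp_sub, h z hz, Complex.exp_log h2, div_eq_iff h2]
    field_simp
    ring

/-- There is no map of a disk to itself that fixes the boundary and misses an interior point. -/
theorem no_retraction_missing_point {w : ℂ} {R : ℝ} (hw : ‖w‖ < R) {r : ℂ → ℂ}
    (hr : ContinuousOn r (closedBall 0 R)) (hid : ∀ z ∈ sphere (0 : ℂ) R, r z = z)
    (hmiss : ∀ z ∈ closedBall (0 : ℂ) R, r z ≠ w) : False := by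
  have hR : 0 < R := (norm_nonneg w).trans_lt hw
  have hm : ∀ x : unitInterval × closedBall (0 : ℂ) R,
      ((x.1 : ℝ) : ℂ) * (x.2 : ℂ) ∈ closedBall (0 : ℂ) R := by
    rintro ⟨t, z, hz⟩
    simp only [mem_closedBall, dist_zero_right] at hz ⊢
    rw [norm_mul, Complex.norm_real, Real.norm_of_nonneg t.2.1]
    calc (t : ℝ) * ‖z‖ ≤ 1 * ‖z‖ := by gcongr; exact t.2.2
      _ ≤ R := by simpa using hz
  -- Contracting the disk to its center deforms r - w to a constant without zeros, so r - w has a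
  -- logarithm on the disk. On the boundary circle it would be a logarithm of z - w.
  let F : C(unitInterval × closedBall (0 : ℂ) R, ℂ) :=
    ⟨fun x => r (((x.1 : ℝ) : ℂ) * (x.2 : ℂ)) - w,
      (hr.comp_continuous (by fun_prop) hm).sub continuous_const⟩
  obtain ⟨L, hL⟩ := exists_log_of_homotopy F (fun x => sub_ne_zero.2 (hmiss _ (hm x)))
    (r 0 - w) (by intro s; simp [F])
  classical
  let L' : ℂ → ℂ := fun z => if hz : z ∈ closedBall (0 : ℂ) R then L ⟨z, hz⟩ else 0
  have hL' : ContinuousOn L' (closedBall (0 : ℂ) R) := by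
    rw [continuousOn_iff_continuous_domRestrict]
    convert L.continuous using 1
    ext ⟨z, hz⟩
    simp only [domRestrict_apply, L']
    rw [dif_pos hz]
  apply no_log_sub_on_sphere hw (hL'.mono sphere_subset_closedBall)
  intro z hz
  have hz' := sphere_subset_closedBall hz
  simp only [L']
  rw [dif_pos hz', hL]
  simp [F, hid z hz]

/-- If the complement splits into two open pieces, a large circle lies in one of them. Applying the
retraction on the other piece and fixing everything else gives a continuous map that fixes the
circle and misses a point it encloses. -/
theorem isPreconnected_compl_of_retract {X : Set ℂ} (hX : IsCompact X) {g : ℂ → ℂ}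
    (hg : Continuous g) (hgX : ∀ z, g z ∈ X) (hgid : ∀ z ∈ X, g z = z) : IsPreconnected Xᶜ := by
  by_contra hcon
  have hcl : IsClosed X := hX.isClosed
  obtain ⟨u, v, hu, hv, hcov, hun, hvn, huv⟩ : ∃ u v : Set ℂ, IsOpen u ∧ IsOpen v ∧ Xᶜ ⊆ u ∪ v ∧
      (Xᶜ ∩ u).Nonempty ∧ (Xᶜ ∩ v).Nonempty ∧ ¬ (Xᶜ ∩ (u ∩ v)).Nonempty := by
    unfold IsPreconnected at hcon
    push Not at hcon
    obtain ⟨u, v, h1, h2, h3, h4, h5, h6⟩ := hcon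
    exact ⟨u, v, h1, h2, h3, h4, h5, by rw [h6]; simp⟩
  have main : ∀ u v : Set ℂ, IsOpen u → IsOpen v → Xᶜ ⊆ u ∪ v → ¬ (Xᶜ ∩ (u ∩ v)).Nonempty →
      ∀ w R, ‖w‖ < R → w ∈ Xᶜ ∩ v → sphere 0 R ⊆ u → sphere 0 R ⊆ Xᶜ → False := by
    intro u v hu hv hcov huv w R hwR hw hs hsX
    classical
    have hcl1 : IsClosed (v ∪ X) := by
      have : v ∪ X = (u ∩ Xᶜ)ᶜ := by
        ext z
        by_cases hz : z ∈ X
        · simp [hz]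
        · have h1 := hcov hz
          have h2 : ¬ (z ∈ u ∧ z ∈ v) := fun h => huv ⟨z, hz, h⟩
          simp only [mem_union, hz, or_false, mem_compl_iff, mem_inter_iff, not_false_eq_true,
            and_true]
          constructor
          · exact fun h h' => h2 ⟨h', h⟩
          · exact fun h => h1.resolve_left h
      rw [this]
      exact (hu.inter hcl.isOpen_compl).isClosed_compl
    have hcl2 : IsClosed ((v ∩ Xᶜ)ᶜ) := (hv.inter hcl.isOpen_compl).isClosed_compl
    let r : ℂ → ℂ := fun z => if z ∈ v ∩ Xᶜ then g z else z
    have hr1 : ContinuousOn r (v ∪ X) := by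
      refine hg.continuousOn.congr fun z hz => ?_
      simp only [r]
      split_ifs with h
      · rfl
      · by_cases hzX : z ∈ X
        · exact (hgid z hzX).symm
        · exact absurd ⟨hz.resolve_right hzX, hzX⟩ h
    have hr2 : ContinuousOn r ((v ∩ Xᶜ)ᶜ) := by
      refine continuousOn_id.congr fun z hz => ?_
      simp only [r]
      rw [if_neg hz]
      rfl
    have hr : Continuous r := by
      rw [← continuousOn_univ]
      have : (univ : Set ℂ) = (v ∪ X) ∪ (v ∩ Xᶜ)ᶜ := by
        ext z
        by_cases z ∈ v <;> by_cases z ∈ X <;> simp [*]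
      rw [this]
      exact hr1.union_of_isClosed hr2 hcl1 hcl2
    refine no_retraction_missing_point hwR hr.continuousOn ?_ ?_
    · intro z hz
      simp only [r]
      rw [if_neg]
      exact fun h => huv ⟨z, h.2, hs hz, h.1⟩
    · intro z _
      simp only [r]
      split_ifs with h
      · intro h'
        exact hw.1 (h' ▸ hgX z)
      · rintro rfl
        exact h ⟨hw.2, hw.1⟩
  obtain ⟨w₁, hw₁⟩ := hun
  obtain ⟨w₂, hw₂⟩ := hvn
  obtain ⟨R₀, hR₀⟩ := hX.isBounded.subset_ball (0 : ℂ)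
  set R := max R₀ (max (‖w₁‖ + 1) (‖w₂‖ + 1)) with hR
  have h1 : ‖w₁‖ < R := by
    have : ‖w₁‖ + 1 ≤ R := (le_max_left _ _).trans (le_max_right _ _)
    linarith
  have h2 : ‖w₂‖ < R := by
    have : ‖w₂‖ + 1 ≤ R := (le_max_right _ _).trans (le_max_right _ _)
    linarith
  have hsX : sphere (0 : ℂ) R ⊆ Xᶜ := by
    intro z hz hzX
    have h3 := hR₀ hzX
    have h4 : R₀ ≤ R := le_max_left _ _
    simp only [mem_sphere, dist_zero_right, mem_ball] at hz h3
    linarith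
  have hrank : 1 < Module.rank ℝ ℂ := by
    rw [Complex.rank_real_complex]; exact Cardinal.one_lt_two
  have huv' : Xᶜ ∩ (u ∩ v) = ∅ := Set.not_nonempty_iff_eq_empty.1 huv
  rcases isPreconnected_iff_subset_of_disjoint.1 (isPreconnected_sphere hrank (0 : ℂ) R) u v hu hv
    (hsX.trans hcov) (subset_empty_iff.1 ((inter_subset_inter_left _ hsX).trans huv'.subset))
    with h | h
  · exact main u v hu hv hcov huv w₂ R h2 hw₂ h hsX
  · exact main v u hv hu (by rwa [union_comm]) (by rwa [inter_comm v u]) w₁ R h1 hw₁ h hsX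

/-- An injective image of a compact space with the Tietze extension property does not separate
the plane. -/
theorem isPreconnected_compl_range {D : Type*} [TopologicalSpace D] [CompactSpace D]
    [TietzeExtension.{0} D] {j : D → ℂ} (hj : Continuous j) (hinj : Function.Injective j) :
    IsPreconnected (range j)ᶜ := by
  have he : Topology.IsClosedEmbedding j := hj.isClosedEmbedding hinj
  let e : D ≃ₜ range j := he.isEmbedding.toHomeomorph
  -- The inverse of `j` extends to the plane, and `j` after this extension is a retraction onto the
  -- image.
  obtain ⟨g, hg⟩ := ContinuousMap.exists_restrict_eq he.isClosed_range (e.symm : C(range j, D))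
  refine isPreconnected_compl_of_retract (isCompact_range hj) (g := fun z => j (g z))
    (by fun_prop) (fun z => mem_range_self _) ?_
  rintro _ ⟨x, rfl⟩
  have h1 : g (j x) = e.symm ⟨j x, mem_range_self x⟩ :=
    congrArg (fun f : C(range j, D) => f ⟨j x, mem_range_self x⟩) hg
  have h2 : (⟨j x, mem_range_self x⟩ : range j) = e x := rfl
  simp only [h1, h2, Homeomorph.symm_apply_apply]

/-- Move the pole from p to q along the path: (z - p)/(z - A t) starts as the constant 1 and has
neither zeros nor poles off the path. -/
theorem exists_log_compl_path (A : C(unitInterval, ℂ)) {p q : ℂ} (h0 : A 0 = p) (h1 : A 1 = q) :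
    ∃ L : ℂ → ℂ, ContinuousOn L (range A)ᶜ ∧
      ∀ z ∈ (range A)ᶜ, Complex.exp (L z) = (z - p) / (z - q) := by
  have hne : ∀ x : unitInterval × ((range A)ᶜ : Set ℂ), (x.2 : ℂ) - A x.1 ≠ 0 := by
    rintro ⟨t, z, hz⟩ h
    exact hz ⟨t, (sub_eq_zero.1 h).symm⟩
  have hnp : ∀ x : unitInterval × ((range A)ᶜ : Set ℂ), (x.2 : ℂ) - p ≠ 0 := fun x =>
    h0 ▸ hne (0, x.2)
  let F : C(unitInterval × ((range A)ᶜ : Set ℂ), ℂ) :=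
    ⟨fun x => ((x.2 : ℂ) - p) / ((x.2 : ℂ) - A x.1),
      Continuous.div (by fun_prop) (by fun_prop) hne⟩
  obtain ⟨L, hL⟩ := exists_log_of_homotopy F (fun x => div_ne_zero (hnp x) (hne x)) 1
    (by intro s; simp only [F, ContinuousMap.coe_mk, h0]; exact div_self (hnp (0, s)))
  classical
  refine ⟨fun z => if hz : z ∈ (range A)ᶜ then L ⟨z, hz⟩ else 0, ?_, ?_⟩
  · rw [continuousOn_iff_continuous_domRestrict]
    convert L.continuous using 1
    ext ⟨z, hz⟩
    simp only [domRestrict_apply]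
    rw [dif_pos hz]
  · intro z hz
    beta_reduce
    rw [dif_pos hz, hL]
    simp [F, h1]

/-- Two paths with the same distinct end points that meet only there separate the plane. -/
theorem not_isPreconnected_compl_union_range (A B : C(unitInterval, ℂ)) {p q : ℂ} (hpq : p ≠ q)
    (hA0 : A 0 = p) (hA1 : A 1 = q) (hB0 : B 0 = p) (hB1 : B 1 = q)
    (hAB : range A ∩ range B ⊆ {p, q}) : ¬ IsPreconnected (range A ∪ range B)ᶜ := by
  intro hcon
  obtain ⟨LA, hLA, hLA'⟩ := exists_log_compl_path A hA0 hA1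
  obtain ⟨LB, hLB, hLB'⟩ := exists_log_compl_path B hB0 hB1
  have hoA : IsOpen (range A)ᶜ := (isCompact_range A.continuous).isClosed.isOpen_compl
  have hoB : IsOpen (range B)ᶜ := (isCompact_range B.continuous).isClosed.isOpen_compl
  -- If the complement of both paths were connected, the two logarithms of (z - p)/(z - q) would
  -- differ there by one constant. They would then glue to a logarithm off the intersection of the
  -- paths, that is, at least off p and q.
  have hk : ∃ k : ℂ, Complex.exp k = 1 ∧ ∀ z ∈ (range A ∪ range B)ᶜ, LA z = LB z + k := by
    rcases (range A ∪ range B)ᶜ.eq_empty_or_nonempty with h | ⟨z₀, hz₀⟩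
    · exact ⟨0, by simp, by simp [h]⟩
    · have hsub : (range A ∪ range B)ᶜ = (range A)ᶜ ∩ (range B)ᶜ := compl_union _ _
      have hexp : ∀ z ∈ (range A ∪ range B)ᶜ, Complex.exp (LA z - LB z) = 1 := by
        intro z hz
        rw [hsub] at hz
        rw [Complex.exp_sub, hLA' z hz.1, ← hLB' z hz.2, div_self (Complex.exp_ne_zero _)]
      have : PreconnectedSpace ((range A ∪ range B)ᶜ : Set ℂ) :=
        isPreconnected_iff_preconnectedSpace.1 hcon
      have hc : Continuous fun z : ((range A ∪ range B)ᶜ : Set ℂ) => LA z - LB z := by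
        have : ContinuousOn (fun z => LA z - LB z) (range A ∪ range B)ᶜ := by
          rw [hsub]
          exact (hLA.mono inter_subset_left).sub (hLB.mono inter_subset_right)
        exact continuousOn_iff_continuous_domRestrict.1 this
      refine ⟨LA z₀ - LB z₀, hexp z₀ hz₀, fun z hz => ?_⟩
      have := eq_of_continuous_of_exp_eq hc 1 (fun z => hexp z z.2) ⟨z, hz⟩ ⟨z₀, hz₀⟩
      simp only at this
      linear_combination this
  obtain ⟨k, hk1, hk⟩ := hk
  classical
  let L : ℂ → ℂ := fun z => if z ∈ (range A)ᶜ then LA z else LB z + k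
  have hL : ContinuousOn L ((range A)ᶜ ∪ (range B)ᶜ) := by
    refine ContinuousOn.union_of_isOpen ?_ ?_ hoA hoB
    · exact hLA.congr fun z hz => if_pos hz
    · refine (hLB.add (continuousOn_const (c := k))).congr fun z hz => ?_
      simp only [L]
      split_ifs with h
      · exact hk z (by rw [compl_union]; exact ⟨h, hz⟩)
      · rfl
  have hL' : ∀ z ∈ (range A)ᶜ ∪ (range B)ᶜ, Complex.exp (L z) = (z - p) / (z - q) := by
    intro z hz
    simp only [L]
    split_ifs with h
    · exact hLA' z h
    · rw [Complex.exp_add, hk1, mul_one, hLB' z (hz.resolve_left h)]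
  have hd : 0 < ‖p - q‖ := norm_pos_iff.2 (sub_ne_zero.2 hpq)
  -- On this circle about p the factor z - q has a logarithm as well, since it is p - q times a
  -- number within 1/2 of 1. So z - p would have one.
  set r := ‖p - q‖ / 2 with hr
  have hr0 : 0 < r := by positivity
  have hpq0 : p - q ≠ 0 := sub_ne_zero.2 hpq
  have hslit : ∀ z ∈ sphere p r, 1 + (z - p) / (p - q) ∈ Complex.slitPlane := by
    intro z hz
    apply exists_log_slit
    have : ‖z - p‖ = r := by simpa [dist_eq_norm] using hz
    rw [norm_div, this, div_lt_one hd]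
    linarith
  have hsub : sphere p r ⊆ (range A)ᶜ ∪ (range B)ᶜ := by
    intro z hz
    rw [← compl_inter]
    intro h
    rcases hAB h with rfl | h
    · simp only [mem_sphere, dist_self] at hz
      linarith
    · rw [mem_singleton_iff] at h
      subst h
      rw [mem_sphere, dist_comm, dist_eq_norm] at hz
      linarith
  apply no_log_on_sphere (p := p) hr0
    (L := fun z => L z + Complex.log (1 + (z - p) / (p - q)) + Complex.log (p - q))
  · refine ((hL.mono hsub).add ?_).add continuousOn_const
    refine ContinuousOn.clog ?_ hslit
    fun_prop
  · intro z hz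
    have h1 := Complex.slitPlane_ne_zero (hslit z hz)
    have h2 : z - q ≠ 0 := by
      intro h
      apply h1
      rw [sub_eq_zero.1 h, ← neg_sub p q, neg_div, div_self hpq0]
      simp
    rw [Complex.exp_add, Complex.exp_add, hL' z (hsub hz), Complex.exp_log h1,
      Complex.exp_log hpq0]
    field_simp
    ring

end DiskPatterns

namespace DiskPatterns

open Set Metric

/-! ### The realization of a simplicial complex -/

section Complex

variable {V : Type*} {K : AbstractSimplicialComplex V}

theorem face_of_subset {s t : Finset V} (hs : s ∈ K.faces) (hts : t ⊆ s) (ht : t.Nonempty) :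
    t ∈ K.faces :=
  (K.isRelLowerSet_faces hs).2 hts ht

theorem exists_face_support {x : V → ℝ} (hx : x ∈ realization K) :
    ∃ s ∈ K.faces, ∀ v, 0 < x v → v ∈ s := by
  obtain ⟨-, s, hs, h0, -⟩ := hx
  exact ⟨s, hs, fun v hv => by_contra fun h => hv.ne' (h0 v h)⟩

theorem exists_pos_of_realization {x : V → ℝ} (hx : x ∈ realization K) : ∃ v, 0 < x v := by
  obtain ⟨h, s, hs, h0, h1⟩ := hx
  by_contra hcon
  push Not at hcon
  have : ∑ v ∈ s, x v ≤ 0 := Finset.sum_nonpos fun v _ => hcon v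
  linarith

theorem isOpen_coord_pos (v : V) : IsOpen {x : realization K | 0 < x.1 v} :=
  isOpen_lt continuous_const ((continuous_apply v).comp continuous_subtype_val)

variable [DecidableEq V]

/-- The point with barycentric coordinates `α, β, γ, δ` at the vertices `a, b, c, d`. -/
def bary (a b c d : V) (α β γ δ : ℝ) : V → ℝ := fun v =>
  (if v = a then α else 0) + (if v = b then β else 0) + (if v = c then γ else 0) +
    (if v = d then δ else 0)

/-- The four vertices may coincide; the weights of repeated vertices add up. Vertices, edges and
triangles are all written with the same formula. -/
theorem bary_mem {s : Finset V} (hs : s ∈ K.faces) {a b c d : V} (ha : a ∈ s) (hb : b ∈ s)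
    (hc : c ∈ s) (hd : d ∈ s) {α β γ δ : ℝ} (hα : 0 ≤ α) (hβ : 0 ≤ β) (hγ : 0 ≤ γ) (hδ : 0 ≤ δ)
    (h : α + β + γ + δ = 1) : bary a b c d α β γ δ ∈ realization K := by
  refine ⟨fun v => ?_, s, hs, fun v hv => ?_, ?_⟩
  · unfold bary
    have : ∀ (P : Prop) [Decidable P] (x : ℝ), 0 ≤ x → 0 ≤ if P then x else 0 := by
      intro P _ x hx
      split_ifs <;> simp [hx]
    have h1 := this (v = a) α hα
    have h2 := this (v = b) β hβ
    have h3 := this (v = c) γ hγ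
    have h4 := this (v = d) δ hδ
    linarith
  · have h1 : v ≠ a := fun h => hv (h ▸ ha)
    have h2 : v ≠ b := fun h => hv (h ▸ hb)
    have h3 : v ≠ c := fun h => hv (h ▸ hc)
    have h4 : v ≠ d := fun h => hv (h ▸ hd)
    simp [bary, h1, h2, h3, h4]
  · simp only [bary, Finset.sum_add_distrib, Finset.sum_ite_eq', ha, hb, hc, hd, if_true]
    exact h

theorem continuous_bary {X : Type*} [TopologicalSpace X] (a b c d : V) {f g h k : X → ℝ}
    (hf : Continuous f) (hg : Continuous g) (hh : Continuous h) (hk : Continuous k) :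
    Continuous fun x => bary a b c d (f x) (g x) (h x) (k x) := by
  refine continuous_pi fun v => ?_
  unfold bary
  refine Continuous.add (Continuous.add (Continuous.add ?_ ?_) ?_) ?_ <;> split_ifs <;> fun_prop

theorem realization_sum_eq_one {x : V → ℝ} (hx : x ∈ realization K) {S : Finset V}
    (hS : ∀ v, v ∉ S → x v = 0) : ∑ v ∈ S, x v = 1 := by
  obtain ⟨-, s, -, h0, h1⟩ := hx
  rw [← h1, Finset.sum_subset (Finset.subset_union_left (s₁ := S) (s₂ := s)) fun v _ hv => hS v hv,
    Finset.sum_subset (Finset.subset_union_right (s₁ := S) (s₂ := s)) fun v _ hv => h0 v hv]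

theorem vertex_mem (v : V) : bary v v v v 1 0 0 0 ∈ realization K :=
  bary_mem (K.singleton_mem v) (by simp) (by simp) (by simp) (by simp) zero_le_one le_rfl le_rfl
    le_rfl (by norm_num)

theorem isPreconnected_star (v : V) : IsPreconnected {x : realization K | 0 < x.1 v} := by
  rw [← Topology.IsInducing.subtypeVal.isPreconnected_image]
  refine (StarConvex.isPathConnected (a := bary v v v v 1 0 0 0)
    (s := Subtype.val '' {x : realization K | 0 < x.1 v}) ?_
    ?_).isConnected.isPreconnected
  · rintro _ ⟨⟨x, hx⟩, hxv, rfl⟩ α β hα hβ hαβ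
    obtain ⟨hx0, s, hs, h0, h1⟩ := hx
    have hvs : v ∈ s := by
      by_contra h
      exact (ne_of_gt hxv) (h0 v h)
    refine ⟨⟨_, fun w => ?_, s, hs, fun w hw => ?_, ?_⟩, ?_, rfl⟩
    · have h2 := hx0 w
      have h3 : 0 ≤ bary v v v v 1 0 0 0 w := by
        unfold bary
        split_ifs <;> simp
      simp only [Pi.add_apply, Pi.smul_apply, smul_eq_mul]
      positivity
    · have hwv : w ≠ v := fun h => hw (h ▸ hvs)
      simp [bary, hwv, h0 w hw]
    · simp only [Pi.add_apply, Pi.smul_apply, smul_eq_mul, Finset.sum_add_distrib,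
        ← Finset.mul_sum, h1]
      have : ∑ w ∈ s, bary v v v v 1 0 0 0 w = 1 := by
        simp [bary, Finset.sum_ite_eq', hvs]
      rw [this]
      linarith
    · have : 0 < x v := hxv
      simp only [mem_ofPred_eq, Pi.add_apply, Pi.smul_apply, smul_eq_mul]
      have h3 : bary v v v v 1 0 0 0 v = 1 := by simp [bary]
      rw [h3]
      rcases hα.eq_or_lt with rfl | h
      · rw [zero_add] at hαβ
        subst hαβ
        simpa using this
      · positivity
  · exact ⟨⟨_, vertex_mem v⟩, by simp [bary], rfl⟩

variable {G : SimpleGraph V}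

theorem adj_of_mem_face (hadj : ∀ u v, G.Adj u v ↔ u ≠ v ∧ {u, v} ∈ K.faces)
    {s : Finset V} (hs : s ∈ K.faces) {u v : V} (hu : u ∈ s) (hv : v ∈ s)
    (huv : u ≠ v) : G.Adj u v :=
  (hadj u v).2 ⟨huv, face_of_subset hs (by simp [Finset.insert_subset_iff, hu, hv]) (by simp)⟩

/-- Open stars of distinct nonadjacent vertices are disjoint. So the stars of the vertices reachable
from `x` outside `S` and those of the other vertices outside `S` would disconnect the union. -/
theorem exists_walk_of_isPreconnected (hadj : ∀ u v, G.Adj u v ↔ u ≠ v ∧ {u, v} ∈ K.faces)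
    {S : Set V}
    (h : IsPreconnected {x : realization K | ∃ v, v ∉ S ∧ 0 < x.1 v}) {x y : V} (hx : x ∉ S)
    (hy : y ∉ S) : ∃ p : G.Walk x y, ∀ u ∈ p.support, u ∉ S := by
  by_contra hcon
  let R : Set V := {z | ∃ p : G.Walk x z, ∀ u ∈ p.support, u ∉ S}
  have hRx : x ∈ R := ⟨SimpleGraph.Walk.nil, by simpa using hx⟩
  have hstep : ∀ u v, u ∈ R → v ∉ S → G.Adj u v → v ∈ R := by
    rintro u v ⟨p, hp⟩ hv huv
    refine ⟨p.concat huv, fun w hw => ?_⟩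
    rw [SimpleGraph.Walk.support_concat, List.mem_append,
      List.mem_singleton] at hw
    rcases hw with hw | rfl
    · exact hp w hw
    · exact hv
  let O₁ : Set (realization K) := ⋃ v ∈ {v | v ∈ R ∧ v ∉ S}, {x | 0 < x.1 v}
  let O₂ : Set (realization K) := ⋃ v ∈ {v | v ∉ R ∧ v ∉ S}, {x | 0 < x.1 v}
  have ho₁ : IsOpen O₁ := isOpen_biUnion fun v _ => isOpen_coord_pos v
  have ho₂ : IsOpen O₂ := isOpen_biUnion fun v _ => isOpen_coord_pos v
  have hpt : ∀ v, (⟨_, vertex_mem v⟩ : realization K) ∈ {x : realization K | 0 < x.1 v} := by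
    intro v
    simp [bary]
  obtain ⟨⟨z, hz⟩, -, hz1, hz2⟩ := h O₁ O₂ ho₁ ho₂ (by
    rintro z ⟨v, hv, hzv⟩
    by_cases hvR : v ∈ R
    · exact Or.inl (mem_biUnion (x := v) ⟨hvR, hv⟩ hzv)
    · exact Or.inr (mem_biUnion (x := v) ⟨hvR, hv⟩ hzv))
    ⟨_, ⟨x, hx, hpt x⟩, mem_biUnion (x := x) ⟨hRx, hx⟩ (hpt x)⟩
    ⟨_, ⟨y, hy, hpt y⟩, mem_biUnion (x := y) ⟨hcon, hy⟩ (hpt y)⟩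
  simp only [O₁, O₂, mem_iUnion] at hz1 hz2
  obtain ⟨u, ⟨hu, huS⟩, hzu⟩ := hz1
  obtain ⟨v, ⟨hv, hvS⟩, hzv⟩ := hz2
  obtain ⟨s, hs, hsup⟩ := exists_face_support hz
  have huv : u ≠ v := by
    rintro rfl
    exact hv hu
  exact hv (hstep u v hu hvS (adj_of_mem_face hadj hs (hsup u hzu) (hsup v hzv) huv))

/-- Stars are connected, and the stars of the two ends of an edge share its midpoint. -/
theorem isPreconnected_of_walks (hadj : ∀ u v, G.Adj u v ↔ u ≠ v ∧ {u, v} ∈ K.faces)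
    {S : Set V}
    (h : ∀ x y, x ∉ S → y ∉ S → ∃ p : G.Walk x y, ∀ u ∈ p.support, u ∉ S) :
    IsPreconnected {x : realization K | ∃ v, v ∉ S ∧ 0 < x.1 v} := by
  have : {x : realization K | ∃ v, v ∉ S ∧ 0 < x.1 v} =
      ⋃ v ∈ Sᶜ, {x : realization K | 0 < x.1 v} := by
    ext x
    simp
  rw [this]
  refine IsPreconnected.biUnion_of_reflTransGen (fun v _ => isPreconnected_star v) ?_
  intro x hx y hy
  obtain ⟨p, hp⟩ := h x y hx hy
  clear hy this
  induction p with
  | nil => exact Relation.ReflTransGen.refl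
  | @cons u v w huv p ih =>
    have hv : v ∉ S := hp v (by simp)
    refine Relation.ReflTransGen.head ⟨?_, hx⟩ (ih hv fun z hz => hp z (by simp [hz]))
    obtain ⟨hne, hf⟩ := (hadj u v).1 huv
    refine ⟨⟨bary u v v v (1 / 2) (1 / 2) 0 0, bary_mem hf (by simp) (by simp) (by simp) (by simp)
      (by norm_num) (by norm_num) le_rfl le_rfl (by norm_num)⟩, ?_, ?_⟩
    · simp [bary, hne]
    · simp [bary, hne.symm]

end Complex

end DiskPatterns

/-! ### Triangles, arcs and separation in the realization -/

namespace DiskPatterns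

open Set Metric

/-- The standard triangle in `ℝ × ℝ`. -/
abbrev StdTriangle : Type := {p : ℝ × ℝ // 0 ≤ p.1 ∧ 0 ≤ p.2 ∧ p.1 + p.2 ≤ 1}

instance : CompactSpace StdTriangle := by
  refine isCompact_iff_compactSpace (s := {p : ℝ × ℝ | 0 ≤ p.1 ∧ 0 ≤ p.2 ∧ p.1 + p.2 ≤ 1}).1 ?_
  refine (isCompact_Icc (a := ((0, 0) : ℝ × ℝ)) (b := (1, 1))).of_isClosed_subset ?_ ?_
  · exact (isClosed_le continuous_const continuous_fst).inter
      ((isClosed_le continuous_const continuous_snd).inter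
        (isClosed_le (continuous_fst.add continuous_snd) continuous_const))
  · rintro ⟨x, y⟩ ⟨h1, h2, h3⟩
    simp only at h1 h2 h3
    exact ⟨⟨h1, h2⟩, ⟨by simp only; linarith, by simp only; linarith⟩⟩

instance : TietzeExtension.{0} StdTriangle := by
  -- Clamping the first coordinate to [0, 1] and then the second to [0, 1 - x], where x is the
  -- clamped first, retracts the plane onto the triangle.
  let r : ℝ × ℝ → ℝ × ℝ := fun p =>
    (min (max p.1 0) 1, min (max p.2 0) (1 - min (max p.1 0) 1))
  refine TietzeExtension.of_retract (Z := ℝ × ℝ) ⟨Subtype.val, continuous_subtype_val⟩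
    ⟨fun p => ⟨r p, ?_, ?_, ?_⟩, ?_⟩ ?_
  · exact le_min (le_max_right _ _) zero_le_one
  · exact le_min (le_max_right _ _) (sub_nonneg.2 (min_le_right _ _))
  · have := min_le_right (max p.2 0) (1 - min (max p.1 0) 1)
    simp only [r]
    linarith
  · exact Continuous.subtype_mk (by fun_prop) _
  · ext ⟨⟨x, y⟩, h1, h2, h3⟩
    · simp only at h1 h2 h3
      have : x ≤ 1 := by linarith
      simp [r, h1, this]
    · simp only at h1 h2 h3
      have : x ≤ 1 := by linarith
      have : y ≤ 1 - x := by linarith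
      simp [r, *]

section Complex

variable {V : Type*} {K : AbstractSimplicialComplex V}

theorem isPreconnected_compl_range_realization (Ψ : realization K ≃ₜ ℂ) {D : Type*}
    [TopologicalSpace D] [CompactSpace D] [TietzeExtension.{0} D] {j : D → realization K}
    (hj : Continuous j) (hinj : Function.Injective j) : IsPreconnected (range j)ᶜ := by
  rw [← Ψ.isPreconnected_image, image_compl_eq Ψ.bijective, ← range_comp]
  exact isPreconnected_compl_range (Ψ.continuous.comp hj) (Ψ.injective.comp hinj)

theorem not_isPreconnected_compl_union_range_realization (Ψ : realization K ≃ₜ ℂ)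
    (A B : C(unitInterval, realization K)) {p q : realization K} (hpq : p ≠ q)
    (hA0 : A 0 = p) (hA1 : A 1 = q) (hB0 : B 0 = p) (hB1 : B 1 = q)
    (hAB : range A ∩ range B ⊆ {p, q}) : ¬ IsPreconnected (range A ∪ range B)ᶜ := by
  rw [← Ψ.isPreconnected_image, image_compl_eq Ψ.bijective, image_union, ← range_comp, ← range_comp]
  let ψ : C(realization K, ℂ) := ⟨Ψ, Ψ.continuous⟩
  refine not_isPreconnected_compl_union_range (ψ.comp A) (ψ.comp B) (p := Ψ p) (q := Ψ q)
    (Ψ.injective.ne hpq) (by simp [ψ, hA0]) (by simp [ψ, hA1]) (by simp [ψ, hB0])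
    (by simp [ψ, hB1]) ?_
  have : range (ψ.comp A) ∩ range (ψ.comp B) = Ψ '' (range A ∩ range B) := by
    rw [image_inter Ψ.injective, ← range_comp, ← range_comp]
    rfl
  rw [this]
  refine (image_mono hAB).trans ?_
  rw [image_pair]

variable [DecidableEq V]

/-- The boundary of a triangle spanned by edges separates the realization. -/
theorem not_isPreconnected_compl_triangle (Ψ : realization K ≃ₜ ℂ) {a b c : V} (hab : a ≠ b)
    (hbc : b ≠ c) (hca : c ≠ a) (fab : {a, b} ∈ K.faces) (fbc : {b, c} ∈ K.faces)
    (fca : {c, a} ∈ K.faces) :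
    ¬ IsPreconnected {x : realization K |
      (∀ v, v ∉ ({a, b, c} : Finset V) → x.1 v = 0) ∧ (x.1 a = 0 ∨ x.1 b = 0 ∨ x.1 c = 0)}ᶜ := by
  let A : C(unitInterval, realization K) :=
    ⟨fun t => ⟨bary a b b b (1 - t) t 0 0, bary_mem fab (by simp) (by simp) (by simp) (by simp)
      (by linarith [t.2.2]) t.2.1 le_rfl le_rfl (by ring)⟩,
      Continuous.subtype_mk (continuous_bary _ _ _ _ (by fun_prop) (by fun_prop) (by fun_prop)
        (by fun_prop)) _⟩
  -- The second path runs from `a` to `c` in the first half of the time and on to `b` in the second;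
  -- `f` and `g` are the weights of `a` and `b`.
  let f : unitInterval → ℝ := fun t => max 0 (1 - 2 * t)
  let g : unitInterval → ℝ := fun t => max 0 (2 * t - 1)
  have hB : ∀ t : unitInterval,
      bary a b c c (f t) (g t) (1 - f t - g t) 0 ∈ realization K := by
    intro t
    rcases le_total (t : ℝ) (1 / 2) with h | h
    · have hg : g t = 0 := max_eq_left (by linarith)
      have hf : f t = 1 - 2 * t := max_eq_right (by linarith)
      have : bary a b c c (f t) (g t) (1 - f t - g t) 0 = bary a a c c (f t) 0 (1 - f t) 0 := by
        funext v
        simp [bary, hg]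
      rw [this, hf]
      exact bary_mem fca (by simp) (by simp) (by simp) (by simp) (by linarith) le_rfl
        (by linarith [t.2.1]) le_rfl (by ring)
    · have hg : g t = 2 * t - 1 := max_eq_right (by linarith)
      have hf : f t = 0 := max_eq_left (by linarith)
      have : bary a b c c (f t) (g t) (1 - f t - g t) 0 = bary b b c c (g t) 0 (1 - g t) 0 := by
        funext v
        simp [bary, hf]
      rw [this, hg]
      exact bary_mem fbc (by simp) (by simp) (by simp) (by simp) (by linarith) le_rfl
        (by linarith [t.2.2]) le_rfl (by ring)
  let B : C(unitInterval, realization K) :=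
    ⟨fun t => ⟨bary a b c c (f t) (g t) (1 - f t - g t) 0, hB t⟩,
      Continuous.subtype_mk (continuous_bary _ _ _ _ (by fun_prop) (by fun_prop) (by fun_prop)
        (by fun_prop)) _⟩
  have hac := hca.symm
  have hba := hab.symm
  have hcb := hbc.symm
  have hpq : (⟨_, vertex_mem a⟩ : realization K) ≠ ⟨_, vertex_mem b⟩ := by
    intro h
    have := congrFun (congrArg Subtype.val h) a
    simp [bary, hab] at this
  have key := not_isPreconnected_compl_union_range_realization Ψ A B hpq ?_ ?_ ?_ ?_ ?_
  · convert key using 2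
    congr 1
    ext ⟨x, hx⟩
    simp only [mem_ofPred_eq, mem_union, mem_range]
    constructor
    · rintro ⟨h0, h1⟩
      have hsum := realization_sum_eq_one hx h0
      rw [Finset.sum_insert (by simp [hab, hac]), Finset.sum_pair hbc] at hsum
      have hxa := hx.1 a
      have hxb := hx.1 b
      have hxc := hx.1 c
      rcases h1 with h1 | h1 | h1
      · right
        refine ⟨⟨(1 + x b) / 2, by constructor <;> linarith⟩, Subtype.ext (funext fun v => ?_)⟩
        have hf : max (0 : ℝ) (1 - 2 * ((1 + x b) / 2)) = 0 := max_eq_left (by linarith)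
        have hg : max (0 : ℝ) (2 * ((1 + x b) / 2) - 1) = x b := by
          rw [max_eq_right] <;> linarith
        by_cases hva : v = a
        · subst hva; simp [B, bary, f, hf, hab, hac, h1]
        by_cases hvb : v = b
        · subst hvb; simp [B, bary, g, hg, hba, hbc]
        by_cases hvc : v = c
        · subst hvc
          simp only [B, bary, f, g, hf, hg, ContinuousMap.coe_mk, hca, hcb, if_false, if_true]
          linarith
        · have := h0 v (by simp [hva, hvb, hvc])
          simp [B, bary, hva, hvb, hvc, this]
      · right
        refine ⟨⟨(1 - x a) / 2, by constructor <;> linarith⟩, Subtype.ext (funext fun v => ?_)⟩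
        have hg : max (0 : ℝ) (2 * ((1 - x a) / 2) - 1) = 0 := max_eq_left (by linarith)
        have hf : max (0 : ℝ) (1 - 2 * ((1 - x a) / 2)) = x a := by
          rw [max_eq_right] <;> linarith
        by_cases hva : v = a
        · subst hva; simp [B, bary, f, hf, hab, hac]
        by_cases hvb : v = b
        · subst hvb; simp [B, bary, g, hg, hba, hbc, h1]
        by_cases hvc : v = c
        · subst hvc
          simp only [B, bary, f, g, hf, hg, ContinuousMap.coe_mk, hca, hcb, if_false, if_true]
          linarith
        · have := h0 v (by simp [hva, hvb, hvc])
          simp [B, bary, hva, hvb, hvc, this]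
      · left
        refine ⟨⟨x b, by constructor <;> linarith⟩, Subtype.ext (funext fun v => ?_)⟩
        by_cases hva : v = a
        · subst hva
          simp only [A, bary, ContinuousMap.coe_mk, hab, if_false, if_true]
          linarith
        by_cases hvb : v = b
        · subst hvb; simp [A, bary, hba]
        · simp only [A, bary, ContinuousMap.coe_mk, hva, hvb, if_false]
          by_cases hvc : v = c
          · rw [hvc, h1]; simp
          · rw [h0 v (by simp [hva, hvb, hvc])]; simp
    · rintro (⟨t, ht⟩ | ⟨t, ht⟩)
      · have ht' : bary a b b b (1 - t) t 0 0 = x := congrArg Subtype.val ht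
        subst ht'
        refine ⟨fun v hv => ?_, Or.inr (Or.inr ?_)⟩
        · simp only [Finset.mem_insert, Finset.mem_singleton, not_or] at hv
          simp [bary, hv]
        · simp [bary, hca, hcb]
      · have ht' : bary a b c c (f t) (g t) (1 - f t - g t) 0 = x := congrArg Subtype.val ht
        subst ht'
        refine ⟨fun v hv => ?_, ?_⟩
        · simp only [Finset.mem_insert, Finset.mem_singleton, not_or] at hv
          simp [bary, hv]
        · rcases le_total (t : ℝ) (1 / 2) with h | h
          · exact Or.inr (Or.inl (by simp only [bary, hba, hbc, if_true, if_false, g]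
                                     rw [max_eq_left (by linarith)]; simp))
          · exact Or.inl (by simp only [bary, hab, hac, if_true, if_false, f]
                             rw [max_eq_left (by linarith)]; simp)
  · apply Subtype.ext
    funext v
    simp [A, bary]
  · apply Subtype.ext
    funext v
    simp [A, bary]
  · apply Subtype.ext
    funext v
    simp [B, bary, f, g]
  · apply Subtype.ext
    funext v
    have h1 : f 1 = 0 := max_eq_left (by norm_num)
    have h2 : g 1 = 1 := by simp only [g]; norm_num
    simp [B, bary, h1, h2]
  · rintro _ ⟨⟨t, rfl⟩, ⟨s, hs⟩⟩
    have h1 : bary a b c c (f s) (g s) (1 - f s - g s) 0 = bary a b b b (1 - t) t 0 0 :=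
      congrArg Subtype.val hs
    have hc := congrFun h1 c
    simp only [bary, hca, hcb, if_true, if_false] at hc
    have ha := congrFun h1 a
    simp only [bary, hab, hac, if_true, if_false] at ha
    have ht : (t : ℝ) = 0 ∨ (t : ℝ) = 1 := by
      rcases le_total (s : ℝ) (1 / 2) with h | h
      · have hg : g s = 0 := max_eq_left (by linarith)
        left; linarith
      · have hf : f s = 0 := max_eq_left (by linarith)
        right; linarith
    rcases ht with ht | ht
    · left
      apply Subtype.ext
      funext v
      simp [A, bary, ht]
    · right
      apply Subtype.ext
      funext v
      simp [A, bary, ht]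

end Complex

end DiskPatterns

/-! ### Faces and edges of a triangulated plane -/

namespace DiskPatterns

open Set Metric

section Complex

variable {V : Type*} [DecidableEq V] {K : AbstractSimplicialComplex V}

/-- A finite complex has a compact realization, and the plane is not compact. -/
theorem infinite_of_homeomorph_plane (Ψ : realization K ≃ₜ ℂ) : Infinite V := by
  by_contra hfin
  rw [not_infinite_iff_finite] at hfin
  have := Fintype.ofFinite V
  have hc : IsCompact (realization K) := by
    have : realization K = ⋃ s ∈ K.faces,
        {x : V → ℝ | (∀ v, 0 ≤ x v) ∧ (∀ v, v ∉ s → x v = 0) ∧ ∑ v ∈ s, x v = 1} := by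
      ext x
      simp only [realization, mem_ofPred_eq, mem_iUnion, exists_prop]
      constructor
      · rintro ⟨h, s, hs, h1, h2⟩
        exact ⟨s, hs, h, h1, h2⟩
      · rintro ⟨s, hs, h, h1, h2⟩
        exact ⟨h, s, hs, h1, h2⟩
    rw [this]
    refine (toFinite _).isCompact_biUnion fun s _ => ?_
    refine (isCompact_Icc (a := (0 : V → ℝ)) (b := 1)).of_isClosed_subset ?_ ?_
    · have h1 : IsClosed {x : V → ℝ | ∀ v, 0 ≤ x v} := by
        simp only [ofPred_forall]
        exact isClosed_iInter fun v => isClosed_le continuous_const (continuous_apply v)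
      have h2 : IsClosed {x : V → ℝ | ∀ v, v ∉ s → x v = 0} := by
        simp only [ofPred_forall]
        exact isClosed_iInter fun v => isClosed_iInter fun _ =>
          isClosed_eq (continuous_apply v) continuous_const
      have h3 : IsClosed {x : V → ℝ | ∑ v ∈ s, x v = 1} :=
        isClosed_eq (by fun_prop) continuous_const
      exact h1.inter (h2.inter h3)
    · rintro x ⟨h1, h2, h3⟩
      refine ⟨fun v => h1 v, fun v => ?_⟩
      by_cases hv : v ∈ s
      · calc x v ≤ ∑ w ∈ s, x w := Finset.single_le_sum (fun w _ => h1 w) hv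
          _ = 1 := h3
      · rw [h2 v hv]
        exact zero_le_one
  have : CompactSpace (realization K) := isCompact_iff_compactSpace.1 hc
  have h2 : CompactSpace ℂ := Ψ.compactSpace
  exact noncompact_univ ℂ h2.isCompact_univ

/-- The complement of a closed triangle in the realization is connected. -/
theorem isPreconnected_compl_face (Ψ : realization K ≃ₜ ℂ) {a b c : V} (hab : a ≠ b)
    (hbc : b ≠ c) (hca : c ≠ a) (f : {a, b, c} ∈ K.faces) :
    IsPreconnected {x : realization K | ∀ v, v ∉ ({a, b, c} : Finset V) → x.1 v = 0}ᶜ := by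
  let j : StdTriangle → realization K := fun p =>
    ⟨bary a b c c p.1.1 p.1.2 (1 - p.1.1 - p.1.2) 0, bary_mem f (by simp) (by simp) (by simp)
      (by simp) p.2.1 p.2.2.1 (by linarith [p.2.2.2]) le_rfl (by ring)⟩
  have hac := hca.symm
  have hba := hab.symm
  have hcb := hbc.symm
  have hj : Continuous j := Continuous.subtype_mk (continuous_bary _ _ _ _ (by fun_prop)
    (by fun_prop) (by fun_prop) (by fun_prop)) _
  have hinj : Function.Injective j := by
    rintro ⟨⟨x, y⟩, _⟩ ⟨⟨x', y'⟩, _⟩ h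
    have h1 := congrFun (congrArg Subtype.val h) a
    have h2 := congrFun (congrArg Subtype.val h) b
    simp only [j, bary, hab, hac, hba, hbc, if_true, if_false] at h1 h2
    ext
    · simpa using h1
    · simpa using h2
  convert isPreconnected_compl_range_realization Ψ hj hinj using 2
  ext ⟨x, hx⟩
  simp only [mem_ofPred_eq, mem_range]
  constructor
  · intro h0
    have hsum := realization_sum_eq_one hx h0
    rw [Finset.sum_insert (by simp [hab, hac]), Finset.sum_pair hbc] at hsum
    refine ⟨⟨(x a, x b), hx.1 a, hx.1 b, by simp only; linarith [hx.1 c]⟩,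
      Subtype.ext (funext fun v => ?_)⟩
    by_cases hva : v = a
    · subst hva; simp [j, bary, hab, hac]
    by_cases hvb : v = b
    · subst hvb; simp [j, bary, hba, hbc]
    by_cases hvc : v = c
    · subst hvc
      simp only [j, bary, hca, hcb, if_false, if_true]
      linarith
    · have := h0 v (by simp [hva, hvb, hvc])
      simp [j, bary, hva, hvb, hvc, this]
  · rintro ⟨p, hp⟩ v hv
    have hp' : bary a b c c p.1.1 p.1.2 (1 - p.1.1 - p.1.2) 0 = x := congrArg Subtype.val hp
    subst hp'
    simp only [Finset.mem_insert, Finset.mem_singleton, not_or] at hv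
    simp [bary, hv]

/-- The union of three triangles with a common vertex `d` does not separate the realization. -/
theorem isPreconnected_compl_cone (Ψ : realization K ≃ₜ ℂ) {a b c d : V} (hab : a ≠ b)
    (hbc : b ≠ c) (hca : c ≠ a) (hda : d ≠ a) (hdb : d ≠ b) (hdc : d ≠ c)
    (fa : {b, c, d} ∈ K.faces) (fb : {c, a, d} ∈ K.faces) (fc : {a, b, d} ∈ K.faces) :
    IsPreconnected {x : realization K | (∀ v, v ∉ ({a, b, c, d} : Finset V) → x.1 v = 0) ∧
      (x.1 a = 0 ∨ x.1 b = 0 ∨ x.1 c = 0)}ᶜ := by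
  -- The three triangles are the subdivision of a single one with barycenter `d`: the common part
  -- `m` of its three barycentric coordinates is removed from each and given to `d` as weight 3m.
  let m : StdTriangle → ℝ := fun p => min (min p.1.1 p.1.2) (1 - p.1.1 - p.1.2)
  have hm1 : ∀ p, m p ≤ p.1.1 := fun p => (min_le_left _ _).trans (min_le_left _ _)
  have hm2 : ∀ p, m p ≤ p.1.2 := fun p => (min_le_left _ _).trans (min_le_right _ _)
  have hm3 : ∀ p, m p ≤ 1 - p.1.1 - p.1.2 := fun p => min_le_right _ _
  have hm0 : ∀ p, 0 ≤ m p := fun p =>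
    le_min (le_min p.2.1 p.2.2.1) (by linarith [p.2.2.2])
  have hm : ∀ p, m p = p.1.1 ∨ m p = p.1.2 ∨ m p = 1 - p.1.1 - p.1.2 := by
    intro p
    simp only [m]
    rcases min_choice (min p.1.1 p.1.2) (1 - p.1.1 - p.1.2) with h | h
    · rw [h]
      rcases min_choice p.1.1 p.1.2 with h' | h' <;> simp [h']
    · exact Or.inr (Or.inr h)
  have hac := hca.symm
  have hba := hab.symm
  have hcb := hbc.symm
  have had := hda.symm
  have hbd := hdb.symm
  have hcd := hdc.symm
  have hmem : ∀ p, bary a b c d (p.1.1 - m p) (p.1.2 - m p) (1 - p.1.1 - p.1.2 - m p) (3 * m p) ∈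
      realization K := by
    intro p
    have h1 := hm1 p
    have h2 := hm2 p
    have h3 := hm3 p
    have h0 := hm0 p
    rcases hm p with h | h | h
    · have : bary a b c d (p.1.1 - m p) (p.1.2 - m p) (1 - p.1.1 - p.1.2 - m p) (3 * m p) =
          bary b b c d 0 (p.1.2 - m p) (1 - p.1.1 - p.1.2 - m p) (3 * m p) := by
        funext v
        simp [bary, h]
      rw [this]
      exact bary_mem fa (by simp) (by simp) (by simp) (by simp) le_rfl (by linarith) (by linarith)
        (by linarith) (by linarith)
    · have : bary a b c d (p.1.1 - m p) (p.1.2 - m p) (1 - p.1.1 - p.1.2 - m p) (3 * m p) =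
          bary a a c d (p.1.1 - m p) 0 (1 - p.1.1 - p.1.2 - m p) (3 * m p) := by
        funext v
        simp [bary, h]
      rw [this]
      exact bary_mem fb (by simp) (by simp) (by simp) (by simp) (by linarith) le_rfl (by linarith)
        (by linarith) (by linarith)
    · have : bary a b c d (p.1.1 - m p) (p.1.2 - m p) (1 - p.1.1 - p.1.2 - m p) (3 * m p) =
          bary a b b d (p.1.1 - m p) (p.1.2 - m p) 0 (3 * m p) := by
        funext v
        simp [bary, h]
      rw [this]
      exact bary_mem fc (by simp) (by simp) (by simp) (by simp) (by linarith) (by linarith) le_rfl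
        (by linarith) (by linarith)
  let j : StdTriangle → realization K := fun p => ⟨_, hmem p⟩
  have hmc : Continuous m := by fun_prop
  have hj : Continuous j := Continuous.subtype_mk (continuous_bary _ _ _ _ (by fun_prop)
    (by fun_prop) (by fun_prop) (by fun_prop)) _
  have hinj : Function.Injective j := by
    intro p q h
    have h1 := congrFun (congrArg Subtype.val h) a
    have h2 := congrFun (congrArg Subtype.val h) b
    have h3 := congrFun (congrArg Subtype.val h) d
    simp only [j, bary, hab, hac, hba, hbc, had, hbd, hda, hdb, hdc, if_true, if_false] at h1 h2 h3
    ext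
    · linarith
    · linarith
  convert isPreconnected_compl_range_realization Ψ hj hinj using 2
  ext ⟨x, hx⟩
  simp only [mem_ofPred_eq, mem_range]
  constructor
  · rintro ⟨h0, h1⟩
    have hsum := realization_sum_eq_one hx h0
    rw [Finset.sum_insert (by simp [hab, hac, had]), Finset.sum_insert (by simp [hbc, hbd]),
      Finset.sum_pair hcd] at hsum
    have ha := hx.1 a
    have hb := hx.1 b
    have hc := hx.1 c
    have hd := hx.1 d
    refine ⟨⟨(x a + x d / 3, x b + x d / 3), by simp only; linarith, by simp only; linarith,
      by simp only; linarith⟩, Subtype.ext ?_⟩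
    have hmv : min (min (x a + x d / 3) (x b + x d / 3))
        (1 - (x a + x d / 3) - (x b + x d / 3)) = x d / 3 := by
      have e : 1 - (x a + x d / 3) - (x b + x d / 3) = x c + x d / 3 := by linarith
      rw [e]
      apply le_antisymm
      · rcases h1 with h | h | h
        · exact (min_le_left _ _).trans ((min_le_left _ _).trans (by linarith))
        · exact (min_le_left _ _).trans ((min_le_right _ _).trans (by linarith))
        · exact (min_le_right _ _).trans (by linarith)
      · exact le_min (le_min (by linarith) (by linarith)) (by linarith)
    funext v
    simp only [j, m, hmv]
    by_cases hva : v = a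
    · subst hva; simp [bary, hab, hac, had]
    by_cases hvb : v = b
    · subst hvb; simp [bary, hba, hbc, hbd]
    by_cases hvc : v = c
    · subst hvc
      simp only [bary, hca, hcb, hcd, if_false, if_true]
      linarith
    by_cases hvd : v = d
    · subst hvd
      simp only [bary, hda, hdb, hdc, if_false, if_true]
      linarith
    · have := h0 v (by simp [hva, hvb, hvc, hvd])
      simp [bary, hva, hvb, hvc, hvd, this]
  · rintro ⟨p, hp⟩
    have hp' : bary a b c d (p.1.1 - m p) (p.1.2 - m p) (1 - p.1.1 - p.1.2 - m p) (3 * m p) = x :=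
      congrArg Subtype.val hp
    subst hp'
    refine ⟨fun v hv => ?_, ?_⟩
    · simp only [Finset.mem_insert, Finset.mem_singleton, not_or] at hv
      simp [bary, hv]
    · rcases hm p with h | h | h
      · left; simp [bary, hab, hac, had, h]
      · right; left; simp [bary, hba, hbc, hbd, h]
      · right; right; simp [bary, hca, hcb, hcd, h]

/-- The four triangles of a tetrahedron are not all faces. -/
theorem not_tetrahedron (Ψ : realization K ≃ₜ ℂ) {a b c d : V} (hab : a ≠ b)
    (hbc : b ≠ c) (hca : c ≠ a) (hda : d ≠ a) (hdb : d ≠ b) (hdc : d ≠ c)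
    (f : {a, b, c} ∈ K.faces)
    (fa : {b, c, d} ∈ K.faces) (fb : {c, a, d} ∈ K.faces) (fc : {a, b, d} ∈ K.faces) : False := by
  refine not_isPreconnected_compl_triangle Ψ hab hbc hca
    (face_of_subset f (by simp [Finset.insert_subset_iff]) (by simp))
    (face_of_subset f (by simp) (by simp))
    (face_of_subset f (by simp [Finset.insert_subset_iff]) (by simp)) ?_
  have := infinite_of_homeomorph_plane Ψ
  obtain ⟨e, he⟩ := Infinite.exists_notMem_finset ({a, b, c, d} : Finset V)
  have he' := he
  simp only [Finset.mem_insert, Finset.mem_singleton, not_or] at he'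
  obtain ⟨hea, heb, hec, hed⟩ := he'
  have hpos : bary e e e e 1 0 0 0 e ≠ 0 := by simp [bary]
  -- The face `abc` and the cone over its boundary with apex `d` meet exactly in that boundary. Its
  -- complement is therefore the union of two connected sets that share the vertex `e`, although a
  -- triangle separates.
  convert IsPreconnected.union (⟨_, vertex_mem e⟩ : realization K) ?_ ?_
    (isPreconnected_compl_face Ψ hab hbc hca f)
    (isPreconnected_compl_cone Ψ hab hbc hca hda hdb hdc fa fb fc) using 1
  · rw [← compl_inter]
    congr 1
    ext x
    simp only [mem_ofPred_eq, mem_inter_iff]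
    constructor
    · rintro ⟨h1, h2⟩
      exact ⟨h1, fun v hv => h1 v fun h => hv (by
        simp only [Finset.mem_insert, Finset.mem_singleton] at h ⊢; tauto), h2⟩
    · rintro ⟨h1, -, h2⟩
      exact ⟨h1, h2⟩
  · intro h
    exact hpos (h e (by simp [hea, heb, hec]))
  · intro h
    exact hpos (h.1 e he)

/-- Removing the vertices of a triangle of the complex does not disconnect the graph. -/
theorem exists_walk_avoiding_face (Ψ : realization K ≃ₜ ℂ) {G : SimpleGraph V}
    (hadj : ∀ u v, G.Adj u v ↔ u ≠ v ∧ {u, v} ∈ K.faces) {a b c : V} (hab : a ≠ b)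
    (hbc : b ≠ c) (hca : c ≠ a) (f : {a, b, c} ∈ K.faces) {x y : V}
    (hx : x ∉ ({a, b, c} : Set V)) (hy : y ∉ ({a, b, c} : Set V)) :
    ∃ p : G.Walk x y, ∀ u ∈ p.support, u ∉ ({a, b, c} : Set V) := by
  refine exists_walk_of_isPreconnected hadj ?_ hx hy
  convert isPreconnected_compl_face Ψ hab hbc hca f using 1
  ext z
  simp only [mem_ofPred_eq, mem_compl_iff, not_forall]
  constructor
  · rintro ⟨v, hv, hz⟩
    exact ⟨v, by simpa using hv, hz.ne'⟩
  · rintro ⟨v, hv, hz⟩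
    exact ⟨v, by simpa using hv, lt_of_le_of_ne (z.2.1 v) (Ne.symm hz)⟩

theorem connected_of_homeomorph_plane (Ψ : realization K ≃ₜ ℂ) {G : SimpleGraph V}
    (hadj : ∀ u v, G.Adj u v ↔ u ≠ v ∧ {u, v} ∈ K.faces) (x y : V) : Nonempty (G.Walk x y) := by
  obtain ⟨p, -⟩ := exists_walk_of_isPreconnected hadj (S := ∅) (x := x) (y := y) (by
    have : {z : realization K | ∃ v, v ∉ (∅ : Set V) ∧ 0 < z.1 v} = univ := by
      ext z
      simpa using exists_pos_of_realization z.2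
    rw [this, ← Ψ.isPreconnected_image, image_univ, Ψ.surjective.range_eq]
    exact isPreconnected_univ) (by simp) (by simp)
  exact ⟨p⟩

/-- A triangle of the graph that does not separate the vertices is a face. -/
theorem face_of_not_separatesVertices (Ψ : realization K ≃ₜ ℂ) {G : SimpleGraph V}
    (hadj : ∀ u v, G.Adj u v ↔ u ≠ v ∧ {u, v} ∈ K.faces) {a b c : V} (hab : G.Adj a b)
    (hbc : G.Adj b c) (hca : G.Adj c a) (h : ¬ SeparatesVertices G {a, b, c}) :
    {a, b, c} ∈ K.faces := by
  by_contra hf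
  refine not_isPreconnected_compl_triangle Ψ hab.ne hbc.ne hca.ne ((hadj _ _).1 hab).2
    ((hadj _ _).1 hbc).2 ((hadj _ _).1 hca).2 ?_
  have h' : ∀ x y, x ∉ ({a, b, c} : Set V) → y ∉ ({a, b, c} : Set V) →
      ∃ p : G.Walk x y, ∀ u ∈ p.support, u ∉ ({a, b, c} : Set V) := by
    intro x y hx hy
    by_contra hcon
    push Not at hcon
    exact h ⟨x, y, hx, hy, hcon⟩
  -- Since `abc` is not a face, no point has positive weight at all three vertices. So the
  -- complement of the triangular loop is the union of the stars of the remaining vertices.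
  convert isPreconnected_of_walks hadj h' using 1
  ext z
  simp only [mem_compl_iff, mem_ofPred_eq, not_and_or, not_or]
  constructor
  · rintro (hz | ⟨ha, hb, hc⟩)
    · push Not at hz
      obtain ⟨v, hv, hz⟩ := hz
      exact ⟨v, by simpa using hv, lt_of_le_of_ne (z.2.1 v) (Ne.symm hz)⟩
    · obtain ⟨s, hs, hsup⟩ := exists_face_support z.2
      have hsub : ({a, b, c} : Finset V) ⊆ s := by
        simp only [Finset.insert_subset_iff, Finset.singleton_subset_iff]
        exact ⟨hsup a (lt_of_le_of_ne (z.2.1 a) (Ne.symm ha)),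
          hsup b (lt_of_le_of_ne (z.2.1 b) (Ne.symm hb)),
          hsup c (lt_of_le_of_ne (z.2.1 c) (Ne.symm hc))⟩
      exact absurd (face_of_subset hs hsub (by simp)) hf
  · rintro ⟨v, hv, hz⟩
    left
    push Not
    exact ⟨v, by simpa using hv, hz.ne'⟩

/-- Every edge lies in at least two triangles. -/
theorem exists_two_faces (Ψ : realization K ≃ₜ ℂ) {a b : V} (hab : a ≠ b)
    (f : {a, b} ∈ K.faces) : ∃ c d, c ≠ d ∧ c ≠ a ∧ c ≠ b ∧ d ≠ a ∧ d ≠ b ∧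
      {a, b, c} ∈ K.faces ∧ {a, b, d} ∈ K.faces := by
  have hba := hab.symm
  -- The set min(x a, x b) = 1/3 separates the midpoint of the edge, where both weights are 1/2,
  -- from the vertex `a`. It remains to see that with fewer than two triangles this set is too small
  -- to separate the plane.
  have key : ∀ A : Set (realization K), IsPreconnected Aᶜ →
      (∀ x : realization K, x ∉ A → (1 / 3 < x.1 a ∧ 1 / 3 < x.1 b) ∨ (x.1 a < 1 / 3 ∨
        x.1 b < 1 / 3)) → (∀ x ∈ A, 1 / 3 ≤ x.1 a ∧ 1 / 3 ≤ x.1 b ∧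
          (x.1 a = 1 / 3 ∨ x.1 b = 1 / 3)) → False := by
    intro A hA h1 h2
    have hc : ∀ v, Continuous fun x : realization K => x.1 v := fun v =>
      (continuous_apply v).comp continuous_subtype_val
    let O₁ : Set (realization K) := {x | 1 / 3 < x.1 a} ∩ {x | 1 / 3 < x.1 b}
    let O₂ : Set (realization K) := {x | x.1 a < 1 / 3} ∪ {x | x.1 b < 1 / 3}
    have ho₁ : IsOpen O₁ := (isOpen_lt continuous_const (hc a)).inter
      (isOpen_lt continuous_const (hc b))
    have ho₂ : IsOpen O₂ := (isOpen_lt (hc a) continuous_const).union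
      (isOpen_lt (hc b) continuous_const)
    let x₁ : realization K := ⟨bary a b b b (1 / 2) (1 / 2) 0 0, bary_mem f (by simp) (by simp)
      (by simp) (by simp) (by norm_num) (by norm_num) le_rfl le_rfl (by norm_num)⟩
    let x₂ : realization K := ⟨_, vertex_mem a⟩
    have e1 : x₁.1 a = 1 / 2 := by simp [x₁, bary, hab]
    have e2 : x₁.1 b = 1 / 2 := by simp [x₁, bary, hba]
    have e3 : x₂.1 b = 0 := by simp [x₂, bary, hba]
    obtain ⟨z, -, ⟨hz1, hz2⟩, hz3⟩ := hA O₁ O₂ ho₁ ho₂ (fun x hx => h1 x hx)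
      ⟨x₁, fun hx => by
        have := (h2 _ hx).2.2
        rw [e1, e2] at this
        norm_num at this, by
        constructor
        · simp only [mem_ofPred_eq, e1]; norm_num
        · simp only [mem_ofPred_eq, e2]; norm_num⟩
      ⟨x₂, fun hx => by
        have := (h2 _ hx).2.1
        rw [e3] at this
        norm_num at this, Or.inr (by simp only [mem_ofPred_eq, e3]; norm_num)⟩
    simp only [mem_ofPred_eq] at hz1 hz2
    rcases hz3 with h | h <;> simp only [mem_ofPred_eq] at h <;> linarith
  by_cases hex : ∃ c, c ≠ a ∧ c ≠ b ∧ {a, b, c} ∈ K.faces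
  · obtain ⟨c, hca, hcb, hf⟩ := hex
    by_contra hcon
    have huniq : ∀ d, d ≠ a → d ≠ b → {a, b, d} ∈ K.faces → d = c := by
      intro d hda hdb hd
      by_contra hdc
      exact hcon ⟨c, d, Ne.symm hdc, hca, hcb, hda, hdb, hf, hd⟩
    have hac := hca.symm
    have hbc := hcb.symm
    -- With one triangle `abc` the level set is a broken arc: the weights of `a` and `b` go from
    -- (1/3, 2/3) through the barycenter to (2/3, 1/3).
    let p : unitInterval → ℝ := fun u => 1 / 3 + max 0 (2 * (u : ℝ) - 1) / 3
    let q : unitInterval → ℝ := fun u => 1 / 3 + max 0 (1 - 2 * (u : ℝ)) / 3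
    have hp : ∀ u, 1 / 3 ≤ p u := fun u => by
      have := le_max_left (0 : ℝ) (2 * u - 1)
      simp only [p]; linarith
    have hq : ∀ u, 1 / 3 ≤ q u := fun u => by
      have := le_max_left (0 : ℝ) (1 - 2 * u)
      simp only [q]; linarith
    have hpq : ∀ u : unitInterval, (p u = 1 / 3 ∧ q u = 1 / 3 + (1 - 2 * u) / 3) ∨
        (q u = 1 / 3 ∧ p u = 1 / 3 + (2 * u - 1) / 3) := by
      intro u
      rcases le_total (u : ℝ) (1 / 2) with h | h
      · left
        simp only [p, q]
        rw [max_eq_left (by linarith), max_eq_right (by linarith)]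
        simp
      · right
        simp only [p, q]
        rw [max_eq_left (by linarith), max_eq_right (by linarith)]
        simp
    have hpq1 : ∀ u, p u + q u ≤ 1 := by
      intro u
      have h0 := u.2.1
      have h1 := u.2.2
      rcases hpq u with h | h <;> rw [h.1, h.2] <;> linarith
    let j : unitInterval → realization K := fun u =>
      ⟨bary a b c c (p u) (q u) (1 - p u - q u) 0, bary_mem hf (by simp) (by simp) (by simp)
        (by simp) (by linarith [hp u]) (by linarith [hq u]) (by linarith [hpq1 u]) le_rfl (by ring)⟩
    have hj : Continuous j := Continuous.subtype_mk (continuous_bary _ _ _ _ (by fun_prop)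
      (by fun_prop) (by fun_prop) (by fun_prop)) _
    have ja : ∀ u, (j u).1 a = p u := fun u => by simp [j, bary, hab, hac]
    have jb : ∀ u, (j u).1 b = q u := fun u => by simp [j, bary, hba, hbc]
    have jc : ∀ u, (j u).1 c = 1 - p u - q u := fun u => by simp [j, bary, hca, hcb]
    have hinj : Function.Injective j := by
      intro u v h
      have h1 : p u = p v := by rw [← ja, ← ja, h]
      have h2 : q u = q v := by rw [← jb, ← jb, h]
      apply Subtype.ext
      rcases hpq u with h3 | h3 <;> rcases hpq v with h4 | h4 <;> linarith [h3.1, h3.2, h4.1, h4.2]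
    refine key _ (isPreconnected_compl_range_realization Ψ hj hinj) ?_ ?_
    · rintro ⟨x, hx⟩ hxr
      by_contra hcon2
      simp only [not_or, not_and_or, not_lt] at hcon2
      obtain ⟨h1, h2, h3⟩ := hcon2
      obtain ⟨s, hs, hsup⟩ := exists_face_support hx
      have has := hsup a (by linarith)
      have hbs := hsup b (by linarith)
      have h0 : ∀ v, v ∉ ({a, b, c} : Finset V) → x v = 0 := by
        intro v hv
        simp only [Finset.mem_insert, Finset.mem_singleton, not_or] at hv
        by_contra hne
        have hvs := hsup v (lt_of_le_of_ne (hx.1 v) (Ne.symm hne))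
        exact hv.2.2 (huniq v hv.1 hv.2.1
          (face_of_subset hs (by simp [Finset.insert_subset_iff, has, hbs, hvs]) (by simp)))
      have hsum := realization_sum_eq_one hx h0
      rw [Finset.sum_insert (by simp [hab, hac]), Finset.sum_pair hbc] at hsum
      have hxc := hx.1 c
      have hext : ∀ u, p u = x a → q u = x b → False := by
        intro u h4 h5
        refine hxr ⟨u, Subtype.ext (funext fun v => ?_)⟩
        by_cases hva : v = a
        · subst hva; rw [ja, h4]
        by_cases hvb : v = b
        · subst hvb; rw [jb, h5]
        by_cases hvc : v = c
        · subst hvc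
          rw [jc]
          simp only
          linarith
        · have := h0 v (by simp [hva, hvb, hvc])
          simp [j, bary, hva, hvb, hvc, this]
      rcases h1 with h1 | h1
      · have h1' : x a = 1 / 3 := le_antisymm h1 h2
        refine hext ⟨(2 - 3 * x b) / 2, by constructor <;> linarith⟩ ?_ ?_
        · simp only [p]
          rw [max_eq_left (by linarith), h1']
          norm_num
        · simp only [q]
          rw [max_eq_right (by linarith)]
          ring
      · have h1' : x b = 1 / 3 := le_antisymm h1 h3
        refine hext ⟨(3 * x a) / 2, by constructor <;> linarith⟩ ?_ ?_
        · simp only [p]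
          rw [max_eq_right (by linarith)]
          ring
        · simp only [q]
          rw [max_eq_left (by linarith), h1']
          norm_num
    · rintro _ ⟨u, rfl⟩
      rw [ja, jb]
      exact ⟨hp u, hq u, (hpq u).imp (fun h => h.1) fun h => h.1⟩
  · exfalso
    push Not at hex
    let A : Set (realization K) := {x | 1 / 3 ≤ x.1 a ∧ 1 / 3 ≤ x.1 b ∧
      (x.1 a = 1 / 3 ∨ x.1 b = 1 / 3)}
    -- With no triangle the level set lies on the edge itself and has at most two points.
    have hA : A.Finite := by
      have hsum : ∀ x ∈ A, x.1 a + x.1 b = 1 ∧ ∀ v, v ≠ a → v ≠ b → x.1 v = 0 := by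
        rintro ⟨x, hx⟩ ⟨h1, h2, -⟩
        obtain ⟨s, hs, hsup⟩ := exists_face_support hx
        simp only at h1 h2
        have has := hsup a (by linarith)
        have hbs := hsup b (by linarith)
        have h0 : ∀ v, v ∉ ({a, b} : Finset V) → x v = 0 := by
          intro v hv
          simp only [Finset.mem_insert, Finset.mem_singleton, not_or] at hv
          by_contra hne
          have hvs := hsup v (lt_of_le_of_ne (hx.1 v) (Ne.symm hne))
          exact hex v hv.1 hv.2
            (face_of_subset hs (by simp [Finset.insert_subset_iff, has, hbs, hvs]) (by simp))
        have hsum := realization_sum_eq_one hx h0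
        rw [Finset.sum_pair hab] at hsum
        exact ⟨hsum, fun v hva hvb => h0 v (by simp [hva, hvb])⟩
      refine Set.Finite.of_finite_image (f := fun x => x.1 a) (((finite_singleton (2 / 3)).insert
        (1 / 3 : ℝ)).subset ?_) ?_
      · rintro _ ⟨x, hx, rfl⟩
        have h1 := (hsum x hx).1
        rcases hx.2.2 with h | h
        · left; exact h
        · right
          simp only [mem_singleton_iff]
          linarith
      · intro x hx y hy hxy
        simp only at hxy
        apply Subtype.ext
        funext v
        have h1 := (hsum x hx).1
        have h2 := (hsum y hy).1
        by_cases hva : v = a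
        · rw [hva, hxy]
        by_cases hvb : v = b
        · rw [hvb]; linarith
        · rw [(hsum x hx).2 v hva hvb, (hsum y hy).2 v hva hvb]
    refine key A ?_ ?_ ?_
    · rw [← Ψ.isPreconnected_image, image_compl_eq Ψ.bijective]
      exact ((hA.image Ψ).countable.isConnected_compl_of_one_lt_rank
        (by rw [Complex.rank_real_complex]; exact Cardinal.one_lt_two)).isPreconnected
    · intro x hx
      by_contra hcon
      simp only [not_or, not_and_or, not_lt] at hcon
      obtain ⟨h1, h2, h3⟩ := hcon
      exact hx ⟨h2, h3, h1.imp (fun h => le_antisymm h h2) fun h => le_antisymm h h3⟩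
    · intro x hx
      exact hx

end Complex

end DiskPatterns

namespace DiskPatterns

open Set

/-! ### Straight drawings of triangulations -/

/-- The determinant of two plane vectors. -/
def cross (x y : ℂ) : ℝ := x.re * y.im - x.im * y.re

theorem cross_swap (x y : ℂ) : cross y x = -cross x y := by
  unfold cross; ring

/-- The closed simplex spanned by the points `z i`, `i ∈ T`. -/
def closedTri {V : Type*} (z : V → ℂ) (T : Finset V) : Set ℂ :=
  {p | ∃ w : V → ℝ, (∀ i ∈ T, 0 ≤ w i) ∧ ∑ i ∈ T, w i = 1 ∧ ∑ i ∈ T, w i • z i = p}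

/-- The open simplex spanned by the points `z i`, `i ∈ T`. -/
def openTri {V : Type*} (z : V → ℂ) (T : Finset V) : Set ℂ :=
  {p | ∃ w : V → ℝ, (∀ i ∈ T, 0 < w i) ∧ ∑ i ∈ T, w i = 1 ∧ ∑ i ∈ T, w i • z i = p}

/-- The least weight is a continuous function of τ, positive at 0 and negative at 1; a zero of it is
a point where the segment leaves the simplex. -/
theorem exists_first_exit {V : Type*} {T : Finset V} {w w' : V → ℝ} (hw : ∀ i ∈ T, 0 < w i)
    (hw' : ∃ i ∈ T, w' i < 0) : ∃ τ : ℝ, 0 < τ ∧ τ < 1 ∧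
      (∀ i ∈ T, 0 ≤ (1 - τ) * w i + τ * w' i) ∧ ∃ i ∈ T, (1 - τ) * w i + τ * w' i = 0 := by
  obtain ⟨i₀, hi₀, hneg⟩ := hw'
  have hT : T.Nonempty := ⟨i₀, hi₀⟩
  let m : ℝ → ℝ := fun τ => T.inf' hT fun i => (1 - τ) * w i + τ * w' i
  have hm : Continuous m := Continuous.finset_inf'_apply hT fun i _ => by fun_prop
  have h0 : 0 < m 0 := by
    simp only [m, Finset.lt_inf'_iff]
    intro i hi
    simpa using hw i hi
  have h1 : m 1 < 0 := by
    simp only [m, Finset.inf'_lt_iff]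
    exact ⟨i₀, hi₀, by simpa using hneg⟩
  obtain ⟨τ, hτ, hmτ⟩ := intermediate_value_Icc' (zero_le_one' ℝ) hm.continuousOn
    (show (0 : ℝ) ∈ Icc (m 1) (m 0) from ⟨h1.le, h0.le⟩)
  refine ⟨τ, lt_of_le_of_ne hτ.1 ?_, lt_of_le_of_ne hτ.2 ?_, fun i hi => ?_, ?_⟩
  · rintro rfl
    exact h0.ne' hmτ
  · rintro rfl
    exact h1.ne hmτ
  · rw [← hmτ]
    exact Finset.inf'_le _ hi
  · obtain ⟨i, hi, h⟩ := Finset.exists_mem_eq_inf' hT fun i => (1 - τ) * w i + τ * w' i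
    exact ⟨i, hi, by rw [← h]; exact hmτ⟩

theorem exists_weights {a b c : ℂ} (h : cross (b - a) (c - a) ≠ 0) (p : ℂ) :
    ∃ α β γ : ℝ, α + β + γ = 1 ∧ p = α • a + β • b + γ • c ∧
      γ * cross (b - a) (c - a) = cross (b - a) (p - a) := by
  set D := cross (b - a) (c - a) with hD
  refine ⟨1 - cross (p - a) (c - a) / D - cross (b - a) (p - a) / D,
    cross (p - a) (c - a) / D, cross (b - a) (p - a) / D, by ring, ?_, by field_simp⟩
  have e1 : ∀ x y : ℝ, x * D = y → x = y / D := fun x y h' => by rw [← h']; field_simp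
  apply Complex.ext
  · simp only [Complex.add_re, Complex.real_smul, Complex.mul_re, Complex.ofReal_re,
      Complex.ofReal_im, zero_mul, sub_zero]
    field_simp
    rw [hD]
    simp only [cross, Complex.sub_re, Complex.sub_im]
    ring
  · simp only [Complex.add_im, Complex.real_smul, Complex.mul_im, Complex.ofReal_re,
      Complex.ofReal_im, zero_mul, add_zero]
    field_simp
    rw [hD]
    simp only [cross, Complex.sub_re, Complex.sub_im]
    ring

theorem weights_unique {a b c : ℂ} (h : cross (b - a) (c - a) ≠ 0) {α β γ : ℝ}
    (hs : α + β + γ = 0) (hp : α • a + β • b + γ • c = 0) : α = 0 ∧ β = 0 ∧ γ = 0 := by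
  have hre := congrArg Complex.re hp
  have him := congrArg Complex.im hp
  simp only [Complex.add_re, Complex.add_im, Complex.real_smul, Complex.mul_re, Complex.mul_im,
    Complex.ofReal_re, Complex.ofReal_im, zero_mul, sub_zero, add_zero, Complex.zero_re,
    Complex.zero_im] at hre him
  have hα : α = -β - γ := by linarith
  subst hα
  have h1 : β * cross (b - a) (c - a) = 0 := by
    simp only [cross, Complex.sub_re, Complex.sub_im]
    linear_combination (c.im - a.im) * hre - (c.re - a.re) * him
  have h2 : γ * cross (b - a) (c - a) = 0 := by
    simp only [cross, Complex.sub_re, Complex.sub_im]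
    linear_combination -(b.im - a.im) * hre + (b.re - a.re) * him
  have h1' := (mul_eq_zero.1 h1).resolve_right h
  have h2' := (mul_eq_zero.1 h2).resolve_right h
  exact ⟨by rw [h1', h2']; ring, h1', h2'⟩

/-- Among three collinear points one lies between the other two. -/
theorem collinear_cases {a b c : ℂ} (hab : a ≠ b) (h : cross (b - a) (c - a) = 0) :
    ∃ t ∈ Icc (0 : ℝ) 1, c = t • a + (1 - t) • b ∨ b = t • a + (1 - t) • c ∨
      a = t • b + (1 - t) • c := by
  have hn : 0 < Complex.normSq (b - a) := Complex.normSq_pos.2 (sub_ne_zero.2 hab.symm)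
  set k : ℝ := ((b - a).re * (c - a).re + (b - a).im * (c - a).im) / Complex.normSq (b - a) with hk
  have hc : c = a + k • (b - a) := by
    have h' : (b - a).re * (c - a).im - (b - a).im * (c - a).re = 0 := h
    have hn' := hn.ne'
    apply Complex.ext
    · simp only [Complex.add_re, Complex.real_smul, Complex.mul_re, Complex.ofReal_re,
        Complex.ofReal_im, zero_mul, sub_zero, hk]
      rw [div_mul_eq_mul_div, ← sub_eq_iff_eq_add', eq_div_iff hn', Complex.normSq_apply,
        ← Complex.sub_re]
      linear_combination -(b - a).im * h'
    · simp only [Complex.add_im, Complex.real_smul, Complex.mul_im, Complex.ofReal_re,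
        Complex.ofReal_im, zero_mul, add_zero, hk]
      rw [div_mul_eq_mul_div, ← sub_eq_iff_eq_add', eq_div_iff hn', Complex.normSq_apply,
        ← Complex.sub_im]
      linear_combination (b - a).re * h'
  rcases lt_or_ge k 0 with hk0 | hk0
  · have hk1 : 0 < 1 - k := by linarith
    refine ⟨-k / (1 - k), ⟨by apply div_nonneg <;> linarith, by rw [div_le_one hk1]; linarith⟩,
      Or.inr (Or.inr ?_)⟩
    rw [hc]
    have : (1 - (k : ℂ)) ≠ 0 := by exact_mod_cast hk1.ne'
    simp only [Complex.real_smul]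
    push_cast
    field_simp
    ring
  · rcases le_or_gt k 1 with hk1 | hk1
    · refine ⟨1 - k, ⟨by linarith, by linarith⟩, Or.inl ?_⟩
      rw [hc]
      simp only [Complex.real_smul]
      push_cast
      ring
    · have hk' : 0 < k := by linarith
      refine ⟨1 - 1 / k, ⟨?_, ?_⟩, Or.inr (Or.inl ?_)⟩
      · rw [sub_nonneg, div_le_one hk']; linarith
      · have : 0 < 1 / k := by positivity
        linarith
      · rw [hc]
        have : (k : ℂ) ≠ 0 := by exact_mod_cast hk'.ne'
        simp only [Complex.real_smul]
        push_cast
        field_simp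
        ring

theorem sum_three {V M : Type*} [DecidableEq V] [AddCommMonoid M] {a b c : V} (hab : a ≠ b)
    (hbc : b ≠ c) (hca : c ≠ a) (f : V → M) : ∑ i ∈ {a, b, c}, f i = f a + f b + f c := by
  rw [Finset.sum_insert (by simp [hab, hca.symm]), Finset.sum_insert (by simpa using hbc),
    Finset.sum_singleton, add_assoc]

theorem exists_fun_three {V : Type*} [DecidableEq V] {a b c : V} (hab : a ≠ b)
    (hbc : b ≠ c) (hca : c ≠ a) (α β γ : ℝ) : ∃ w : V → ℝ, w a = α ∧ w b = β ∧ w c = γ :=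
  ⟨fun i => if i = a then α else if i = b then β else γ, by simp, by simp [hab.symm],
    by simp [hca, hbc.symm]⟩

theorem mem_openTri {V : Type*} [DecidableEq V] (z : V → ℂ) {a b c : V} (hab : a ≠ b)
    (hbc : b ≠ c) (hca : c ≠ a) {α β γ : ℝ} (hα : 0 < α) (hβ : 0 < β) (hγ : 0 < γ)
    (h : α + β + γ = 1) : α • z a + β • z b + γ • z c ∈ openTri z {a, b, c} := by
  obtain ⟨w, rfl, rfl, rfl⟩ := exists_fun_three hab hbc hca α β γ
  refine ⟨w, ?_, ?_, ?_⟩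
  · simp only [Finset.mem_insert, Finset.mem_singleton]
    rintro i (rfl | rfl | rfl) <;> assumption
  · rw [sum_three hab hbc hca, h]
  · rw [sum_three hab hbc hca]

theorem openTri_subset_closedTri {V : Type*} (z : V → ℂ) (T : Finset V) :
    openTri z T ⊆ closedTri z T :=
  fun _ ⟨w, hw, h1, h2⟩ => ⟨w, fun i hi => (hw i hi).le, h1, h2⟩

/-- A straight drawing of a graph with a set of triangular faces, each of which does not separate
the graph. -/
structure IsDrawing {V : Type*} (G : SimpleGraph V) (F : Set (Finset V)) (z : V → ℂ) : Prop where
  card : ∀ T ∈ F, T.card = 3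
  injective : Function.Injective z
  adj : ∀ T ∈ F, ∀ u ∈ T, ∀ v ∈ T, u ≠ v → G.Adj u v
  not_mem_edge : ∀ a b d, G.Adj a b → d ≠ a → d ≠ b → ∀ t ∈ Icc (0 : ℝ) 1,
    z d ≠ t • z a + (1 - t) • z b
  not_cross : ∀ a b c d, G.Adj a b → G.Adj c d → a ≠ c → a ≠ d → b ≠ c → b ≠ d →
    ∀ t ∈ Icc (0 : ℝ) 1, ∀ s ∈ Icc (0 : ℝ) 1,
      t • z a + (1 - t) • z b ≠ s • z c + (1 - s) • z d
  avoid : ∀ T ∈ F, ∀ x y, x ∉ T → y ∉ T → ∃ p : G.Walk x y, ∀ u ∈ p.support, u ∉ T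
  outside : ∀ T ∈ F, ∃ x, x ∉ T ∧ z x ∉ closedTri z T

namespace IsDrawing

variable {V : Type*} [DecidableEq V] {G : SimpleGraph V} {F : Set (Finset V)} {z : V → ℂ}

theorem exists_eq (h : IsDrawing G F z) {T : Finset V} (hT : T ∈ F) :
    ∃ a b c, a ≠ b ∧ b ≠ c ∧ c ≠ a ∧ T = {a, b, c} := by
  obtain ⟨a, b, c, hab, hac, hbc, e⟩ := Finset.card_eq_three.1 (h.card T hT)
  exact ⟨a, b, c, hab, hbc, hac.symm, e⟩

theorem cross_ne_zero (h : IsDrawing G F z) {a b c : V} (hab : a ≠ b) (hbc : b ≠ c) (hca : c ≠ a)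
    (hT : {a, b, c} ∈ F) : cross (z b - z a) (z c - z a) ≠ 0 := by
  intro h0
  have Aab := h.adj _ hT a (by simp) b (by simp) hab
  have Abc := h.adj _ hT b (by simp) c (by simp) hbc
  have Aac := h.adj _ hT a (by simp) c (by simp) hca.symm
  obtain ⟨t, ht, e | e | e⟩ := collinear_cases (h.injective.ne hab) h0
  · exact h.not_mem_edge a b c Aab hca hbc.symm t ht e
  · exact h.not_mem_edge a c b Aac hab.symm hbc t ht e
  · exact h.not_mem_edge b c a Abc hab hca.symm t ht e

theorem weights_eq (h : IsDrawing G F z) {T : Finset V} (hT : T ∈ F) {w w' : V → ℝ}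
    (h1 : ∑ i ∈ T, w i = ∑ i ∈ T, w' i) (h2 : ∑ i ∈ T, w i • z i = ∑ i ∈ T, w' i • z i) :
    ∀ i ∈ T, w i = w' i := by
  obtain ⟨a, b, c, hab, hbc, hca, rfl⟩ := h.exists_eq hT
  rw [sum_three hab hbc hca, sum_three hab hbc hca] at h1 h2
  obtain ⟨e1, e2, e3⟩ := weights_unique (h.cross_ne_zero hab hbc hca hT)
    (α := w a - w' a) (β := w b - w' b) (γ := w c - w' c) (by linarith)
    (by rw [← sub_eq_zero] at h2; rw [← h2]; module)
  simp only [Finset.mem_insert, Finset.mem_singleton]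
  rintro i (rfl | rfl | rfl) <;> linarith

theorem exists_weights (h : IsDrawing G F z) {T : Finset V} (hT : T ∈ F) (p : ℂ) :
    ∃ w : V → ℝ, ∑ i ∈ T, w i = 1 ∧ ∑ i ∈ T, w i • z i = p := by
  obtain ⟨a, b, c, hab, hbc, hca, rfl⟩ := h.exists_eq hT
  obtain ⟨α, β, γ, h1, h2, -⟩ :=
    DiskPatterns.exists_weights (h.cross_ne_zero hab hbc hca hT) p
  obtain ⟨w, rfl, rfl, rfl⟩ := exists_fun_three hab hbc hca α β γ
  exact ⟨w, by rw [sum_three hab hbc hca, h1], by rw [sum_three hab hbc hca, h2]⟩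

/-- A point of a closed face with a vanishing weight lies on an edge. -/
theorem exists_edge (h : IsDrawing G F z) {T : Finset V} (hT : T ∈ F) {w : V → ℝ}
    (hw : ∀ i ∈ T, 0 ≤ w i) (h1 : ∑ i ∈ T, w i = 1) (h0 : ∃ i ∈ T, w i = 0) :
    ∃ a ∈ T, ∃ b ∈ T, a ≠ b ∧ ∃ t ∈ Icc (0 : ℝ) 1, ∑ i ∈ T, w i • z i = t • z a + (1 - t) • z b := by
  obtain ⟨a, b, c, hab, hbc, hca, rfl⟩ := h.exists_eq hT
  obtain ⟨i, hi, hi0⟩ := h0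
  rw [sum_three hab hbc hca] at h1 ⊢
  have ha := hw a (by simp)
  have hb := hw b (by simp)
  have hc := hw c (by simp)
  simp only [Finset.mem_insert, Finset.mem_singleton] at hi
  rcases hi with rfl | rfl | rfl
  · refine ⟨b, by simp, c, by simp, hbc, w b, ⟨hb, by linarith⟩, ?_⟩
    rw [hi0, show 1 - w b = w c by linarith, zero_smul, zero_add]
  · refine ⟨a, by simp, c, by simp, hca.symm, w a, ⟨ha, by linarith⟩, ?_⟩
    rw [hi0, show 1 - w a = w c by linarith, zero_smul, add_zero]
  · refine ⟨a, by simp, b, by simp, hab, w a, ⟨ha, by linarith⟩, ?_⟩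
    rw [hi0, show 1 - w a = w b by linarith, zero_smul, add_zero]

theorem exists_exit (h : IsDrawing G F z) {T : Finset V} (hT : T ∈ F) {p q : ℂ}
    (hp : p ∈ openTri z T) (hq : q ∉ closedTri z T) : ∃ τ : ℝ, 0 < τ ∧ τ < 1 ∧
      ∃ a ∈ T, ∃ b ∈ T, a ≠ b ∧ ∃ t ∈ Icc (0 : ℝ) 1,
        (1 - τ) • p + τ • q = t • z a + (1 - t) • z b := by
  obtain ⟨w, hw, h1, rfl⟩ := hp
  obtain ⟨w', h1', rfl⟩ := h.exists_weights hT q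
  have hneg : ∃ i ∈ T, w' i < 0 := by
    by_contra! hcon
    exact hq ⟨w', hcon, h1', rfl⟩
  obtain ⟨τ, h0, h1τ, hnn, hz⟩ := exists_first_exit hw hneg
  refine ⟨τ, h0, h1τ, ?_⟩
  have := h.exists_edge hT (w := fun i => (1 - τ) * w i + τ * w' i) hnn
    (by rw [Finset.sum_add_distrib, ← Finset.mul_sum, ← Finset.mul_sum, h1, h1']; ring) hz
  simpa only [add_smul, mul_smul, Finset.sum_add_distrib, Finset.smul_sum] using this

/-- A walk avoiding `T` leads from `d` to a vertex known to lie outside. If it started inside the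
triangle, one of its edges would cross a side of the triangle, which the drawing forbids. -/
theorem notMem_closedTri (h : IsDrawing G F z) {T : Finset V} (hT : T ∈ F) {d : V} (hd : d ∉ T) :
    z d ∉ closedTri z T := by
  have key : ∀ e ∉ T, z e ∈ closedTri z T → z e ∈ openTri z T := by
    rintro e he ⟨w, hw, h1, h2⟩
    refine ⟨w, fun i hi => lt_of_le_of_ne (hw i hi) fun h0 => ?_, h1, h2⟩
    obtain ⟨a, ha, b, hb, hab, t, ht, e1⟩ := h.exists_edge hT hw h1 ⟨i, hi, h0.symm⟩
    exact h.not_mem_edge a b e (h.adj T hT a ha b hb hab) (fun e => he (e ▸ ha))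
      (fun e => he (e ▸ hb)) t ht (h2.symm.trans e1)
  intro hin
  obtain ⟨x, hx, hxo⟩ := h.outside T hT
  obtain ⟨p, hp⟩ := h.avoid T hT d x hd hx
  have walk : ∀ (u v : V) (q : G.Walk u v), (∀ x ∈ q.support, x ∉ T) → z u ∈ closedTri z T →
      z v ∈ closedTri z T := by
    intro u v q
    induction q with
    | nil => exact fun _ h => h
    | @cons u e v hue q ih =>
      intro hs hu
      have huT : u ∉ T := hs u (by simp)
      have heT : e ∉ T := hs e (by simp)
      refine ih (fun x hx => hs x (by simp [hx])) ?_
      by_contra hne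
      obtain ⟨τ, h0, h1, a, ha, b, hb, hab, t, ht, e1⟩ := h.exists_exit hT (key u huT hu) hne
      refine h.not_cross u e a b hue (h.adj T hT a ha b hb hab) (fun e => huT (e ▸ ha))
        (fun e => huT (e ▸ hb)) (fun e => heT (e ▸ ha)) (fun e => heT (e ▸ hb)) (1 - τ)
        ⟨by linarith, by linarith⟩ t ht ?_
      rw [← e1, sub_sub_cancel]
  exact hxo (walk d x p hp hin)

theorem eq_of_mem_edges_aux (h : IsDrawing G F z) {a b d : V} (hab : G.Adj a b) (had : G.Adj a d)
    {t s : ℝ} (ht1 : t < 1) (hs : s ∈ Icc (0 : ℝ) 1)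
    (e : t • z a + (1 - t) • z b = s • z a + (1 - s) • z d) : b = d := by
  by_contra hbd
  have key : (1 - t) • z b = (s - t) • z a + (1 - s) • z d := by
    rw [← sub_eq_zero] at e ⊢
    rw [← e]
    module
  rcases le_or_gt t s with hts | hts
  · have h1t : 0 < 1 - t := by linarith
    refine h.not_mem_edge a d b had hab.ne' hbd ((s - t) / (1 - t))
      ⟨div_nonneg (by linarith) h1t.le, by rw [div_le_one h1t]; linarith [hs.2]⟩ ?_
    have : (1 - (t : ℂ)) ≠ 0 := by exact_mod_cast h1t.ne'
    simp only [Complex.real_smul] at key ⊢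
    push_cast at key ⊢
    field_simp
    linear_combination key
  · have h1s : 0 < 1 - s := by linarith
    refine h.not_mem_edge a b d hab had.ne' (Ne.symm hbd) ((t - s) / (1 - s))
      ⟨div_nonneg (by linarith) h1s.le, by rw [div_le_one h1s]; linarith⟩ ?_
    have : (1 - (s : ℂ)) ≠ 0 := by exact_mod_cast h1s.ne'
    simp only [Complex.real_smul] at key ⊢
    push_cast at key ⊢
    field_simp
    linear_combination -key

/-- Edges without a common vertex do not cross, and two edges from one vertex cannot overlap, since
the end of one would then lie on the other. So an interior point of an edge lies on no other edge.
-/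
theorem mem_of_mem_edges (h : IsDrawing G F z) {a b c d : V} (hab : G.Adj a b) (hcd : G.Adj c d)
    {t s : ℝ} (ht0 : 0 < t) (ht1 : t < 1) (hs : s ∈ Icc (0 : ℝ) 1)
    (e : t • z a + (1 - t) • z b = s • z c + (1 - s) • z d) : a = c ∧ b = d ∨ a = d ∧ b = c := by
  have hs' : 1 - s ∈ Icc (0 : ℝ) 1 := ⟨by linarith [hs.2], by linarith [hs.1]⟩
  by_cases h1 : a = c
  · subst h1
    exact Or.inl ⟨rfl, h.eq_of_mem_edges_aux hab hcd ht1 hs e⟩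
  by_cases h2 : a = d
  · subst h2
    refine Or.inr ⟨rfl, h.eq_of_mem_edges_aux hab hcd.symm ht1 hs' ?_⟩
    rw [e]; module
  by_cases h3 : b = c
  · subst h3
    refine absurd (h.eq_of_mem_edges_aux (t := 1 - t) hab.symm hcd (by linarith) hs ?_) h2
    rw [← e]; module
  by_cases h4 : b = d
  · subst h4
    refine absurd (h.eq_of_mem_edges_aux (t := 1 - t) hab.symm hcd.symm (by linarith)
      hs' ?_) h1
    rw [show (1 - t) • z b + (1 - (1 - t)) • z a = t • z a + (1 - t) • z b by module, e]
    module
  exact absurd e (h.not_cross a b c d hab hcd h1 h2 h3 h4 t ⟨ht0.le, ht1.le⟩ s hs)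

theorem notMem_openTri_of_edge (h : IsDrawing G F z) {T : Finset V} (hT : T ∈ F) {a b : V}
    (ha : a ∈ T) (hb : b ∈ T) (t : ℝ) : t • z a + (1 - t) • z b ∉ openTri z T := by
  rintro ⟨w, hw, h1, h2⟩
  have hc : ∃ c ∈ T, c ≠ a ∧ c ≠ b := by
    by_contra! hcon
    have h3 := h.card _ hT
    have : T ⊆ {a, b} := fun i hi => by
      by_cases e : i = a
      · simp [e]
      · simp [hcon i hi e]
    have := Finset.card_le_card this
    have := Finset.card_le_two (a := a) (b := b)
    omega
  obtain ⟨c', hc', hca', hcb'⟩ := hc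
  let w' : V → ℝ := fun i => (if i = a then t else 0) + (if i = b then 1 - t else 0)
  have e := h.weights_eq hT (w := w) (w' := w')
    (by rw [h1]; simp only [w', Finset.sum_add_distrib, Finset.sum_ite_eq', ha, hb, if_true]; ring)
    (by rw [h2]; simp only [w', add_smul, ite_smul, zero_smul, Finset.sum_add_distrib,
          Finset.sum_ite_eq', ha, hb, if_true]) c' hc'
  have := hw c' hc'
  simp [w', hca', hcb'] at e
  linarith

/-- Distinct faces have disjoint interiors. -/
theorem eq_of_mem_openTri (h : IsDrawing G F z) {T T' : Finset V} (hT : T ∈ F) (hT' : T' ∈ F)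
    {p : ℂ} (hp : p ∈ openTri z T) (hp' : p ∈ openTri z T') : T = T' := by
  by_contra hne
  have hd : ∃ d ∈ T', d ∉ T := by
    by_contra! hcon
    exact hne (Finset.eq_of_subset_of_card_le hcon (by rw [h.card T hT, h.card T' hT'])).symm
  obtain ⟨d, hd', hd⟩ := hd
  obtain ⟨τ, h0, h1, a, ha, b, hb, hab, t, ht, e⟩ :=
    h.exists_exit hT hp (h.notMem_closedTri hT hd)
  -- Moving from an interior point of `T'` toward its vertex `d` stays in the interior until `d` is
  -- reached. Hence the point where the segment leaves `T`, on a side of `T`, is interior to `T'`.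
  have hy : t • z a + (1 - t) • z b ∈ openTri z T' := by
    obtain ⟨w, hw, hw1, rfl⟩ := hp'
    rw [← e]
    refine ⟨fun i => (1 - τ) * w i + if i = d then τ else 0, fun i hi => ?_, ?_, ?_⟩
    · have := mul_pos (sub_pos.2 h1) (hw i hi)
      dsimp only
      split_ifs <;> linarith
    · simp only [Finset.sum_add_distrib, Finset.sum_ite_eq', hd', if_true, ← Finset.mul_sum, hw1]
      ring
    · simp only [add_smul, mul_smul, ite_smul, zero_smul, Finset.sum_add_distrib,
        Finset.sum_ite_eq', hd', if_true, Finset.smul_sum]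
  -- If `a` were not a vertex of `T'`, continuing along the side toward `a` would leave `T'` through
  -- one of its own sides. That side meets the interior of `ab`, so it equals `ab`, and `a` is a
  -- vertex of `T'` after all.
  have key : ∀ a b : V, a ∈ T → b ∈ T → a ≠ b → ∀ t ∈ Icc (0 : ℝ) 1,
      t • z a + (1 - t) • z b ∈ openTri z T' → a ∈ T' := by
    intro a b ha hb hab t ht hy
    by_contra haT
    have hza := h.notMem_closedTri hT' haT
    have ht1 : t < 1 := lt_of_le_of_ne ht.2 (by
      rintro rfl
      exact hza (openTri_subset_closedTri z T' (by simpa using hy)))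
    obtain ⟨τ, h0, h1, x, hx, y, hyT, hxy, s, hs, e⟩ := h.exists_exit hT' hy hza
    have e' : ((1 - τ) * t + τ) • z a + (1 - ((1 - τ) * t + τ)) • z b =
        s • z x + (1 - s) • z y := by
      rw [← e]; module
    have hm := mul_pos (sub_pos.2 h1) (sub_pos.2 ht1)
    have hm' := mul_nonneg (sub_pos.2 h1).le ht.1
    rcases h.mem_of_mem_edges (h.adj T hT a ha b hb hab) (h.adj T' hT' x hx y hyT hxy)
      (by linarith) (by linarith) hs e' with ⟨h1, -⟩ | ⟨h1, -⟩
    · exact haT (h1 ▸ hx)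
    · exact haT (h1 ▸ hyT)
  refine h.notMem_openTri_of_edge hT' (key a b ha hb hab t ht hy)
    (key b a hb ha hab.symm (1 - t) ⟨by linarith [ht.2], by linarith [ht.1]⟩ ?_) t hy
  rw [sub_sub_cancel, add_comm]
  exact hy

/-- Two faces on the same side of a common edge overlap near the midpoint of the edge. -/
theorem eq_of_cross_pos (h : IsDrawing G F z) {a b c d : V} (hab : a ≠ b) (hbc : b ≠ c)
    (hca : c ≠ a) (hbd : b ≠ d) (hda : d ≠ a) (hT : {a, b, c} ∈ F) (hT' : {a, b, d} ∈ F)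
    (hc : 0 < cross (z b - z a) (z c - z a)) (hd : 0 < cross (z b - z a) (z d - z a)) : c = d := by
  obtain ⟨α, β, γ, h1, h2, h3⟩ := DiskPatterns.exists_weights hc.ne' (z d)
  have hγ : 0 < γ := by
    by_contra! hcon
    nlinarith
  set M := |α| + |β| with hM
  have hM0 : 0 ≤ M := by positivity
  -- Chosen so that (1 - δ)/2 - δM = δ/2 is positive, which keeps the weights of `a` and `b`
  -- positive in both faces.
  set δ := 1 / (2 + 2 * M) with hδ
  have hδ0 : 0 < δ := by positivity
  have hδ1 : δ * (2 + 2 * M) = 1 := by rw [hδ]; field_simp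
  have hm1 : δ * -M ≤ δ * α :=
    mul_le_mul_of_nonneg_left (by linarith [neg_abs_le α, abs_nonneg β]) hδ0.le
  have hm2 : δ * -M ≤ δ * β :=
    mul_le_mul_of_nonneg_left (by linarith [neg_abs_le β, abs_nonneg α]) hδ0.le
  have p1 := mem_openTri z hab hbc hca (α := (1 - δ) / 2 + δ * α) (β := (1 - δ) / 2 + δ * β)
    (γ := δ * γ) (by nlinarith) (by nlinarith) (by positivity) (by linear_combination δ * h1)
  have p2 := mem_openTri z hab hbd hda (α := (1 - δ) / 2) (β := (1 - δ) / 2)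
    (γ := δ) (by nlinarith) (by nlinarith) hδ0 (by ring)
  have e : ((1 - δ) / 2 + δ * α) • z a + ((1 - δ) / 2 + δ * β) • z b + (δ * γ) • z c =
      ((1 - δ) / 2) • z a + ((1 - δ) / 2) • z b + δ • z d := by
    rw [h2]; module
  rw [e] at p1
  have hTT := h.eq_of_mem_openTri hT hT' p1 p2
  have : c ∈ ({a, b, d} : Finset V) := by rw [← hTT]; simp
  simpa [hca, hbc.symm] using this

end IsDrawing

end DiskPatterns

namespace DiskPatterns

open Set

/-! ### Inversive products and the drawing by centers -/

/-- The inversive product of two disks, the cosine of the dihedral angle of intersecting disks. -/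
noncomputable def invProd (D D' : ClosedDisk) : ℝ :=
  (Complex.normSq (D.center - D'.center) - D.radius ^ 2 - D'.radius ^ 2) /
    (2 * D.radius * D'.radius)

theorem invProd_comm (D D' : ClosedDisk) : invProd D D' = invProd D' D := by
  unfold invProd
  rw [← Complex.normSq_neg, neg_sub]
  ring

theorem normSq_center_sub (D D' : ClosedDisk) : Complex.normSq (D.center - D'.center) =
    D.radius ^ 2 + D'.radius ^ 2 + 2 * D.radius * D'.radius * invProd D D' := by
  have h := D.radius_pos.ne'
  have h' := D'.radius_pos.ne'
  unfold invProd
  field_simp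
  ring

/-- Law of cosines in the triangle formed by the two centers and a common boundary point. As one of
the two tangents is reversed, external tangency has angle 0 and inversive product 1. -/
theorem invProd_eq_cos {D D' : ClosedDisk} {θ : ℝ} (h : HasDihedralAngle D D' θ) :
    invProd D D' = Real.cos θ := by
  obtain ⟨p, ⟨hp, hp'⟩, rfl⟩ := h
  have hD := D.radius_pos
  have hD' := D'.radius_pos
  have e1 : ‖p - D.center‖ = D.radius := by simpa [ClosedDisk.boundary, dist_eq_norm] using hp
  have e2 : ‖p - D'.center‖ = D'.radius := by simpa [ClosedDisk.boundary, dist_eq_norm] using hp'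
  rw [InnerProductGeometry.cos_angle]
  simp only [ClosedDisk.ccwTangent, norm_neg, norm_mul, Complex.norm_I, one_mul, e1, e2]
  have e1' : Complex.normSq (p - D.center) = D.radius ^ 2 := by rw [Complex.normSq_eq_norm_sq, e1]
  have e2' : Complex.normSq (p - D'.center) = D'.radius ^ 2 := by
    rw [Complex.normSq_eq_norm_sq, e2]
  unfold invProd
  rw [div_eq_div_iff (by positivity) (by positivity), ← e1', ← e2', inner_neg_left,
    Complex.inner]
  simp only [Complex.normSq_apply, Complex.mul_re, Complex.sub_re, Complex.sub_im,
    Complex.conj_re, Complex.conj_im, Complex.mul_im, Complex.I_re, Complex.I_im]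
  ring

theorem one_lt_invProd {D D' : ClosedDisk} (h : ¬ (D.carrier ∩ D'.carrier).Nonempty) :
    1 < invProd D D' := by
  have hD := D.radius_pos
  have hD' := D'.radius_pos
  have hlt : D.radius + D'.radius < ‖D.center - D'.center‖ := by
    by_contra! hle
    rw [not_nonempty_iff_eq_empty, ← disjoint_iff_inter_eq_empty] at h
    have := (disjoint_closedBall_closedBall_iff hD.le hD'.le).1 h
    rw [dist_eq_norm] at this
    linarith
  have h2 : (D.radius + D'.radius) ^ 2 < Complex.normSq (D.center - D'.center) := by
    rw [Complex.normSq_eq_norm_sq]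
    gcongr
  unfold invProd
  rw [lt_div_iff₀ (by positivity)]
  linarith

/-- Stewart's theorem. With `normSq_center_sub` it turns an incidence of centers into a relation
between radii and inversive products. -/
theorem normSq_combination (t : ℝ) (a b d : ℂ) :
    Complex.normSq (d - (t • a + (1 - t) • b)) + t * (1 - t) * Complex.normSq (a - b) =
      t * Complex.normSq (d - a) + (1 - t) * Complex.normSq (d - b) := by
  simp only [Complex.normSq_apply, Complex.sub_re, Complex.sub_im, Complex.add_re, Complex.add_im,
    Complex.real_smul, Complex.mul_re, Complex.mul_im, Complex.ofReal_re, Complex.ofReal_im]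
  ring

/-- The center of a disk does not lie on the segment joining the centers of two intersecting
disks. -/
theorem center_ne_of_invProd {A B D : ClosedDisk} (hAB : invProd A B ≤ 1) (hDA : 0 ≤ invProd D A)
    (hDB : 0 ≤ invProd D B) {t : ℝ} (ht : t ∈ Icc (0 : ℝ) 1) :
    D.center ≠ t • A.center + (1 - t) • B.center := by
  intro e
  have h := normSq_combination t A.center B.center D.center
  rw [← e, sub_self, map_zero, normSq_center_sub, normSq_center_sub, normSq_center_sub] at h
  have hA := A.radius_pos
  have hB := B.radius_pos
  have hD := D.radius_pos
  have ht1 : 0 ≤ 1 - t := sub_nonneg.2 ht.2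
  have h1 : 0 ≤ t * (1 - t) * (2 * A.radius * B.radius * (1 - invProd A B)) := by
    have := sub_nonneg.2 hAB
    have := ht.1
    positivity
  have h2 : 0 ≤ t * (2 * D.radius * A.radius * invProd D A) := by
    have := ht.1
    positivity
  have h3 : 0 ≤ (1 - t) * (2 * D.radius * B.radius * invProd D B) := by positivity
  -- Stewart's identity says that the squared radius of `D`, plus the square of t r_A - (1 - t) r_B,
  -- plus nonnegative terms, is zero.
  nlinarith [sq_nonneg (t * A.radius - (1 - t) * B.radius), sq_pos_of_pos hD]

/-- If the segments joining the centers of two pairs of intersecting disks meet, then the disks of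
each pair are tangent and orthogonal to those of the other pair. -/
theorem invProd_of_crossing {A B C D : ClosedDisk} (hAB : invProd A B ≤ 1) (hCD : invProd C D ≤ 1)
    (hAC : 0 ≤ invProd A C) (hAD : 0 ≤ invProd A D) (hBC : 0 ≤ invProd B C)
    (hBD : 0 ≤ invProd B D) {t s : ℝ} (ht : t ∈ Icc (0 : ℝ) 1) (hs : s ∈ Icc (0 : ℝ) 1)
    (e : t • A.center + (1 - t) • B.center = s • C.center + (1 - s) • D.center) :
    invProd A B = 1 ∧ invProd C D = 1 ∧ invProd A C = 0 ∧ invProd A D = 0 ∧ invProd B C = 0 ∧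
      invProd B D = 0 := by
  have hA := A.radius_pos
  have hB := B.radius_pos
  have hC := C.radius_pos
  have hD := D.radius_pos
  obtain ⟨ht0, ht1⟩ := ht
  obtain ⟨hs0, hs1⟩ := hs
  have e1 := normSq_combination s C.center D.center A.center
  have e2 := normSq_combination s C.center D.center B.center
  have e3 := normSq_combination t A.center B.center (s • C.center + (1 - s) • D.center)
  have sw : ∀ x y : ℂ, Complex.normSq (x - y) = Complex.normSq (y - x) := fun x y => by
    rw [← Complex.normSq_neg, neg_sub]
  rw [← e, sub_self, map_zero, e] at e3
  rw [sw A.center (s • _ + _)] at e1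
  rw [sw B.center (s • _ + _)] at e2
  simp only [normSq_center_sub] at e1 e2 e3
  have p1 := sub_nonneg.2 hAB
  have p2 := sub_nonneg.2 hCD
  have q1 := sub_nonneg.2 ht1
  have q2 := sub_nonneg.2 hs1
  have n1 : 0 ≤ 2 * (t * A.radius) * ((1 - t) * B.radius) * (1 - invProd A B) := by positivity
  have n2 : 0 ≤ 2 * (s * C.radius) * ((1 - s) * D.radius) * (1 - invProd C D) := by positivity
  have n3 : 0 ≤ 2 * (t * A.radius) * (s * C.radius) * invProd A C := by positivity
  have n4 : 0 ≤ 2 * (t * A.radius) * ((1 - s) * D.radius) * invProd A D := by positivity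
  have n5 : 0 ≤ 2 * ((1 - t) * B.radius) * (s * C.radius) * invProd B C := by positivity
  have n6 : 0 ≤ 2 * ((1 - t) * B.radius) * ((1 - s) * D.radius) * invProd B D := by positivity
  have m1 := sq_nonneg (t * A.radius - (1 - t) * B.radius)
  have m2 := sq_nonneg (s * C.radius - (1 - s) * D.radius)
  -- Three applications of Stewart's theorem make a sum of nonnegative terms vanish. The squares
  -- force the crossing point to be interior to both segments, so the remaining factors vanish too.
  have total : (t * A.radius - (1 - t) * B.radius) ^ 2 + (s * C.radius - (1 - s) * D.radius) ^ 2 +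
      2 * (t * A.radius) * ((1 - t) * B.radius) * (1 - invProd A B) +
      2 * (s * C.radius) * ((1 - s) * D.radius) * (1 - invProd C D) +
      2 * (t * A.radius) * (s * C.radius) * invProd A C +
      2 * (t * A.radius) * ((1 - s) * D.radius) * invProd A D +
      2 * ((1 - t) * B.radius) * (s * C.radius) * invProd B C +
      2 * ((1 - t) * B.radius) * ((1 - s) * D.radius) * invProd B D = 0 := by
    linear_combination -e3 - t * e1 - (1 - t) * e2
  have z1 : t * A.radius - (1 - t) * B.radius = 0 := pow_eq_zero_iff two_ne_zero |>.1 (by linarith)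
  have z2 : s * C.radius - (1 - s) * D.radius = 0 := pow_eq_zero_iff two_ne_zero |>.1 (by linarith)
  have pos : ∀ x a b : ℝ, 0 ≤ x → x ≤ 1 → 0 < a → 0 < b → x * a - (1 - x) * b = 0 →
      0 < x ∧ 0 < 1 - x := by
    intro x a b hx hx1 ha hb h
    refine ⟨lt_of_le_of_ne hx ?_, lt_of_le_of_ne (sub_nonneg.2 hx1) ?_⟩
    · rintro rfl
      linarith
    · intro h'
      rw [← h', zero_mul, sub_zero] at h
      have : x = 1 := by linarith
      subst this
      linarith
  obtain ⟨t0, t1⟩ := pos t _ _ ht0 ht1 hA hB z1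
  obtain ⟨s0, s1⟩ := pos s _ _ hs0 hs1 hC hD z2
  have fin : ∀ a b x : ℝ, 0 < a → 0 < b → 0 ≤ 2 * a * b * x → 2 * a * b * x ≤ 0 → x = 0 := by
    intro a b x ha hb h h'
    have h0 : 2 * a * b * x = 0 := le_antisymm h' h
    exact (mul_eq_zero.1 h0).resolve_left (by positivity)
  have tA := mul_pos t0 hA
  have tB := mul_pos t1 hB
  have sC := mul_pos s0 hC
  have sD := mul_pos s1 hD
  refine ⟨?_, ?_, fin _ _ _ tA sC n3 (by linarith), fin _ _ _ tA sD n4 (by linarith),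
    fin _ _ _ tB sC n5 (by linarith), fin _ _ _ tB sD n6 (by linarith)⟩
  · linarith [fin _ _ _ tA tB n1 (by linarith)]
  · linarith [fin _ _ _ sC sD n2 (by linarith)]

/-! ### Combinatorial and geometric data of a realization -/

/-- The combinatorial properties of a triangulated plane, with graph `G` and set of faces `F`. -/
structure IsTriangulation {V : Type*} (G : SimpleGraph V) (F : Set (Finset V)) : Prop where
  card : ∀ T ∈ F, T.card = 3
  adj : ∀ T ∈ F, ∀ u ∈ T, ∀ v ∈ T, u ≠ v → G.Adj u v
  two_faces : ∀ a b, G.Adj a b → ∃ S ∈ F, ∃ T ∈ F, S ≠ T ∧ a ∈ S ∧ b ∈ S ∧ a ∈ T ∧ b ∈ T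
  finite_nbrs : ∀ v, {u | G.Adj v u}.Finite
  connected : ∀ x y, Nonempty (G.Walk x y)
  infinite : Infinite V

/-- The geometric properties of a pattern of disks, with contact graph and faces given by a
triangulation, that are used in the rigidity proof. -/
structure IsPacking {V : Type*} (G : SimpleGraph V) (F : Set (Finset V)) (P : V → ClosedDisk) :
    Prop where
  invProd_nonneg : ∀ u v, u ≠ v → 0 ≤ invProd (P u) (P v)
  invProd_le_one : ∀ u v, G.Adj u v → invProd (P u) (P v) ≤ 1
  drawing : IsDrawing G F fun v => (P v).center

theorem closedTri_subset_convexHull {V : Type*} (z : V → ℂ) (T : Finset V) :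
    closedTri z T ⊆ convexHull ℝ (z '' T) := by
  rintro p ⟨w, hw, h1, rfl⟩
  exact (convex_convexHull ℝ _).sum_mem hw h1 fun i hi =>
    subset_convexHull ℝ _ (mem_image_of_mem z hi)

/-- The convex hull of the centers of `T` is a compact subset of the unit disk and meets only
finitely many disks, whereas there are infinitely many. -/
theorem exists_notMem_closedTri {V : Type*} [Infinite V] {P : V → ClosedDisk}
    (hP : IsLocallyFiniteIn P (Metric.ball 0 1)) (T : Finset V) :
    ∃ x, x ∉ T ∧ (P x).center ∉ closedTri (fun v => (P v).center) T := by
  have hc : ∀ v, (P v).center ∈ (P v).carrier := fun v =>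
    Metric.mem_closedBall_self (P v).radius_pos.le
  by_contra! hcon
  have hfin := hP.2 (convexHull ℝ ((fun v => (P v).center) '' T))
    (convexHull_min (by rintro _ ⟨v, -, rfl⟩; exact hP.1 v (hc v)) (convex_ball 0 1))
    ((T.finite_toSet.image _).isCompact_convexHull ℝ)
  refine infinite_univ (hfin.subset fun v _ => ⟨(P v).center, hc v, ?_⟩)
  by_cases hv : v ∈ T
  · exact subset_convexHull ℝ _ (mem_image_of_mem _ hv)
  · exact closedTri_subset_convexHull _ _ (hcon v hv)

theorem Realizes.invProd_eq {V : Type*} {G : SimpleGraph V} {Θ : Sym2 V → ℝ} {P : V → ClosedDisk}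
    (hP : Realizes P G Θ) {u v : V} (h : G.Adj u v) :
    invProd (P u) (P v) = Real.cos (Θ s(u, v)) := by
  have := hP.dihedralAngle u v (by rw [hP.contactGraph_eq]; exact Or.inl h)
  rw [invProd_eq_cos this, completedAngle, if_pos (by simpa using h)]

/-- Added edges carry the angle 0, so their inversive product is 1, and disjoint disks have a larger
one. An inversive product below 1 thus forces an edge of `G` itself. -/
theorem Realizes.invProd_of_not_adj {V : Type*} {G : SimpleGraph V} {Θ : Sym2 V → ℝ}
    {P : V → ClosedDisk} (hP : Realizes P G Θ) {u v : V} (huv : u ≠ v) (h : ¬ G.Adj u v) :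
    1 ≤ invProd (P u) (P v) := by
  by_cases hc : ((P u).carrier ∩ (P v).carrier).Nonempty
  · have := hP.dihedralAngle u v ⟨huv, hc⟩
    rw [invProd_eq_cos this, completedAngle, if_neg (by simpa using h), Real.cos_zero]
  · exact (one_lt_invProd hc).le

theorem Realizes.invProd_nonneg {V : Type*} {G : SimpleGraph V} {Θ : Sym2 V → ℝ}
    {P : V → ClosedDisk} (hΘ : ∀ e ∈ G.edgeSet, Θ e ∈ Icc 0 (Real.pi / 2)) (hP : Realizes P G Θ)
    {u v : V} (huv : u ≠ v) : 0 ≤ invProd (P u) (P v) := by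
  by_cases h : G.Adj u v
  · rw [hP.invProd_eq h]
    have := hΘ s(u, v) (by simpa using h)
    exact Real.cos_nonneg_of_neg_pi_div_two_le_of_le (by linarith [this.1, Real.pi_pos]) this.2
  · exact zero_le_one.trans (hP.invProd_of_not_adj huv h)

/-- This is where (C1) enters. If two segments of centers crossed, the four disks would form two
tangent pairs, each orthogonal to the other. All four triangles then have angle sum at least π, so
none separates, all are faces, and they form a tetrahedron. -/
theorem exists_isTriangulation {V : Type*} {G : SimpleGraph V} {Θ : Sym2 V → ℝ}
    (hG : IsDiskTriangulationGraph G) (hΘ : ∀ e ∈ G.edgeSet, Θ e ∈ Icc 0 (Real.pi / 2))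
    (hsep : SeparatingTriangleCondition G Θ) : ∃ F : Set (Finset V), IsTriangulation G F ∧
      ∀ P : V → ClosedDisk, Realizes P G Θ → IsLocallyFiniteIn P (Metric.ball 0 1) →
        IsPacking G F P := by
  classical
  obtain ⟨K, ⟨hlf, ⟨Φ⟩⟩, hadj'⟩ := hG
  have Ψ : realization K ≃ₜ ℂ := Φ.trans (Homeomorph.unitBall (E := ℂ)).symm
  have hadj : ∀ u v, G.Adj u v ↔ u ≠ v ∧ {u, v} ∈ K.faces := by
    intro u v
    rw [hadj']
    refine and_congr_right fun _ => ⟨?_, fun h => ⟨_, h, by simp⟩⟩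
    rintro ⟨s, hs, e⟩
    have : s = {u, v} := Finset.coe_injective (by rw [e]; simp)
    exact this ▸ hs
  have hinf : Infinite V := infinite_of_homeomorph_plane Ψ
  have htri : IsTriangulation G {T | T ∈ K.faces ∧ T.card = 3} := by
    refine ⟨fun T hT => hT.2, fun T hT u hu v hv huv => adj_of_mem_face hadj hT.1 hu hv huv, ?_,
      ?_, fun x y => connected_of_homeomorph_plane Ψ hadj x y, hinf⟩
    · intro a b hab
      obtain ⟨c, d, hcd, hca, hcb, hda, hdb, h1, h2⟩ :=
        exists_two_faces Ψ hab.ne ((hadj a b).1 hab).2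
      refine ⟨_, ⟨h1, Finset.card_eq_three.2 ⟨a, b, c, hab.ne, hca.symm, hcb.symm, rfl⟩⟩, _,
        ⟨h2, Finset.card_eq_three.2 ⟨a, b, d, hab.ne, hda.symm, hdb.symm, rfl⟩⟩, ?_, by simp,
        by simp, by simp, by simp⟩
      intro e
      have : c ∈ ({a, b, d} : Finset V) := by rw [← e]; simp
      simp [hca, hcb, hcd] at this
    · intro v
      refine ((hlf v).biUnion fun s _ => s.finite_toSet).subset fun u hu => ?_
      exact mem_biUnion (x := {v, u}) ⟨((hadj v u).1 hu).2, by simp⟩ (by simp)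
  refine ⟨_, htri, fun P hP hfin => ⟨fun u v huv => hP.invProd_nonneg hΘ huv, fun u v h => ?_, ?_⟩⟩
  · rw [hP.invProd_eq h]
    exact Real.cos_le_one _
  have hnn := fun u v huv => hP.invProd_nonneg hΘ (u := u) (v := v) huv
  have hle : ∀ u v, G.Adj u v → invProd (P u) (P v) ≤ 1 := fun u v h => by
    rw [hP.invProd_eq h]
    exact Real.cos_le_one _
  refine ⟨htri.card, ?_, htri.adj, ?_, ?_, ?_, fun T _ => exists_notMem_closedTri hfin T⟩
  · intro u v e
    by_contra huv
    have h := normSq_center_sub (P u) (P v)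
    have := hnn u v huv
    have := (P u).radius_pos
    have := (P v).radius_pos
    simp only at e
    rw [e, sub_self, map_zero] at h
    have : 0 < (P u).radius ^ 2 + (P v).radius ^ 2 +
      2 * (P u).radius * (P v).radius * invProd (P u) (P v) := by positivity
    linarith
  · exact fun a b d hab hda hdb t ht =>
      center_ne_of_invProd (hle a b hab) (hnn d a hda) (hnn d b hdb) ht
  · intro a b c d hab hcd hac had hbc hbd t ht s hs e
    obtain ⟨e1, e2, e3, e4, e5, e6⟩ := invProd_of_crossing (hle a b hab) (hle c d hcd)
      (hnn a c hac) (hnn a d had) (hnn b c hbc) (hnn b d hbd) ht hs e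
    have right : ∀ u v, u ≠ v → invProd (P u) (P v) = 0 → G.Adj u v ∧
        Θ s(u, v) = Real.pi / 2 := by
      intro u v huv h0
      have hA : G.Adj u v := by
        by_contra hA
        have := hP.invProd_of_not_adj huv hA
        linarith
      refine ⟨hA, ?_⟩
      rw [hP.invProd_eq hA] at h0
      have hm := hΘ s(u, v) (by simpa using hA)
      by_contra hne
      have := Real.cos_pos_of_mem_Ioo (x := Θ s(u, v)) ⟨by linarith [hm.1, Real.pi_pos],
        lt_of_le_of_ne hm.2 hne⟩
      linarith
    have face : ∀ u v w, u ≠ v → v ≠ w → w ≠ u → G.Adj u v → invProd (P v) (P w) = 0 →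
        invProd (P w) (P u) = 0 → {u, v, w} ∈ K.faces := by
      intro u v w huv hvw hwu hA h1 h2
      obtain ⟨A1, t1⟩ := right v w hvw h1
      obtain ⟨A2, t2⟩ := right w u hwu h2
      refine face_of_not_separatesVertices Ψ hadj hA A1 A2 fun hs => ?_
      have := hsep u v w hA A1 A2 hs
      have := (hΘ s(u, v) (by simpa using hA)).1
      linarith
    have e5' := e5
    have e3' := e3
    have e4' := e4
    have e6' := e6
    rw [invProd_comm] at e3' e4' e5' e6'
    refine not_tetrahedron Ψ hab.ne hbc hac.symm had.symm hbd.symm hcd.ne.symm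
      (face a b c hab.ne hbc hac.symm hab e5 e3') ?_ ?_
      (face a b d hab.ne hbd had.symm hab e6 e4')
    · have := face c d b hcd.ne hbd.symm hbc hcd e6' e5
      rwa [show ({b, c, d} : Finset V) = {c, d, b} by ext; simp; tauto]
    · have := face c d a hcd.ne had.symm hac hcd e4' e3
      rwa [show ({c, a, d} : Finset V) = {c, d, a} by ext; simp; tauto]
  · rintro T ⟨hT, h3⟩ x y hx hy
    obtain ⟨a, b, c, hab, hac, hbc, rfl⟩ := Finset.card_eq_three.1 h3
    obtain ⟨p, hp⟩ := exists_walk_avoiding_face Ψ hadj hab hbc hac.symm hT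
      (x := x) (y := y) (by simpa using hx) (by simpa using hy)
    exact ⟨p, fun u hu => by simpa using hp u hu⟩

end DiskPatterns

namespace DiskPatterns

open Set

/-! ### Flowers -/

/-- The neighbors of a vertex. -/
abbrev Nbr {V : Type*} (G : SimpleGraph V) (v : V) : Type _ := {a // G.Adj v a}

theorem exists_eq_insert {V : Type*} [DecidableEq V] {T : Finset V} (hT : T.card = 3) {a b : V}
    (hab : a ≠ b) (ha : a ∈ T) (hb : b ∈ T) : ∃ c, c ≠ a ∧ c ≠ b ∧ T = {a, b, c} := by
  have h1 : ((T.erase a).erase b).card = 1 := by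
    rw [Finset.card_erase_of_mem (Finset.mem_erase.2 ⟨hab.symm, hb⟩), Finset.card_erase_of_mem ha,
      hT]
  obtain ⟨c, hc⟩ := Finset.card_eq_one.1 h1
  have hc' : c ∈ (T.erase a).erase b := by rw [hc]; simp
  simp only [Finset.mem_erase] at hc'
  refine ⟨c, hc'.2.1, hc'.1, ?_⟩
  rw [← hc, Finset.insert_erase (Finset.mem_erase.2 ⟨hab.symm, hb⟩), Finset.insert_erase ha]

theorem cross_sub_swap (a b c : ℂ) : cross (a - b) (c - b) = -cross (b - a) (c - a) := by
  simp only [cross, Complex.sub_re, Complex.sub_im]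
  ring

section Wrap

variable {V : Type*} [DecidableEq V] {G : SimpleGraph V} {F : Set (Finset V)} {z : V → ℂ}

theorem IsDrawing.exists_sides (hF : IsTriangulation G F) (h : IsDrawing G F z) {v a : V}
    (hva : G.Adj v a) : ∃ c d, c ≠ v ∧ c ≠ a ∧ d ≠ v ∧ d ≠ a ∧ {v, a, c} ∈ F ∧ {v, a, d} ∈ F ∧
      0 < cross (z a - z v) (z c - z v) ∧ cross (z a - z v) (z d - z v) < 0 := by
  obtain ⟨S, hS, T, hT, hST, hvS, haS, hvT, haT⟩ := hF.two_faces v a hva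
  obtain ⟨c, hcv, hca, rfl⟩ := exists_eq_insert (hF.card S hS) hva.ne hvS haS
  obtain ⟨d, hdv, hda, rfl⟩ := exists_eq_insert (hF.card T hT) hva.ne hvT haT
  have hcd : c ≠ d := fun e => hST (by rw [e])
  rcases lt_or_gt_of_ne (h.cross_ne_zero hva.ne hca.symm hcv hS) with h1 | h1 <;>
    rcases lt_or_gt_of_ne (h.cross_ne_zero hva.ne hda.symm hdv hT) with h2 | h2
  · refine absurd (h.eq_of_cross_pos hva.ne' hcv.symm hca hdv.symm hda
      (by rwa [Finset.insert_comm]) (by rwa [Finset.insert_comm]) ?_ ?_) hcd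
    · rw [cross_sub_swap]; linarith
    · rw [cross_sub_swap]; linarith
  · exact ⟨d, c, hdv, hda, hcv, hca, hT, hS, h2, h1⟩
  · exact ⟨c, d, hcv, hca, hdv, hda, hS, hT, h1, h2⟩
  · exact absurd (h.eq_of_cross_pos hva.ne hca.symm hcv hda.symm hdv hS hT h1 h2) hcd

/-- Multiplication by `q` turns by an angle in (0, π). The principal argument loses 2π exactly when
the turn crosses the cut, from nonnegative to negative imaginary part. -/
theorem arg_mul_cases {x q : ℂ} (hx : x ≠ 0) (hq : 0 < q.im) :
    (x * q).arg = x.arg + q.arg - if 0 ≤ x.im ∧ (x * q).im < 0 then 2 * Real.pi else 0 := by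
  have hq0 : q ≠ 0 := by rintro rfl; simp at hq
  have h0 : 0 < q.arg := by
    have := Complex.arg_nonneg_iff.2 hq.le
    refine lt_of_le_of_ne this fun h => ?_
    have := (Complex.arg_eq_zero_iff.1 h.symm).2
    linarith
  have h1 : q.arg < Real.pi := by
    refine lt_of_le_of_ne (Complex.arg_le_pi q) fun h => ?_
    have := (Complex.arg_eq_pi_iff.1 h).2
    linarith
  obtain ⟨k, hk⟩ := Real.Angle.angle_eq_iff_two_pi_dvd_sub.1
    (show (((x * q).arg : ℝ) : Real.Angle) = ((x.arg + q.arg : ℝ) : Real.Angle) by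
      rw [Complex.arg_mul_coe_angle hx hq0, Real.Angle.coe_add])
  have hpi := Real.pi_pos
  have b1 := Complex.neg_pi_lt_arg x
  have b2 := Complex.arg_le_pi x
  have b3 := Complex.neg_pi_lt_arg (x * q)
  have b4 := Complex.arg_le_pi (x * q)
  have hk0 : ∀ m : ℤ, 2 * Real.pi * (m - 1) < 2 * Real.pi * k →
      2 * Real.pi * k < 2 * Real.pi * (m + 1) → k = m := by
    intro m h1 h2
    have h1 := lt_of_mul_lt_mul_left h1 (by positivity)
    have h2 := lt_of_mul_lt_mul_left h2 (by positivity)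
    have h1 : m - 1 < k := by exact_mod_cast h1
    have h2 : k < m + 1 := by exact_mod_cast h2
    omega
  split_ifs with hc
  · have c1 := Complex.arg_nonneg_iff.2 hc.1
    have c2 := Complex.arg_neg_iff.2 hc.2
    have := hk0 (-1) (by push_cast; linarith) (by push_cast; linarith)
    rw [this] at hk
    push_cast at hk
    linarith
  · have : k = 0 := by
      rw [not_and_or, not_le, not_lt] at hc
      rcases hc with hc | hc
      · have c1 := Complex.arg_neg_iff.2 hc
        exact hk0 0 (by push_cast; linarith) (by push_cast; linarith)
      · have c1 := Complex.arg_nonneg_iff.2 hc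
        by_cases c2 : 0 ≤ x.arg
        · exact hk0 0 (by push_cast; linarith) (by push_cast; linarith)
        · exact hk0 0 (by push_cast; linarith) (by push_cast; linarith)
    rw [this] at hk
    push_cast at hk
    linarith

theorem exists_pos_forall_lt {x y : ℝ} (hx : 0 < x) : ∃ ε₀ > 0, ∀ ε, 0 < ε → ε < ε₀ →
    0 < x + ε * y := by
  refine ⟨x / (1 + |y|), by positivity, fun ε h0 h1 => ?_⟩
  rw [lt_div_iff₀ (by positivity)] at h1
  nlinarith [neg_abs_le y]

/-- If the open sector spanned by a face at `v` contains the directions just below the negative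
real axis, then so does the face near `v`. -/
theorem exists_mem_openTri_of_wrap {v a b : V} (hva : v ≠ a) (hab : a ≠ b) (hbv : b ≠ v)
    (hc : 0 < cross (z a - z v) (z b - z v)) (ha : 0 ≤ (z a - z v).im)
    (hb : (z b - z v).im < 0) : ∃ ε₀ > 0, ∀ ε : ℝ, 0 < ε → ε < ε₀ → ∃ δ₀ > 0, ∀ δ : ℝ, 0 < δ →
      δ < δ₀ → z v + δ • (⟨-1, -ε⟩ : ℂ) ∈ openTri z {v, a, b} := by
  set x := z a - z v with hx
  set y := z b - z v with hy
  have h1 : ∃ ε₀ > 0, ∀ ε : ℝ, 0 < ε → ε < ε₀ → 0 < x.im + ε * -x.re := by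
    rcases ha.lt_or_eq with ha | ha
    · exact exists_pos_forall_lt ha
    · refine ⟨1, one_pos, fun ε h0 _ => ?_⟩
      have : x.re < 0 := by
        unfold cross at hc
        rw [← ha] at hc
        by_contra! hcon
        nlinarith
      nlinarith
  obtain ⟨ε₁, h1, H1⟩ := h1
  obtain ⟨ε₂, h2, H2⟩ := exists_pos_forall_lt (x := -y.im) (y := y.re) (by linarith)
  refine ⟨min ε₁ ε₂, lt_min h1 h2, fun ε h0 hlt => ?_⟩
  have p1 := H1 ε h0 (hlt.trans_le (min_le_left _ _))
  have p2 := H2 ε h0 (hlt.trans_le (min_le_right _ _))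
  set D := cross x y with hD
  have q1 := div_pos p1 hc
  have q2 := div_pos p2 hc
  set β := (x.im + ε * -x.re) / D with hβ
  set α := (-y.im + ε * y.re) / D with hα
  refine ⟨1 / (α + β), by positivity, fun δ hδ hlt => ?_⟩
  rw [lt_div_iff₀ (by positivity)] at hlt
  have e : (⟨-1, -ε⟩ : ℂ) = α • x + β • y := by
    have hD0 := hc.ne'
    apply Complex.ext
    · simp only [Complex.add_re, Complex.real_smul, Complex.mul_re, Complex.ofReal_re,
        Complex.ofReal_im, zero_mul, sub_zero, hα, hβ]
      field_simp
      rw [hD, cross]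
      ring
    · simp only [Complex.add_im, Complex.real_smul, Complex.mul_im, Complex.ofReal_re,
        Complex.ofReal_im, zero_mul, add_zero, hα, hβ]
      field_simp
      rw [hD, cross]
      ring
  have := mem_openTri z hva hab hbv (α := 1 - δ * α - δ * β) (β := δ * α) (γ := δ * β)
    (by linarith) (by positivity) (by positivity) (by ring)
  convert this using 1
  rw [e, hx, hy]
  module

end Wrap

/-- The angular ordering of the neighbors of `v` in a drawing. -/
structure IsFlower {V : Type*} [DecidableEq V] {G : SimpleGraph V} (F : Set (Finset V)) (z : V → ℂ)
    (v : V) (σ : Equiv.Perm (Nbr G v)) : Prop where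
  face : ∀ a, {v, a.1, (σ a).1} ∈ F
  pos : ∀ a : Nbr G v, 0 < cross (z a - z v) (z (σ a) - z v)
  eq_or_eq : ∀ a b : Nbr G v, a ≠ b → {v, a.1, b.1} ∈ F → b = σ a ∨ a = σ b

theorem IsDrawing.exists_isFlower {V : Type*} [DecidableEq V] {G : SimpleGraph V}
    {F : Set (Finset V)} {z : V → ℂ} (hF : IsTriangulation G F) (h : IsDrawing G F z) (v : V) :
    ∃ σ : Equiv.Perm (Nbr G v), IsFlower F z v σ := by
  have key : ∀ a : Nbr G v, ∃ c d : Nbr G v, c ≠ a ∧ d ≠ a ∧ {v, a.1, c.1} ∈ F ∧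
      {v, a.1, d.1} ∈ F ∧ 0 < cross (z a - z v) (z c - z v) ∧
      cross (z a - z v) (z d - z v) < 0 := by
    rintro ⟨a, ha⟩
    obtain ⟨c, d, hcv, hca, hdv, hda, h1, h2, h3, h4⟩ := h.exists_sides hF ha
    exact ⟨⟨c, hF.adj _ h1 v (by simp) c (by simp) hcv.symm⟩,
      ⟨d, hF.adj _ h2 v (by simp) d (by simp) hdv.symm⟩, fun e => hca (congrArg Subtype.val e),
      fun e => hda (congrArg Subtype.val e), h1, h2, h3, h4⟩
  choose f g hf hg hfF hgF hfpos hgneg using key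
  have uniq : ∀ a c : Nbr G v, c ≠ a → {v, a.1, c.1} ∈ F → 0 < cross (z a - z v) (z c - z v) →
      c = f a := fun a c hca hc hpos => Subtype.ext <|
    h.eq_of_cross_pos a.2.ne (fun e => hca (Subtype.ext e.symm)) c.2.ne'
      (fun e => hf a (Subtype.ext e.symm)) (f a).2.ne' hc (hfF a) hpos (hfpos a)
  have uniq' : ∀ a c : Nbr G v, c ≠ a → {v, a.1, c.1} ∈ F → cross (z a - z v) (z c - z v) < 0 →
      c = g a := fun a c hca hc hneg => Subtype.ext <|
    h.eq_of_cross_pos a.2.ne' c.2.ne (fun e => hca (Subtype.ext e))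
      (g a).2.ne (fun e => hg a (Subtype.ext e))
      (by rwa [Finset.insert_comm]) (by rw [Finset.insert_comm]; exact hgF a)
      (by rw [cross_sub_swap]; linarith) (by rw [cross_sub_swap]; linarith [hgneg a])
  have swap : ∀ a b : V, ({v, a, b} : Finset V) = {v, b, a} := fun a b => by
    rw [Finset.pair_comm]
  let σ : Equiv.Perm (Nbr G v) :=
    { toFun := f
      invFun := g
      left_inv := fun a => (uniq' (f a) a (hf a).symm (by rw [swap]; exact hfF a)
        (by rw [cross_swap]; linarith [hfpos a])).symm
      right_inv := fun a => (uniq (g a) a (hg a).symm (by rw [swap]; exact hgF a)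
        (by rw [cross_swap]; linarith [hgneg a])).symm }
  refine ⟨σ, hfF, hfpos, fun a b hab hb => ?_⟩
  have hne := h.cross_ne_zero a.2.ne (fun e => hab (Subtype.ext e)) b.2.ne' hb
  rcases lt_or_gt_of_ne hne with h1 | h1
  · exact Or.inr (uniq b a hab (by rwa [swap]) (by rw [cross_swap]; linarith))
  · exact Or.inl (uniq a b hab.symm hb h1)

theorem IsFlower.im_div_pos {V : Type*} [DecidableEq V] {G : SimpleGraph V} {F : Set (Finset V)}
    {z : V → ℂ} {v : V} {σ : Equiv.Perm (Nbr G v)} (hσ : IsFlower F z v σ) (a : Nbr G v) :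
    0 < ((z (σ a) - z v) / (z a - z v)).im := by
  have h := hσ.pos a
  have h0 : z a - z v ≠ 0 := by
    intro h0
    rw [h0] at h
    simp [cross] at h
  have hn := Complex.normSq_pos.2 h0
  rw [Complex.div_im, ← sub_div]
  refine div_pos ?_ hn
  unfold cross at h
  linarith

/-- The angles around a vertex of a drawing add up to `2π` along every cycle of the flower. -/
theorem IsFlower.sum_arg {V : Type*} [DecidableEq V] {G : SimpleGraph V} {F : Set (Finset V)}
    {z : V → ℂ} (h : IsDrawing G F z) {v : V} {σ : Equiv.Perm (Nbr G v)} (hσ : IsFlower F z v σ)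
    {S : Finset (Nbr G v)} (hS : S.Nonempty) (hmap : S.map σ.toEmbedding = S) :
    ∑ a ∈ S, ((z (σ a) - z v) / (z a - z v)).arg = 2 * Real.pi := by
  have hne : ∀ a : Nbr G v, z a - z v ≠ 0 := fun a => sub_ne_zero.2 (h.injective.ne a.2.ne')
  let wrap : Nbr G v → Prop := fun a => 0 ≤ (z a - z v).im ∧ (z (σ a) - z v).im < 0
  have e1 : ∀ a : Nbr G v, ((z (σ a) - z v) / (z a - z v)).arg =
      (z (σ a) - z v).arg - (z a - z v).arg + if wrap a then 2 * Real.pi else 0 := by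
    intro a
    have := arg_mul_cases (hne a) (hσ.im_div_pos a)
    rw [mul_div_cancel₀ _ (hne a)] at this
    rw [this]
    ring
  have e2 : ∑ a ∈ S, (z (σ a) - z v).arg = ∑ a ∈ S, (z a - z v).arg := by
    conv_rhs => rw [← hmap, Finset.sum_map]
    rfl
  -- The differences of arguments cancel over the invariant set, so 2π times the number of crossings
  -- of the cut remains. There is at least one because all angles are positive, and at most one
  -- because two crossing faces would share points just below the cut.
  have e3 : ∑ a ∈ S, ((z (σ a) - z v) / (z a - z v)).arg =
      ((S.filter wrap).card : ℝ) * (2 * Real.pi) := by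
    rw [Finset.sum_congr rfl fun a _ => e1 a, Finset.sum_add_distrib, Finset.sum_sub_distrib, e2,
      sub_self, zero_add, ← Finset.sum_filter, Finset.sum_const, nsmul_eq_mul]
  have hpos : 0 < ∑ a ∈ S, ((z (σ a) - z v) / (z a - z v)).arg := by
    refine Finset.sum_pos (fun a _ => ?_) hS
    have hi := hσ.im_div_pos a
    refine lt_of_le_of_ne (Complex.arg_nonneg_iff.2 hi.le) fun h => ?_
    have := (Complex.arg_eq_zero_iff.1 h.symm).2
    linarith
  have hcard : (S.filter wrap).card ≤ 1 := by
    refine Finset.card_le_one.2 fun a ha b hb => ?_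
    have ha := (Finset.mem_filter.1 ha).2
    have hb := (Finset.mem_filter.1 hb).2
    have dist : ∀ a : Nbr G v, a.1 ≠ (σ a).1 := fun a e => by
      have := hσ.pos a
      rw [← e] at this
      simp only [cross] at this
      linarith
    obtain ⟨ε₁, p1, H1⟩ :=
      exists_mem_openTri_of_wrap a.2.ne (dist a) (σ a).2.ne' (hσ.pos a) ha.1 ha.2
    obtain ⟨ε₂, p2, H2⟩ :=
      exists_mem_openTri_of_wrap b.2.ne (dist b) (σ b).2.ne' (hσ.pos b) hb.1 hb.2
    obtain ⟨ε, hε, hlt⟩ := exists_between (lt_min p1 p2)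
    obtain ⟨δ₁, q1, K1⟩ := H1 ε hε (hlt.trans_le (min_le_left _ _))
    obtain ⟨δ₂, q2, K2⟩ := H2 ε hε (hlt.trans_le (min_le_right _ _))
    obtain ⟨δ, hδ, hlt'⟩ := exists_between (lt_min q1 q2)
    have e := h.eq_of_mem_openTri (hσ.face a) (hσ.face b)
      (K1 δ hδ (hlt'.trans_le (min_le_left _ _))) (K2 δ hδ (hlt'.trans_le (min_le_right _ _)))
    have m1 : a.1 ∈ ({v, b.1, (σ b).1} : Finset V) := by rw [← e]; simp
    simp only [Finset.mem_insert, Finset.mem_singleton, a.2.ne', false_or] at m1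
    rcases m1 with m1 | m1
    · exact Subtype.ext m1
    · have m2 : b.1 ∈ ({v, a.1, (σ a).1} : Finset V) := by rw [e]; simp
      simp only [Finset.mem_insert, Finset.mem_singleton, b.2.ne', false_or] at m2
      rcases m2 with m2 | m2
      · exact Subtype.ext m2.symm
      · have h1 := ha.1
        rw [m1] at h1
        exact absurd hb.2 (not_lt.2 h1)
  rw [e3] at hpos ⊢
  have : (S.filter wrap).card = 1 := by
    refine le_antisymm hcard (Nat.one_le_iff_ne_zero.2 fun h0 => ?_)
    rw [h0] at hpos
    simp at hpos
  rw [this]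
  simp

/-- A flower consists of a single cycle. -/
theorem IsFlower.induction {V : Type*} [DecidableEq V] {G : SimpleGraph V} {F : Set (Finset V)}
    {z : V → ℂ} (h : IsDrawing G F z) {v : V} [Fintype (Nbr G v)] {σ : Equiv.Perm (Nbr G v)}
    (hσ : IsFlower F z v σ) {p : Nbr G v → Prop} (hp : ∀ a, p a → p (σ a)) {a : Nbr G v}
    (ha : p a) (b : Nbr G v) : p b := by
  classical
  by_contra hb
  set S := Finset.univ.filter p with hS
  have hmap : S.map σ.toEmbedding = S := by
    refine Finset.eq_of_subset_of_card_le (fun x hx => ?_) (by rw [Finset.card_map])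
    obtain ⟨y, hy, rfl⟩ := Finset.mem_map.1 hx
    exact Finset.mem_filter.2 ⟨Finset.mem_univ _, hp y (Finset.mem_filter.1 hy).2⟩
  have hmap' : Sᶜ.map σ.toEmbedding = Sᶜ := by
    refine Finset.eq_of_subset_of_card_le (fun x hx => ?_) (by rw [Finset.card_map])
    obtain ⟨y, hy, rfl⟩ := Finset.mem_map.1 hx
    rw [Finset.mem_compl] at hy ⊢
    rw [← hmap]
    simpa using hy
  -- A proper invariant set and its complement would each contribute 2π to a total of 2π.
  have s1 := hσ.sum_arg h ⟨a, by simpa [hS] using ha⟩ hmap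
  have s2 := hσ.sum_arg h ⟨b, by simpa [hS] using hb⟩ hmap'
  have s3 := hσ.sum_arg h (S := Finset.univ) ⟨a, Finset.mem_univ a⟩ (by ext; simp)
  rw [← Finset.sum_add_sum_compl S, s1, s2] at s3
  linarith [Real.pi_pos]

end DiskPatterns

namespace DiskPatterns

open Set

/-! ### Lorentz boosts of `ℝ^{2,1}` -/

/-- The Euclidean inner product of the plane. -/
def dot (x y : ℂ) : ℝ := x.re * y.re + x.im * y.im

/-- The spatial part of the boost, of velocity direction `n`, of the vector `(X, T)`. -/
noncomputable def boostX (n X : ℂ) (T : ℝ) : ℂ :=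
  X + (dot X n / (1 + √(1 + Complex.normSq n)) - T) • n

/-- The time part of the boost of `(X, T)`. -/
noncomputable def boostT (n X : ℂ) (T : ℝ) : ℝ := √(1 + Complex.normSq n) * T - dot X n

theorem sq_sqrt_one_add_normSq (n : ℂ) :
    √(1 + Complex.normSq n) ^ 2 = 1 + (n.re * n.re + n.im * n.im) := by
  rw [Real.sq_sqrt (by have := Complex.normSq_nonneg n; linarith), Complex.normSq_apply]

/-- Boosts preserve the Lorentz form X · Y - ST. -/
theorem dot_boostX (n X Y : ℂ) (S T : ℝ) :
    dot (boostX n X S) (boostX n Y T) = boostT n X S * boostT n Y T + (dot X Y - S * T) := by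
  have hm := sq_sqrt_one_add_normSq n
  unfold boostX boostT
  have h0 : 0 ≤ √(1 + Complex.normSq n) := Real.sqrt_nonneg _
  generalize √(1 + Complex.normSq n) = m at *
  have h1 : 1 + m ≠ 0 := by positivity
  obtain ⟨x, hx⟩ : ∃ x, x = dot X n / (1 + m) := ⟨_, rfl⟩
  obtain ⟨y, hy⟩ : ∃ y, y = dot Y n / (1 + m) := ⟨_, rfl⟩
  have hx' : dot X n = x * (1 + m) := by rw [hx]; field_simp
  have hy' : dot Y n = y * (1 + m) := by rw [hy]; field_simp
  rw [← hx, ← hy, hx', hy']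
  simp only [dot, Complex.add_re, Complex.add_im, Complex.real_smul, Complex.mul_re,
    Complex.mul_im, Complex.ofReal_re, Complex.ofReal_im, zero_mul, sub_zero, add_zero] at *
  linear_combination (y - T) * hx' + (x - S) * hy' - (x - S) * (y - T) * hm

theorem cross_boostX (n X Y : ℂ) (S T : ℝ) : cross (boostX n X S) (boostX n Y T) =
    √(1 + Complex.normSq n) * cross X Y - T * cross X n + S * cross Y n := by
  have hm := sq_sqrt_one_add_normSq n
  unfold boostX
  have h0 : 0 ≤ √(1 + Complex.normSq n) := Real.sqrt_nonneg _
  generalize √(1 + Complex.normSq n) = m at *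
  have h1 : 1 + m ≠ 0 := by positivity
  simp only [dot, cross, Complex.add_re, Complex.add_im, Complex.real_smul, Complex.mul_re,
    Complex.mul_im, Complex.ofReal_re, Complex.ofReal_im, zero_mul, sub_zero, add_zero] at *
  field_simp
  linear_combination -(1 + m) * (X.re * Y.im - X.im * Y.re) * hm

theorem boostX_zero (X : ℂ) (T : ℝ) : boostX 0 X T = X := by
  simp [boostX]

theorem continuous_boostX_smul (n X : ℂ) (T : ℝ) :
    Continuous fun τ : ℝ => boostX (τ • n) X T := by
  have h1 : Continuous fun τ : ℝ => Complex.normSq (τ • n) :=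
    Complex.continuous_normSq.comp (by fun_prop)
  have h2 : Continuous fun τ : ℝ => dot X (τ • n) := by
    simp only [dot, Complex.real_smul, Complex.mul_re, Complex.mul_im, Complex.ofReal_re,
      Complex.ofReal_im]
    fun_prop
  have h3 : ∀ τ : ℝ, 1 + √(1 + Complex.normSq (τ • n)) ≠ 0 := fun τ => by positivity
  exact continuous_const.add (((h2.div (by fun_prop) h3).sub continuous_const).smul (by fun_prop))

theorem dot_self (x : ℂ) : dot x x = Complex.normSq x := (Complex.normSq_apply x).symm

/-- Two vectors `(X, S)` and `(Y, T)` of `ℝ^{2,1}` that represent two disks tangent or orthogonal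
or at an acute angle to a given disk, and at a nonobtuse or imaginary angle to each other. -/
structure IsConfig (p q c : ℝ) (X : ℂ) (S : ℝ) (Y : ℂ) (T : ℝ) : Prop where
  left_mem : p ∈ Icc (0 : ℝ) 1
  right_mem : q ∈ Icc (0 : ℝ) 1
  nonneg : 0 ≤ c
  left_ne : S ≠ 0 ∨ X ≠ 0
  right_ne : T ≠ 0 ∨ Y ≠ 0
  dot_left : dot X X = S * S + (1 - p * p)
  dot_right : dot Y Y = T * T + (1 - q * q)
  dot_eq : dot X Y = S * T - (p * q + c)

theorem boost_ne (n : ℂ) {X : ℂ} {S : ℝ} (h : S ≠ 0 ∨ X ≠ 0) :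
    boostT n X S ≠ 0 ∨ boostX n X S ≠ 0 := by
  by_contra! hcon
  obtain ⟨h1, h2⟩ := hcon
  have e0 : ∀ Y T, dot X Y - S * T = 0 := fun Y T => by
    have := dot_boostX n X Y S T
    rw [h1, h2] at this
    simpa [dot] using this.symm
  have e1 := e0 0 1
  have e2 := e0 X S
  have hS : S = 0 := by simpa [dot] using e1
  have hX : dot X X = 0 := by rw [hS] at e2; linarith
  rw [dot_self, Complex.normSq_eq_zero] at hX
  tauto

namespace IsConfig

variable {p q c : ℝ} {X Y : ℂ} {S T : ℝ}

theorem boost (h : IsConfig p q c X S Y T) (n : ℂ) :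
    IsConfig p q c (boostX n X S) (boostT n X S) (boostX n Y T) (boostT n Y T) where
  left_mem := h.left_mem
  right_mem := h.right_mem
  nonneg := h.nonneg
  left_ne := boost_ne n h.left_ne
  right_ne := boost_ne n h.right_ne
  dot_left := by rw [dot_boostX, h.dot_left]; ring
  dot_right := by rw [dot_boostX, h.dot_right]; ring
  dot_eq := by rw [dot_boostX, h.dot_eq]; ring

theorem left_ne_zero (h : IsConfig p q c X S Y T) : X ≠ 0 := by
  rintro rfl
  have h1 := h.dot_left
  have h2 := h.left_mem
  rcases h.left_ne with h3 | h3
  · have : 0 < S * S := mul_self_pos.2 h3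
    simp [dot] at h1
    nlinarith [h2.1, h2.2]
  · exact h3 rfl

theorem symm (h : IsConfig p q c X S Y T) : IsConfig q p c Y T X S where
  left_mem := h.right_mem
  right_mem := h.left_mem
  nonneg := h.nonneg
  left_ne := h.right_ne
  right_ne := h.left_ne
  dot_left := h.dot_right
  dot_right := h.dot_left
  dot_eq := by
    have := h.dot_eq
    simp only [dot] at *
    linarith

theorem right_ne_zero (h : IsConfig p q c X S Y T) : Y ≠ 0 := h.symm.left_ne_zero

/-- The two directions are never equal. -/
theorem neg_div_mem_slitPlane (h : IsConfig p q c X S Y T) : -(Y / X) ∈ Complex.slitPlane := by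
  rw [Complex.mem_slitPlane_iff]
  by_contra! hcon
  obtain ⟨h1, h2⟩ := hcon
  set r := (Y / X).re with hr
  have hX := h.left_ne_zero
  have hY : Y = r • X := by
    rw [Complex.real_smul, ← div_eq_iff hX]
    apply Complex.ext
    · simp [hr]
    · simpa using h2
  have hr0 : 0 ≤ r := by simpa [hr] using h1
  have hr1 : 0 < r := lt_of_le_of_ne hr0 (by
    intro h0
    rw [← h0, zero_smul] at hY
    exact h.right_ne_zero hY)
  have e1 := h.dot_left
  have e2 := h.dot_right
  have e3 := h.dot_eq
  have hL : 0 < dot X X := by rw [dot_self]; exact Complex.normSq_pos.2 hX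
  have d1 : dot X Y = r * dot X X := by
    rw [hY]; simp [dot]; ring
  have d2 : dot Y Y = r ^ 2 * dot X X := by
    rw [hY]; simp [dot]; ring
  rw [d1] at e3
  rw [d2] at e2
  obtain ⟨p0, p1⟩ := h.left_mem
  obtain ⟨q0, q1⟩ := h.right_mem
  have hc := h.nonneg
  have pq := mul_nonneg p0 q0
  -- If Y = rX with r > 0, the three relations of the configuration combine to a vanishing sum of
  -- nonnegative terms. This forces p = q = 1 and pq + c = 0, which is absurd.
  have key : (r * S - T) ^ 2 + r ^ 2 * (1 - p * p) + (1 - q * q) + 2 * r * (p * q + c) = 0 := by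
    linear_combination 2 * r * e3 - r ^ 2 * e1 - e2
  have n1 : 0 ≤ 1 - p * p := by nlinarith
  have n2 : 0 ≤ 1 - q * q := by nlinarith
  have n3 : 0 ≤ r ^ 2 * (1 - p * p) := by positivity
  have n4 : 0 ≤ 2 * r * (p * q + c) := by positivity
  have n5 := sq_nonneg (r * S - T)
  have z1 : r ^ 2 * (1 - p * p) = 0 := by linarith
  have z2 : 1 - q * q = 0 := by linarith
  have z3 : 2 * r * (p * q + c) = 0 := by linarith
  have z1 := (mul_eq_zero.1 z1).resolve_left (by positivity)
  have z3 := (mul_eq_zero.1 z3).resolve_left (by positivity)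
  have hp : p = 1 := by nlinarith
  have hq : q = 1 := by nlinarith
  rw [hp, hq] at z3
  linarith

end IsConfig

/-! ### Total angles -/

/-- The angle in `(0, 2π]` from the direction of `x` to that of `y`. -/
noncomputable def turn (x y : ℂ) : ℝ := Real.pi + (-(y / x)).arg

theorem turn_of_im_pos {x y : ℂ} (h : 0 < (y / x).im) : turn x y = (y / x).arg := by
  rw [turn, Complex.arg_neg_eq_arg_sub_pi_of_im_pos h]
  ring

theorem abs_arg_le_turn (x y : ℂ) : |(y / x).arg| ≤ turn x y := by
  have h1 := Complex.neg_pi_lt_arg (y / x)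
  have h2 := Complex.arg_le_pi (y / x)
  have h3 := Complex.neg_pi_lt_arg (-(y / x))
  rcases lt_trichotomy (y / x).im 0 with h | h | h
  · rw [turn, Complex.arg_neg_eq_arg_add_pi_of_im_neg h, abs_le]
    constructor <;> linarith
  · rcases le_or_gt 0 (y / x).re with h' | h'
    · rw [Complex.arg_eq_zero_iff.2 ⟨h', h⟩, abs_zero, turn]
      linarith
    · have : (-(y / x)).arg = 0 := Complex.arg_eq_zero_iff.2 ⟨by simpa using h'.le, by simpa using h⟩
      rw [turn, this, Complex.arg_eq_pi_iff.2 ⟨h', h⟩, abs_of_pos Real.pi_pos]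
      simp
  · rw [turn_of_im_pos h, abs_of_nonneg (Complex.arg_nonneg_iff.2 h.le)]

/-- The total angle of a cyclic sequence of directions does not change under a deformation in
which consecutive directions never agree. -/
theorem sum_turn_eq_of_homotopy {N : Type*} [Fintype N] (σ : Equiv.Perm N) (X : N → ℝ → ℂ)
    (hX : ∀ a, Continuous (X a)) (hne : ∀ a τ, X a τ ≠ 0)
    (hs : ∀ a τ, -(X (σ a) τ / X a τ) ∈ Complex.slitPlane) (s t : ℝ) :
    ∑ a, turn (X a s) (X (σ a) s) = ∑ a, turn (X a t) (X (σ a) t) := by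
  have hcont : Continuous fun τ : ℝ =>
      Complex.I * ((∑ a, turn (X a τ) (X (σ a) τ) : ℝ) : ℂ) := by
    refine continuous_const.mul (Complex.continuous_ofReal.comp (continuous_finsetSum _
      fun a _ => continuous_const.add ?_))
    refine continuous_iff_continuousAt.2 fun τ => ?_
    exact (Complex.continuousAt_arg (hs a τ)).comp (f := fun τ => -(X (σ a) τ / X a τ))
      (((hX (σ a)).continuousAt.div (hX a).continuousAt (hne a τ)).neg)
  -- Each factor exp(i turn) is a quotient of consecutive unit directions, and the product over a
  -- permutation is 1. The total is therefore always a multiple of 2π, and it varies continuously.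
  have hexp : ∀ τ : ℝ, Complex.exp (Complex.I * ((∑ a, turn (X a τ) (X (σ a) τ) : ℝ) : ℂ)) = 1 := by
    intro τ
    have h1 : ∀ a, Complex.exp (Complex.I * (turn (X a τ) (X (σ a) τ) : ℂ)) =
        (X (σ a) τ / ‖X (σ a) τ‖) / (X a τ / ‖X a τ‖) := by
      intro a
      have n1 := hne a τ
      have n2 := hne (σ a) τ
      have := Complex.norm_mul_exp_arg_mul_I (-(X (σ a) τ / X a τ))
      rw [turn]
      push_cast
      rw [mul_add, Complex.exp_add, mul_comm Complex.I (Real.pi : ℂ), Complex.exp_pi_mul_I,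
        mul_comm Complex.I]
      rw [norm_neg, norm_div] at this
      have m1 : (‖X a τ‖ : ℂ) ≠ 0 := by simpa using n1
      have m2 : (‖X (σ a) τ‖ : ℂ) ≠ 0 := by simpa using n2
      push_cast at this
      field_simp at this ⊢
      linear_combination -this
    push_cast
    rw [Finset.mul_sum, Complex.exp_sum]
    simp only [h1]
    rw [Finset.prod_div_distrib, Equiv.prod_comp σ fun a => X a τ / (‖X a τ‖ : ℂ), div_self]
    refine Finset.prod_ne_zero_iff.2 fun a _ => div_ne_zero (hne a τ) ?_
    simpa using hne a τ
  have := eq_of_continuous_of_exp_eq hcont 1 hexp s t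
  exact_mod_cast mul_left_cancel₀ Complex.I_ne_zero this

end DiskPatterns

namespace DiskPatterns

open Set

/-! ### Hyperbolic data of disks -/

namespace ClosedDisk

/-- The image of a disk under the homothety of factor `r`. -/
noncomputable def scale (r : ℝ) (hr : 0 < r) (D : ClosedDisk) : ClosedDisk :=
  ⟨r • D.center, r * D.radius, mul_pos hr D.radius_pos⟩

/-- The hyperbolic curvature of the boundary circle of a disk in the unit disk. -/
noncomputable def curv (D : ClosedDisk) : ℝ :=
  (1 + D.radius ^ 2 - Complex.normSq D.center) / (2 * D.radius)

/-- The spatial part of `A`, as seen from `D`. -/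
noncomputable def relX (D A : ClosedDisk) : ℂ := (1 / A.radius) • (A.center - D.center)

/-- The time part of `A`, as seen from `D`. -/
noncomputable def relT (D A : ClosedDisk) : ℝ := D.radius / A.radius + invProd D A

/-- The boost moving the hyperbolic center of `D` to the origin. -/
noncomputable def boostVec (D : ClosedDisk) : ℂ := (1 / √(D.curv ^ 2 - 1)) • D.center

/-- The orientation of the triangle of hyperbolic centers of three disks. -/
def orient (A B C : ClosedDisk) : ℝ :=
  cross A.center B.center * (1 + Complex.normSq C.center - C.radius ^ 2) +
    cross B.center C.center * (1 + Complex.normSq A.center - A.radius ^ 2) +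
    cross C.center A.center * (1 + Complex.normSq B.center - B.radius ^ 2)

theorem invProd_scale (r : ℝ) (hr : 0 < r) (A B : ClosedDisk) :
    invProd (A.scale r hr) (B.scale r hr) = invProd A B := by
  have hA := A.radius_pos.ne'
  have hB := B.radius_pos.ne'
  have hr' := hr.ne'
  simp only [invProd, scale]
  rw [← smul_sub, Complex.real_smul, map_mul, Complex.normSq_ofReal]
  field_simp

theorem norm_add_radius_lt_one {D : ClosedDisk} (h : D.carrier ⊆ Metric.ball 0 1) :
    ‖D.center‖ + D.radius < 1 := by
  have hD := D.radius_pos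
  rcases eq_or_ne D.center 0 with h0 | h0
  · have : (D.radius : ℂ) ∈ D.carrier := by
      simp [carrier, h0, abs_of_pos hD]
    simpa [h0, abs_of_pos hD] using h this
  · have hn : 0 < ‖D.center‖ := norm_pos_iff.2 h0
    have hm : (1 + D.radius / ‖D.center‖) • D.center ∈ D.carrier := by
      rw [carrier, Metric.mem_closedBall, dist_eq_norm, add_smul, one_smul, add_sub_cancel_left,
        norm_smul, Real.norm_of_nonneg (by positivity), div_mul_cancel₀ _ hn.ne']
    have := h hm
    rw [mem_ball_zero_iff, norm_smul, Real.norm_of_nonneg (by positivity), add_mul,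
      div_mul_cancel₀ _ hn.ne', one_mul] at this
    exact this

theorem one_lt_curv {D : ClosedDisk} (h : ‖D.center‖ + D.radius < 1) : 1 < D.curv := by
  have hD := D.radius_pos
  rw [curv, lt_div_iff₀ (by positivity), Complex.normSq_eq_norm_sq]
  nlinarith [norm_nonneg D.center]

theorem one_le_curv {D : ClosedDisk} (h : ‖D.center‖ + D.radius ≤ 1) : 1 ≤ D.curv := by
  have hD := D.radius_pos
  rw [curv, le_div_iff₀ (by positivity), Complex.normSq_eq_norm_sq]
  nlinarith [norm_nonneg D.center]

/-- Disks are unit vectors of ℝ^{3,1} with product -`invProd`. Once `D` is normalized to the unit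
disk, `relX` and `relT` are the components of A + pD, the projection of `A` to the orthogonal
complement of `D`; hence the products 1 - p², 1 - q² and -(pq + c). -/
theorem isConfig {D A B : ClosedDisk} (hA : invProd D A ∈ Icc (0 : ℝ) 1)
    (hB : invProd D B ∈ Icc (0 : ℝ) 1) (hAB : 0 ≤ invProd A B) :
    IsConfig (invProd D A) (invProd D B) (invProd A B) (relX D A) (relT D A) (relX D B)
      (relT D B) := by
  have ha := A.radius_pos
  have hb := B.radius_pos
  have hd := D.radius_pos
  have key : ∀ A B : ClosedDisk, dot (relX D A) (relX D B) = relT D A * relT D B -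
      invProd D A * invProd D B - (Complex.normSq (A.center - B.center) - A.radius ^ 2 -
        B.radius ^ 2) / (2 * A.radius * B.radius) := by
    intro A B
    have ha := A.radius_pos.ne'
    have hb := B.radius_pos.ne'
    have hd := hd.ne'
    simp only [dot, relX, relT, invProd, Complex.real_smul, Complex.mul_re, Complex.mul_im,
      Complex.ofReal_re, Complex.ofReal_im, Complex.normSq_apply, Complex.sub_re, Complex.sub_im,
      zero_mul, sub_zero, add_zero]
    field_simp
    ring
  have self : ∀ A : ClosedDisk, dot (relX D A) (relX D A) =
      relT D A * relT D A + (1 - invProd D A * invProd D A) := by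
    intro A
    have ha := A.radius_pos.ne'
    rw [key, sub_self, map_zero]
    field_simp
    ring
  have pos : ∀ A : ClosedDisk, 0 ≤ invProd D A → relT D A ≠ 0 ∨ relX D A ≠ 0 := fun A h =>
    Or.inl (by
      have := A.radius_pos
      unfold relT
      positivity)
  refine ⟨hA, hB, hAB, pos A hA.1, pos B hB.1, self A, self B, ?_⟩
  rw [key]
  simp only [invProd]
  ring

theorem sqrt_boostVec {D : ClosedDisk} (h : ‖D.center‖ + D.radius < 1) :
    √(1 + Complex.normSq (boostVec D)) =
      (1 - D.radius ^ 2 - Complex.normSq D.center) / (2 * D.radius * √(D.curv ^ 2 - 1)) := by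
  have hd := D.radius_pos
  have h1 := one_lt_curv h
  have hK : 0 < D.curv ^ 2 - 1 := by nlinarith
  have hs := Real.sqrt_pos.2 hK
  have hsq := Real.sq_sqrt hK.le
  have hn : 0 ≤ 1 - D.radius ^ 2 - Complex.normSq D.center := by
    rw [Complex.normSq_eq_norm_sq]
    nlinarith [norm_nonneg D.center]
  rw [Real.sqrt_eq_iff_mul_self_eq (by have := Complex.normSq_nonneg (boostVec D); linarith)
    (by positivity)]
  rw [boostVec, Complex.real_smul, map_mul, Complex.normSq_ofReal]
  generalize √(D.curv ^ 2 - 1) = w at *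
  have hc : D.curv * (2 * D.radius) = 1 + D.radius ^ 2 - Complex.normSq D.center := by
    rw [curv]
    field_simp
  field_simp
  rw [hsq]
  linear_combination (D.curv * (2 * D.radius) + 1 + D.radius ^ 2 - Complex.normSq D.center) * hc

/-- In the frame of the hyperbolic center, the time coordinate of a neighbor depends only on the two
curvatures and the inversive product. This reduces the comparison of angles to one of curvatures. -/
theorem boostT_rel {D : ClosedDisk} (h : ‖D.center‖ + D.radius < 1) (A : ClosedDisk) :
    boostT (boostVec D) (relX D A) (relT D A) =
      (A.curv + D.curv * invProd D A) / √(D.curv ^ 2 - 1) := by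
  have hd := D.radius_pos
  have ha := A.radius_pos
  have h1 := one_lt_curv h
  have hK : 0 < D.curv ^ 2 - 1 := by nlinarith
  have hs := Real.sqrt_pos.2 hK
  rw [boostT, sqrt_boostVec h, boostVec]
  generalize √(D.curv ^ 2 - 1) = w at *
  simp only [dot, relX, relT, invProd, curv, Complex.real_smul, Complex.mul_re, Complex.mul_im,
    Complex.ofReal_re, Complex.ofReal_im, Complex.normSq_apply, Complex.sub_re, Complex.sub_im,
    zero_mul, sub_zero, add_zero]
  field_simp
  ring

/-- The denominator is positive, so the sense of rotation at the hyperbolic center of `D` is the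
sign of `orient`. -/
theorem cross_boost_rel {D : ClosedDisk} (h : ‖D.center‖ + D.radius < 1) (A B : ClosedDisk) :
    cross (boostX (boostVec D) (relX D A) (relT D A)) (boostX (boostVec D) (relX D B) (relT D B)) =
      orient D A B / (2 * D.radius * √(D.curv ^ 2 - 1) * A.radius * B.radius) := by
  have hd := D.radius_pos
  have ha := A.radius_pos
  have hb := B.radius_pos
  have h1 := one_lt_curv h
  have hK : 0 < D.curv ^ 2 - 1 := by nlinarith
  have hs := Real.sqrt_pos.2 hK
  rw [cross_boostX, sqrt_boostVec h, boostVec]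
  generalize √(D.curv ^ 2 - 1) = w at *
  simp only [cross, orient, relX, relT, invProd, Complex.real_smul, Complex.mul_re, Complex.mul_im,
    Complex.ofReal_re, Complex.ofReal_im, Complex.normSq_apply, Complex.sub_re, Complex.sub_im,
    zero_mul, sub_zero, add_zero]
  field_simp
  ring

/-- The squared determinant is the Gram determinant. In this form it is visibly at least 2 when the
curvatures are at least 1 and the inversive products lie in [0, 1]. -/
theorem gram_identity {x₁ y₁ t₁ x₂ y₂ t₂ x₃ y₃ t₃ k₁ k₂ k₃ p q r : ℝ}
    (h1 : t₁ ^ 2 - x₁ ^ 2 - y₁ ^ 2 = k₁ ^ 2 - 1) (h2 : t₂ ^ 2 - x₂ ^ 2 - y₂ ^ 2 = k₂ ^ 2 - 1)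
    (h3 : t₃ ^ 2 - x₃ ^ 2 - y₃ ^ 2 = k₃ ^ 2 - 1) (h12 : t₁ * t₂ - x₁ * x₂ - y₁ * y₂ = p + k₁ * k₂)
    (h13 : t₁ * t₃ - x₁ * x₃ - y₁ * y₃ = q + k₁ * k₃)
    (h23 : t₂ * t₃ - x₂ * x₃ - y₂ * y₃ = r + k₂ * k₃) :
    ((x₁ * y₂ - y₁ * x₂) * t₃ + (x₂ * y₃ - y₂ * x₃) * t₁ + (x₃ * y₁ - y₃ * x₁) * t₂) ^ 2 =
      (p ^ 2 + q ^ 2 + r ^ 2 + 2 * p * q * r - 1) + (1 - r ^ 2) * k₁ ^ 2 + (1 - q ^ 2) * k₂ ^ 2 +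
        (1 - p ^ 2) * k₃ ^ 2 + 2 * (p + q * r) * (k₁ * k₂) + 2 * (q + p * r) * (k₁ * k₃) +
        2 * (r + p * q) * (k₂ * k₃) := by
  have e : ∀ a b c d f g : ℝ, a = t₁ ^ 2 - x₁ ^ 2 - y₁ ^ 2 → b = t₂ ^ 2 - x₂ ^ 2 - y₂ ^ 2 →
      c = t₃ ^ 2 - x₃ ^ 2 - y₃ ^ 2 → d = t₁ * t₂ - x₁ * x₂ - y₁ * y₂ →
      f = t₁ * t₃ - x₁ * x₃ - y₁ * y₃ → g = t₂ * t₃ - x₂ * x₃ - y₂ * y₃ →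
      ((x₁ * y₂ - y₁ * x₂) * t₃ + (x₂ * y₃ - y₂ * x₃) * t₁ + (x₃ * y₁ - y₃ * x₁) * t₂) ^ 2 =
        a * b * c + 2 * d * f * g - a * g ^ 2 - b * f ^ 2 - c * d ^ 2 := by
    rintro a b c d f g rfl rfl rfl rfl rfl rfl
    ring
  rw [e _ _ _ _ _ _ h1.symm h2.symm h3.symm h12.symm h13.symm h23.symm]
  ring

theorem orient_ne_zero {A B C : ClosedDisk} (hA : 1 ≤ A.curv) (hB : 1 ≤ B.curv) (hC : 1 ≤ C.curv)
    (hAB : invProd A B ∈ Icc (0 : ℝ) 1) (hAC : invProd A C ∈ Icc (0 : ℝ) 1)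
    (hBC : invProd B C ∈ Icc (0 : ℝ) 1) : orient A B C ≠ 0 := by
  have ha := A.radius_pos
  have hb := B.radius_pos
  have hc := C.radius_pos
  let t : ClosedDisk → ℝ := fun D => (1 + Complex.normSq D.center - D.radius ^ 2) / (2 * D.radius)
  let x : ClosedDisk → ℝ := fun D => D.center.re / D.radius
  let y : ClosedDisk → ℝ := fun D => D.center.im / D.radius
  have self : ∀ D : ClosedDisk, t D ^ 2 - x D ^ 2 - y D ^ 2 = D.curv ^ 2 - 1 := by
    intro D
    have := D.radius_pos.ne'
    simp only [t, x, y, curv, Complex.normSq_apply]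
    field_simp
    ring
  have pair : ∀ D E : ClosedDisk, t D * t E - x D * x E - y D * y E =
      invProd D E + D.curv * E.curv := by
    intro D E
    have := D.radius_pos.ne'
    have := E.radius_pos.ne'
    simp only [t, x, y, curv, invProd, Complex.normSq_apply, Complex.sub_re, Complex.sub_im]
    field_simp
    ring
  have key := gram_identity (self A) (self B) (self C) (pair A B) (pair A C) (pair B C)
  have e : orient A B C = 2 * A.radius * B.radius * C.radius *
      ((x A * y B - y A * x B) * t C + (x B * y C - y B * x C) * t A +
        (x C * y A - y C * x A) * t B) := by
    simp only [t, x, y, orient, cross]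
    field_simp
  intro h0
  rw [e] at h0
  have h0 := (mul_eq_zero.1 h0).resolve_left (by positivity)
  rw [h0] at key
  obtain ⟨p0, p1⟩ := hAB
  obtain ⟨q0, q1⟩ := hAC
  obtain ⟨r0, r1⟩ := hBC
  generalize invProd A B = p at *
  generalize invProd A C = q at *
  generalize invProd B C = r at *
  have s1 : ∀ u k : ℝ, 0 ≤ u → u ≤ 1 → 1 ≤ k → 1 - u ^ 2 ≤ (1 - u ^ 2) * k ^ 2 := by
    intro u k h0 h1 h
    have : 0 ≤ 1 - u ^ 2 := by nlinarith
    have : 1 ≤ k ^ 2 := by nlinarith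
    nlinarith
  have := s1 r _ r0 r1 hA
  have := s1 q _ q0 q1 hB
  have := s1 p _ p0 p1 hC
  have : 0 ≤ 2 * (p + q * r) * (A.curv * B.curv) := by positivity
  have : 0 ≤ 2 * (q + p * r) * (A.curv * C.curv) := by positivity
  have : 0 ≤ 2 * (r + p * q) * (B.curv * C.curv) := by positivity
  have : 0 ≤ 2 * p * q * r := by positivity
  linarith

/-- For disks in the unit disk, the triangle of Euclidean centers and that of hyperbolic centers
have the same orientation. -/
theorem orient_pos {A B C : ClosedDisk} (hA : ‖A.center‖ + A.radius < 1)
    (hB : ‖B.center‖ + B.radius < 1) (hC : ‖C.center‖ + C.radius < 1)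
    (hAB : invProd A B ∈ Icc (0 : ℝ) 1) (hAC : invProd A C ∈ Icc (0 : ℝ) 1)
    (hBC : invProd B C ∈ Icc (0 : ℝ) 1)
    (h : 0 < cross (B.center - A.center) (C.center - A.center)) : 0 < orient A B C := by
  set d := cross (B.center - A.center) (C.center - A.center) with hd
  set e := orient A B C - d with he
  -- Shrinking the disks toward the origin makes the Euclidean orientation `d` the leading term. As
  -- `orient` does not vanish for 0 < r ≤ 1, d + r²e keeps the sign of `d` up to r = 1; otherwise r²
  -- = -d/e would be a zero.
  have scale_eq : ∀ r : ℝ, ∀ hr : 0 < r,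
      orient (A.scale r hr) (B.scale r hr) (C.scale r hr) = r ^ 2 * (d + r ^ 2 * e) := by
    intro r hr
    rw [he, hd]
    simp only [orient, scale, cross, Complex.real_smul, Complex.mul_re, Complex.mul_im,
      Complex.ofReal_re, Complex.ofReal_im, Complex.normSq_apply, Complex.sub_re, Complex.sub_im,
      zero_mul, sub_zero, add_zero]
    ring
  have curv_scale : ∀ r : ℝ, ∀ hr : 0 < r, r ≤ 1 → ∀ D : ClosedDisk, ‖D.center‖ + D.radius < 1 →
      1 ≤ (D.scale r hr).curv := by
    intro r hr hr1 D hD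
    refine one_le_curv ?_
    rw [scale, norm_smul, Real.norm_of_nonneg hr.le, ← mul_add]
    nlinarith [norm_nonneg D.center, D.radius_pos]
  have hne : ∀ r : ℝ, 0 < r → r ≤ 1 → d + r ^ 2 * e ≠ 0 := by
    intro r hr hr1 h0
    refine orient_ne_zero (curv_scale r hr hr1 A hA) (curv_scale r hr hr1 B hB)
      (curv_scale r hr hr1 C hC) ?_ ?_ ?_ ((scale_eq r hr).trans (by rw [h0, mul_zero]))
    all_goals rwa [invProd_scale]
  have hO : orient A B C = d + e := by rw [he]; ring
  rw [hO]
  by_contra! hcon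
  have hen : e < 0 := by linarith
  refine hne (√(-d / e)) (Real.sqrt_pos.2 (div_pos_of_neg_of_neg (by linarith) hen))
    (Real.sqrt_le_one.2 ?_) ?_
  · rw [div_le_one_of_neg hen]
    linarith
  · rw [Real.sq_sqrt (div_pos_of_neg_of_neg (by linarith) hen).le, div_mul_cancel₀ _ hen.ne]
    ring

end ClosedDisk

end DiskPatterns

namespace DiskPatterns

open Set

/-! ### Comparison of angles -/

theorem abs_arg_div_comm (x y : ℂ) : |(y / x).arg| = |(x / y).arg| := by
  rw [← Complex.abs_arg_inv, inv_div]

namespace IsConfig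

variable {p q c : ℝ} {X Y : ℂ} {S T : ℝ}

theorem cos_arg (h : IsConfig p q c X S Y T) : Real.cos |(Y / X).arg| =
    (S * T - (p * q + c)) / (√(S * S + (1 - p * p)) * √(T * T + (1 - q * q))) := by
  have hX := h.left_ne_zero
  have hY := h.right_ne_zero
  rw [Real.cos_abs, Complex.cos_arg (div_ne_zero hY hX), ← h.dot_left, ← h.dot_right, ← h.dot_eq,
    dot_self, dot_self, norm_div, Complex.div_re, Complex.normSq_eq_norm_sq,
    Complex.normSq_eq_norm_sq, Real.sqrt_sq (norm_nonneg _), Real.sqrt_sq (norm_nonneg _), dot]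
  have h1 := norm_ne_zero_iff.2 hX
  have h2 := norm_ne_zero_iff.2 hY
  field_simp

theorem left_pos (h : IsConfig p q c X S Y T) : 0 < S * S + (1 - p * p) := by
  rw [← h.dot_left, dot_self]
  exact Complex.normSq_pos.2 h.left_ne_zero

end IsConfig

theorem div_sqrt_le {y z P : ℝ} (hP : 0 ≤ P) (hyz : |y| < z) (hy : 0 < y * y + P) :
    |y| / √(y * y + P) ≤ z / √(z * z + P) ∧ (0 < P → |y| / √(y * y + P) < z / √(z * z + P)) := by
  have hz : 0 < z := (abs_nonneg y).trans_lt hyz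
  have h1 := Real.sqrt_pos.2 hy
  have h2 : 0 < √(z * z + P) := Real.sqrt_pos.2 (by positivity)
  have hlt : y * y < z * z := by
    rw [← abs_mul_abs_self y]
    exact mul_self_lt_mul_self (abs_nonneg y) hyz
  rw [div_le_div_iff₀ h1 h2, div_lt_div_iff₀ h1 h2]
  constructor
  · refine abs_le_of_sq_le_sq' ?_ (by positivity) |>.2
    rw [mul_pow, mul_pow, Real.sq_sqrt (by positivity), Real.sq_sqrt hy.le, sq_abs]
    nlinarith
  · intro hP
    refine abs_lt_of_sq_lt_sq' ?_ (by positivity) |>.2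
    rw [mul_pow, mul_pow, Real.sq_sqrt (by positivity), Real.sq_sqrt hy.le, sq_abs]
    nlinarith

/-- The angle at the center is a strictly decreasing function of the distances. -/
theorem IsConfig.arg_lt {p q c : ℝ} {X Y X' Y' : ℂ} {S T S' T' : ℝ} (h : IsConfig p q c X S Y T)
    (h' : IsConfig p q c X' S' Y' T') (hS : |S| < S') (hT : |T| < T') :
    |(Y' / X').arg| < |(Y / X).arg| := by
  have range : ∀ z : ℂ, |z.arg| ∈ Icc 0 Real.pi := fun z => ⟨abs_nonneg _, Complex.abs_arg_le_pi z⟩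
  rw [← Real.strictAntiOn_cos.lt_iff_gt (range _) (range _), h.cos_arg, h'.cos_arg]
  obtain ⟨p0, p1⟩ := h.left_mem
  obtain ⟨q0, q1⟩ := h.right_mem
  have hc := h.nonneg
  have hP : 0 ≤ 1 - p * p := by nlinarith
  have hQ : 0 ≤ 1 - q * q := by nlinarith
  have d1 := h.left_pos
  have d2 := h.symm.left_pos
  have e1 := h'.left_pos
  have e2 := h'.symm.left_pos
  obtain ⟨a1, a2⟩ := div_sqrt_le hP hS d1
  obtain ⟨b1, b2⟩ := div_sqrt_le hQ hT d2
  have hS' : 0 < S' := (abs_nonneg S).trans_lt hS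
  have hT' : 0 < T' := (abs_nonneg T).trans_lt hT
  have lt1 : √(S * S + (1 - p * p)) < √(S' * S' + (1 - p * p)) := by
    refine Real.sqrt_lt_sqrt d1.le (add_lt_add_left ?_ _)
    rw [← abs_mul_abs_self S]
    exact mul_self_lt_mul_self (abs_nonneg S) hS
  have lt2 : √(T * T + (1 - q * q)) < √(T' * T' + (1 - q * q)) := by
    refine Real.sqrt_lt_sqrt d2.le (add_lt_add_left ?_ _)
    rw [← abs_mul_abs_self T]
    exact mul_self_lt_mul_self (abs_nonneg T) hT
  have D1 := Real.sqrt_pos.2 d1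
  have D2 := Real.sqrt_pos.2 d2
  have E1 := Real.sqrt_pos.2 e1
  have E2 := Real.sqrt_pos.2 e2
  generalize √(S * S + (1 - p * p)) = u at *
  generalize √(T * T + (1 - q * q)) = w at *
  generalize √(S' * S' + (1 - p * p)) = u' at *
  generalize √(T' * T' + (1 - q * q)) = w' at *
  -- The cosine is a product of two fractions that grow with S and T, minus a nonnegative constant
  -- over a growing denominator.
  have split : ∀ s t a b e : ℝ, (s * t - e) / (a * b) = s / a * (t / b) - e * (1 / (a * b)) := by
    intro s t a b e
    rw [sub_div, div_mul_div_comm, mul_one_div]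
  rw [split, split]
  have m0 : S / u * (T / w) ≤ |S| / u * (|T| / w) := by
    rw [div_mul_div_comm, div_mul_div_comm, ← abs_mul]
    exact div_le_div_of_nonneg_right (le_abs_self _) (by positivity)
  have n1 : 0 ≤ |S| / u := by positivity
  have n2 : 0 ≤ |T| / w := by positivity
  have n3 : 0 < S' / u' := by positivity
  have n4 : 0 < T' / w' := by positivity
  have m1 : |S| / u * (|T| / w) ≤ S' / u' * (T' / w') := mul_le_mul a1 b1 n2 n3.le
  have inv : 1 / (u' * w') < 1 / (u * w) :=
    one_div_lt_one_div_of_lt (by positivity) (mul_lt_mul lt1 lt2.le D2 E1.le)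
  -- The last term is strictly monotone unless pq + c = 0. In that case p or q is 0, and the
  -- corresponding fraction grows strictly.
  rcases (add_nonneg (mul_nonneg p0 q0) hc).lt_or_eq with he | he
  · have := mul_lt_mul_of_pos_left inv he
    linarith
  · rw [← he, zero_mul, zero_mul, sub_zero, sub_zero]
    have hpq : p * q = 0 := by nlinarith [mul_nonneg p0 q0]
    refine m0.trans_lt ?_
    rcases mul_eq_zero.1 hpq with hp | hq
    · exact (mul_le_mul_of_nonneg_left b1 n1).trans_lt
        (mul_lt_mul_of_pos_right (a2 (by rw [hp]; norm_num)) n4)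
    · exact (mul_le_mul_of_nonneg_right a1 n2).trans_lt
        (mul_lt_mul_of_pos_left (b2 (by rw [hq]; norm_num)) n3)

/-! ### Angles around a vertex -/

section Flower

variable {V : Type*} [DecidableEq V] {G : SimpleGraph V} {F : Set (Finset V)} {z : V → ℂ} {v : V}
  {σ : Equiv.Perm (Nbr G v)}

theorem IsFlower.adj (hF : IsTriangulation G F) (hσ : IsFlower F z v σ) (a : Nbr G v) :
    G.Adj a.1 (σ a).1 := by
  refine hF.adj _ (hσ.face a) a.1 (by simp) (σ a).1 (by simp) fun e => ?_
  have := hσ.pos a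
  rw [← e] at this
  simp only [cross] at this
  linarith

theorem IsFlower.apply_apply_ne (hσ : IsFlower F z v σ) (a : Nbr G v) : σ (σ a) ≠ a := by
  intro e
  have h1 := hσ.pos a
  have h2 := hσ.pos (σ a)
  rw [e, cross_swap] at h2
  linarith

/-- The sum of a symmetric function over consecutive neighbors depends only on the faces. -/
theorem IsFlower.sum_symm_eq [Fintype (Nbr G v)] {z' : V → ℂ} {σ' : Equiv.Perm (Nbr G v)}
    (hF : IsTriangulation G F) (hσ : IsFlower F z v σ) (hσ' : IsFlower F z' v σ')
    {f : Nbr G v → Nbr G v → ℝ} (hf : ∀ a b, f a b = f b a) :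
    ∑ a, f a (σ a) = ∑ a, f a (σ' a) := by
  have twice : ∀ τ : Equiv.Perm (Nbr G v), 2 * ∑ a, f a (τ a) =
      ∑ a, (f a (τ a) + f a (τ.symm a)) := by
    intro τ
    rw [Finset.sum_add_distrib, two_mul]
    congr 1
    rw [← Equiv.sum_comp τ fun a => f a (τ.symm a)]
    exact Finset.sum_congr rfl fun a _ => by rw [Equiv.symm_apply_apply, hf]
  -- The predecessor and the successor of `a` are the third vertices of the faces containing `v` and
  -- `a`. The two orderings therefore agree up to reversal at each `a`.
  have key : ∀ a, f a (σ a) + f a (σ.symm a) = f a (σ' a) + f a (σ'.symm a) := by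
    intro a
    have swap : ∀ a b : V, ({v, a, b} : Finset V) = {v, b, a} := fun a b => by
      rw [Finset.pair_comm]
    have face : ∀ b, a ≠ b → {v, a.1, b.1} ∈ F → b = σ a ∨ b = σ.symm a := fun b hb h =>
      (hσ.eq_or_eq a b hb h).imp_right fun h => by rw [h, Equiv.symm_apply_apply]
    have n1 : a ≠ σ' a := fun e => (hσ'.adj hF a).ne (congrArg Subtype.val e)
    have n2 : a ≠ σ'.symm a := fun e => n1 (by
      conv_lhs => rw [← σ'.apply_symm_apply a, ← e])
    have n3 : σ' a ≠ σ'.symm a := fun e => hσ'.apply_apply_ne a (by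
      rw [e, Equiv.apply_symm_apply])
    have f1 := face _ n1 (hσ'.face a)
    have f2 := face _ n2 (by
      have := hσ'.face (σ'.symm a)
      rwa [Equiv.apply_symm_apply, swap] at this)
    rcases f1 with f1 | f1 <;> rcases f2 with f2 | f2
    · exact absurd (f1.trans f2.symm) n3
    · rw [f1, f2]
    · rw [f1, f2, add_comm]
    · exact absurd (f1.trans f2.symm) n3
  have := (twice σ).trans ((Finset.sum_congr rfl fun a _ => key a).trans (twice σ').symm)
  linarith

end Flower

theorem IsPacking.invProd_mem {V : Type*} {G : SimpleGraph V} {F : Set (Finset V)}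
    {P : V → ClosedDisk} (hP : IsPacking G F P) {u v : V} (h : G.Adj u v) :
    invProd (P u) (P v) ∈ Icc (0 : ℝ) 1 :=
  ⟨hP.invProd_nonneg u v h.ne, hP.invProd_le_one u v h⟩

section Packing

variable {V : Type*} [DecidableEq V] {G : SimpleGraph V} {F : Set (Finset V)} {P : V → ClosedDisk}
  {v : V} {σ : Equiv.Perm (Nbr G v)}

theorem IsPacking.isConfig (hF : IsTriangulation G F) (hP : IsPacking G F P)
    (hσ : IsFlower F (fun v => (P v).center) v σ) (a : Nbr G v) :
    IsConfig (invProd (P v) (P a)) (invProd (P v) (P (σ a))) (invProd (P a) (P (σ a)))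
      ((P v).relX (P a)) ((P v).relT (P a)) ((P v).relX (P (σ a))) ((P v).relT (P (σ a))) :=
  ClosedDisk.isConfig (hP.invProd_mem a.2) (hP.invProd_mem (σ a).2)
    (hP.invProd_mem (hσ.adj hF a)).1

/-- The directions of the neighbors turn once around a vertex in every frame. -/
theorem IsPacking.sum_turn [Fintype (Nbr G v)] (hF : IsTriangulation G F) (hP : IsPacking G F P)
    (hσ : IsFlower F (fun v => (P v).center) v σ) (n : ℂ) :
    ∑ a : Nbr G v, turn (boostX n ((P v).relX (P a)) ((P v).relT (P a)))
      (boostX n ((P v).relX (P (σ a))) ((P v).relT (P (σ a)))) = 2 * Real.pi := by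
  -- Turning off the boost leads to the directions of the Euclidean centers, whose angles add up to
  -- 2π in the drawing.
  have h := sum_turn_eq_of_homotopy σ
    (fun (a : Nbr G v) (τ : ℝ) => boostX (τ • n) ((P v).relX (P a)) ((P v).relT (P a)))
    (fun a => continuous_boostX_smul n _ _)
    (fun a τ => ((hP.isConfig hF hσ a).boost (τ • n)).left_ne_zero)
    (fun a τ => ((hP.isConfig hF hσ a).boost (τ • n)).neg_div_mem_slitPlane) 1 0
  simp only [one_smul, zero_smul, boostX_zero] at h
  rw [h]
  have hne : (Finset.univ : Finset (Nbr G v)).Nonempty := by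
    have := hF.infinite
    obtain ⟨x, hx⟩ := exists_ne v
    obtain ⟨p⟩ := hF.connected v x
    cases p with
    | nil => exact absurd rfl hx
    | cons h _ => exact ⟨⟨_, h⟩, Finset.mem_univ _⟩
  rw [← hσ.sum_arg hP.drawing hne (by ext; simp)]
  refine Finset.sum_congr rfl fun a _ => ?_
  have ha := (P a).radius_pos
  have hb := (P (σ a)).radius_pos
  have e : (P v).relX (P (σ a)) / (P v).relX (P a) = ((P a).radius / (P (σ a)).radius : ℝ) *
      (((P (σ a)).center - (P v).center) / ((P a).center - (P v).center)) := by
    have : ((P a).radius : ℂ) ≠ 0 := by exact_mod_cast ha.ne'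
    have : ((P (σ a)).radius : ℂ) ≠ 0 := by exact_mod_cast hb.ne'
    have : (P a).center - (P v).center ≠ 0 := sub_ne_zero.2 (hP.drawing.injective.ne a.2.ne')
    simp only [ClosedDisk.relX, Complex.real_smul]
    push_cast
    field_simp
  have hpos : 0 < (P a).radius / (P (σ a)).radius := by positivity
  rw [turn_of_im_pos, e, Complex.arg_real_mul _ hpos]
  rw [e, Complex.im_ofReal_mul]
  exact mul_pos hpos (hσ.im_div_pos a)

/-- The angle at the hyperbolic center of `D` between the hyperbolic centers of `A` and `B`. -/
noncomputable def ClosedDisk.hypAngle (D A B : ClosedDisk) : ℝ :=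
  |(boostX D.boostVec (D.relX B) (D.relT B) / boostX D.boostVec (D.relX A) (D.relT A)).arg|

theorem ClosedDisk.hypAngle_comm (D A B : ClosedDisk) : D.hypAngle A B = D.hypAngle B A :=
  abs_arg_div_comm _ _

/-- The neighbors may stick out of the unit disk and lose their cyclic orientation, but the
unoriented angle never exceeds the turn. -/
theorem IsPacking.sum_hypAngle_le [Fintype (Nbr G v)] (hF : IsTriangulation G F)
    (hP : IsPacking G F P) (hσ : IsFlower F (fun v => (P v).center) v σ) :
    ∑ a : Nbr G v, (P v).hypAngle (P a) (P (σ a)) ≤ 2 * Real.pi := by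
  rw [← hP.sum_turn hF hσ (P v).boostVec]
  exact Finset.sum_le_sum fun a _ => abs_arg_le_turn _ _

theorem IsPacking.orient_pos (hF : IsTriangulation G F) (hP : IsPacking G F P)
    (hin : ∀ v, ‖(P v).center‖ + (P v).radius < 1)
    (hσ : IsFlower F (fun v => (P v).center) v σ) (a : Nbr G v) :
    0 < (P v).orient (P a) (P (σ a)) :=
  ClosedDisk.orient_pos (hin _) (hin _) (hin _) (hP.invProd_mem a.2) (hP.invProd_mem (σ a).2)
    (hP.invProd_mem (hσ.adj hF a)) (hσ.pos a)

/-- Inside the unit disk the hyperbolic triangles keep the orientation of the Euclidean ones, so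
each unoriented angle equals the turn. -/
theorem IsPacking.sum_hypAngle_eq [Fintype (Nbr G v)] (hF : IsTriangulation G F)
    (hP : IsPacking G F P) (hin : ∀ v, ‖(P v).center‖ + (P v).radius < 1)
    (hσ : IsFlower F (fun v => (P v).center) v σ) :
    ∑ a : Nbr G v, (P v).hypAngle (P a) (P (σ a)) = 2 * Real.pi := by
  rw [← hP.sum_turn hF hσ (P v).boostVec]
  refine Finset.sum_congr rfl fun a _ => ?_
  have hc := ClosedDisk.cross_boost_rel (hin v) (P a) (P (σ a))
  have ho := hP.orient_pos hF hin hσ a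
  have h0 := ((hP.isConfig hF hσ a).boost (P v).boostVec).left_ne_zero
  have hv := (P v).radius_pos
  have ha := (P a).radius_pos
  have hb := (P (σ a)).radius_pos
  have hk := ClosedDisk.one_lt_curv (hin v)
  have hs : 0 < √((P v).curv ^ 2 - 1) := Real.sqrt_pos.2 (by nlinarith)
  have hpos : 0 < ClosedDisk.orient (P v) (P a) (P (σ a)) /
      (2 * (P v).radius * √((P v).curv ^ 2 - 1) * (P a).radius * (P (σ a)).radius) := by positivity
  rw [← hc] at hpos
  have him : 0 < (boostX (P v).boostVec ((P v).relX (P (σ a))) ((P v).relT (P (σ a))) /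
      boostX (P v).boostVec ((P v).relX (P a)) ((P v).relT (P a))).im := by
    rw [Complex.div_im, ← sub_div]
    refine div_pos ?_ (Complex.normSq_pos.2 h0)
    unfold cross at hpos
    linarith
  rw [turn_of_im_pos him, ClosedDisk.hypAngle, abs_of_nonneg (Complex.arg_nonneg_iff.2 him.le)]

/-- The hyperbolic distances from a vertex to its neighbors cannot all be smaller than in a
pattern contained in the unit disk. -/
theorem IsPacking.not_forall_boostT_lt {P' : V → ClosedDisk} (hF : IsTriangulation G F)
    (hP : IsPacking G F P) (hP' : IsPacking G F P')
    (hinv : ∀ u v, G.Adj u v → invProd (P u) (P v) = invProd (P' u) (P' v))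
    (hin : ∀ v, ‖(P' v).center‖ + (P' v).radius < 1) (v : V) :
    ¬ ∀ a : Nbr G v, |boostT (P v).boostVec ((P v).relX (P a)) ((P v).relT (P a))| <
      boostT (P' v).boostVec ((P' v).relX (P' a)) ((P' v).relT (P' a)) := by
  intro hlt
  have : Fintype (Nbr G v) := (hF.finite_nbrs v).fintype
  obtain ⟨σ, hσ⟩ := hP.drawing.exists_isFlower hF v
  obtain ⟨σ', hσ'⟩ := hP'.drawing.exists_isFlower hF v
  have h1 := hP.sum_hypAngle_le hF hσ
  have h2 := hP'.sum_hypAngle_eq hF hin hσ'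
  rw [← hσ.sum_symm_eq hF hσ' (f := fun a b => (P' v).hypAngle (P' a) (P' b))
    fun a b => ClosedDisk.hypAngle_comm _ _ _] at h2
  have hne : (Finset.univ : Finset (Nbr G v)).Nonempty := by
    by_contra hne
    rw [Finset.not_nonempty_iff_eq_empty.1 hne, Finset.sum_empty] at h2
    linarith [Real.pi_pos]
  have h3 : ∑ a : Nbr G v, (P' v).hypAngle (P' a) (P' (σ a)) <
      ∑ a : Nbr G v, (P v).hypAngle (P a) (P (σ a)) := by
    refine Finset.sum_lt_sum_of_nonempty hne fun a _ => ?_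
    have c1 := (hP.isConfig hF hσ a).boost (P v).boostVec
    have c2 := (ClosedDisk.isConfig (hP'.invProd_mem a.2) (hP'.invProd_mem (σ a).2)
      (hP'.invProd_mem (hσ.adj hF a)).1).boost (P' v).boostVec
    rw [← hinv _ _ a.2, ← hinv _ _ (σ a).2, ← hinv _ _ (hσ.adj hF a)] at c2
    exact c1.arg_lt c2 (hlt a) (hlt (σ a))
  linarith

end Packing

/-! ### Comparison of curvatures -/

/-- |k| ≤ 1 means that the boundary circle of `A` meets the unit circle. Indeed `A` meets `D`, is
not inside the unit disk, and leaves out the center of `D`. -/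
theorem ClosedDisk.abs_curv_le_one {D A : ClosedDisk} (hD : ‖D.center‖ + D.radius < 1)
    (hA : 1 ≤ ‖A.center‖ + A.radius) (h : invProd D A ∈ Icc (0 : ℝ) 1) : |A.curv| ≤ 1 := by
  have hd := D.radius_pos
  have ha := A.radius_pos
  have e := normSq_center_sub D A
  rw [Complex.normSq_eq_norm_sq] at e
  have t1 : ‖D.center - A.center‖ ≤ ‖D.center‖ + ‖A.center‖ := norm_sub_le _ _
  have t2 : ‖A.center‖ ≤ ‖D.center‖ + ‖D.center - A.center‖ := by
    have := norm_sub_le D.center (D.center - A.center)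
    simpa using this
  have n0 := norm_nonneg (D.center - A.center)
  have n1 := norm_nonneg A.center
  have n2 := norm_nonneg D.center
  have b1 : A.radius < ‖D.center - A.center‖ := by
    have : 0 ≤ 2 * D.radius * A.radius * invProd D A := by
      have := h.1
      positivity
    nlinarith
  have b2 : ‖D.center - A.center‖ ≤ D.radius + A.radius := by
    have : 2 * D.radius * A.radius * invProd D A ≤ 2 * D.radius * A.radius :=
      mul_le_of_le_one_right (by positivity) h.2
    nlinarith
  rw [curv, abs_le, Complex.normSq_eq_norm_sq]
  constructor
  · rw [le_div_iff₀ (by positivity)]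
    nlinarith
  · rw [div_le_one (by positivity)]
    rcases le_total A.radius 1 with h1 | h1 <;> nlinarith

/-- The maximum principle. Disks of `P` that leave the unit disk are allowed; finiteness of the
remaining ones guarantees that a maximum is attained. -/
theorem IsPacking.curv_le {V : Type*} {G : SimpleGraph V} {F : Set (Finset V)}
    {P P' : V → ClosedDisk} (hF : IsTriangulation G F) (hP : IsPacking G F P)
    (hP' : IsPacking G F P')
    (hinv : ∀ u v, G.Adj u v → invProd (P u) (P v) = invProd (P' u) (P' v))
    (hin : ∀ v, ‖(P' v).center‖ + (P' v).radius < 1)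
    (hfin : {v | ‖(P v).center‖ + (P v).radius < 1}.Finite) {v : V}
    (hv : ‖(P v).center‖ + (P v).radius < 1) : (P v).curv ≤ (P' v).curv := by
  classical
  by_contra! hcon
  -- Since k = coth ρ, this is the squared ratio of sinh of the hyperbolic radii in `P'` and `P`.
  let f : V → ℝ := fun v => ((P v).curv ^ 2 - 1) / ((P' v).curv ^ 2 - 1)
  obtain ⟨u, hu, hmax⟩ := Finset.exists_max_image hfin.toFinset f ⟨v, by simpa using hv⟩
  have hu : ‖(P u).center‖ + (P u).radius < 1 := by simpa using hu
  have hk' : ∀ w, 1 < (P' w).curv := fun w => ClosedDisk.one_lt_curv (hin w)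
  have hK' : ∀ w, 0 < (P' w).curv ^ 2 - 1 := fun w => by nlinarith [hk' w]
  have hM : 1 < f u := by
    refine lt_of_lt_of_le ?_ (hmax v (by simpa using hv))
    rw [one_lt_div (hK' v)]
    nlinarith [hk' v]
  have hku := ClosedDisk.one_lt_curv hu
  have hKu : 0 < (P u).curv ^ 2 - 1 := by nlinarith
  have hsq := Real.sq_sqrt hKu.le
  have hsq' := Real.sq_sqrt (hK' u).le
  have hw := Real.sqrt_pos.2 hKu
  have hw' := Real.sqrt_pos.2 (hK' u)
  set w := √((P u).curv ^ 2 - 1) with hwdef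
  set w' := √((P' u).curv ^ 2 - 1) with hwdef'
  obtain ⟨m, hm⟩ : ∃ m, m = w / w' := ⟨_, rfl⟩
  have hwm : w = m * w' := by rw [hm]; field_simp
  have hm0 : 0 < m := by rw [hm]; positivity
  have hmf : f u = m ^ 2 := by
    rw [hm, div_pow, hsq, hsq']
  rw [hmf] at hM
  have hku' : (P u).curv ≤ m * (P' u).curv := by
    refine abs_le_of_sq_le_sq' ?_ (by have := hk' u; positivity) |>.2
    rw [hwm] at hsq
    nlinarith
  refine hP.not_forall_boostT_lt hF hP' hinv hin u fun a => ?_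
  -- For a neighbor inside, maximality gives k² ≤ m²k'² - m² + 1 < m²k'². A neighbor that sticks out
  -- has |k| ≤ 1 < mk'.
  have ha : |(P a).curv| < m * (P' a).curv := by
    have h1 := hk' a
    refine abs_lt_of_sq_lt_sq ?_ (by positivity)
    by_cases hin_a : ‖(P a).center‖ + (P a).radius < 1
    · have h2 := hmax a.1 (by simpa using hin_a)
      rw [hmf, div_le_iff₀ (hK' a)] at h2
      nlinarith
    · have h2 := ClosedDisk.abs_curv_le_one hu (not_lt.1 hin_a) (hP.invProd_mem a.2)
      have h3 : (P a).curv ^ 2 ≤ 1 := by rwa [sq_le_one_iff_abs_le_one]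
      have h4 : 1 < (P' a).curv ^ 2 := by nlinarith
      have h5 := mul_lt_mul'' hM h4 zero_le_one zero_le_one
      rw [mul_pow]
      linarith
  rw [ClosedDisk.boostT_rel hu, ClosedDisk.boostT_rel (hin u), ← hwdef, ← hwdef', abs_div,
    abs_of_pos hw, div_lt_div_iff₀ hw hw', hwm, ← hinv u a a.2]
  have hp := (hP.invProd_mem a.2).1
  have t := abs_add_le (P a).curv ((P u).curv * invProd (P u) (P a))
  rw [abs_of_nonneg (mul_nonneg (zero_le_one.trans hku.le) hp)] at t
  have t2 := mul_le_mul_of_nonneg_right hku' hp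
  have : |(P a).curv + (P u).curv * invProd (P u) (P a)| <
      m * ((P' a).curv + (P' u).curv * invProd (P u) (P a)) := by linarith
  calc _ < m * ((P' a).curv + (P' u).curv * invProd (P u) (P a)) * w' :=
        mul_lt_mul_of_pos_right this hw'
    _ = _ := by ring

theorem IsDrawing.smul {V : Type*} {G : SimpleGraph V} {F : Set (Finset V)} {z : V → ℂ}
    (h : IsDrawing G F z) {r : ℝ} (hr : r ≠ 0) : IsDrawing G F fun v => r • z v := by
  have comm : ∀ (t : ℝ) (p : ℂ), t • r • p = r • t • p := fun t p => smul_comm t r p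
  have inj : Function.Injective fun p : ℂ => r • p := smul_right_injective ℂ hr
  refine ⟨h.card, inj.comp h.injective, h.adj, fun a b d hab hda hdb t ht e => ?_,
    fun a b c d hab hcd hac had hbc hbd t ht s hs e => ?_, h.avoid, fun T hT => ?_⟩
  · rw [comm, comm, ← smul_add] at e
    exact h.not_mem_edge a b d hab hda hdb t ht (inj e)
  · rw [comm, comm, comm, comm, ← smul_add, ← smul_add] at e
    exact h.not_cross a b c d hab hcd hac had hbc hbd t ht s hs (inj e)
  · obtain ⟨x, hx, hxT⟩ := h.outside T hT
    refine ⟨x, hx, ?_⟩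
    rintro ⟨w, hw, h1, h2⟩
    simp only [comm, ← Finset.smul_sum] at h2
    exact hxT ⟨w, hw, h1, inj h2⟩

theorem IsPacking.scale {V : Type*} {G : SimpleGraph V} {F : Set (Finset V)} {P : V → ClosedDisk}
    (hP : IsPacking G F P) {r : ℝ} (hr : 0 < r) : IsPacking G F fun v => (P v).scale r hr where
  invProd_nonneg u v h := by
    rw [ClosedDisk.invProd_scale]
    exact hP.invProd_nonneg u v h
  invProd_le_one u v h := by
    rw [ClosedDisk.invProd_scale]
    exact hP.invProd_le_one u v h
  drawing := hP.drawing.smul hr.ne'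

/-- Enlarging `P` by r > 1 leaves only finitely many disks inside the unit disk, because their
originals meet the compact disk of radius 1/r. The comparison then passes to the limit r → 1. -/
theorem IsPacking.curv_le_of_locallyFinite {V : Type*} {G : SimpleGraph V} {F : Set (Finset V)}
    {P P' : V → ClosedDisk} (hF : IsTriangulation G F) (hP : IsPacking G F P)
    (hP' : IsPacking G F P')
    (hinv : ∀ u v, G.Adj u v → invProd (P u) (P v) = invProd (P' u) (P' v))
    (hfin : IsLocallyFiniteIn P (Metric.ball 0 1)) (hfin' : IsLocallyFiniteIn P' (Metric.ball 0 1))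
    (v : V) : (P v).curv ≤ (P' v).curv := by
  have hv := ClosedDisk.norm_add_radius_lt_one (hfin.1 v)
  have hd := (P v).radius_pos
  have norm_scale : ∀ r (hr : 0 < r) u, ‖((P u).scale r hr).center‖ + ((P u).scale r hr).radius =
      r * (‖(P u).center‖ + (P u).radius) := by
    intro r hr u
    rw [ClosedDisk.scale, norm_smul, Real.norm_of_nonneg hr.le, mul_add]
  have main : ∀ r : ℝ, 1 < r → r * (‖(P v).center‖ + (P v).radius) < 1 →
      (1 + r ^ 2 * ((P v).radius ^ 2 - Complex.normSq (P v).center)) / (2 * r * (P v).radius) ≤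
        (P' v).curv := by
    intro r hr1 hrv
    have hr : 0 < r := by linarith
    have := (hP.scale hr).curv_le hF hP' (fun u v h => by
      rw [ClosedDisk.invProd_scale]
      exact hinv u v h) (fun v => ClosedDisk.norm_add_radius_lt_one (hfin'.1 v)) (v := v) ?_
      (by rwa [norm_scale])
    · convert this using 1
      rw [ClosedDisk.curv, ClosedDisk.scale, Complex.real_smul, map_mul, Complex.normSq_ofReal]
      ring
    · refine (hfin.2 (Metric.closedBall 0 (1 / r)) (Metric.closedBall_subset_ball
        (by rw [div_lt_one hr]; exact hr1)) (isCompact_closedBall _ _)).subset fun u hu => ?_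
      refine ⟨(P u).center, Metric.mem_closedBall_self (P u).radius_pos.le, ?_⟩
      simp only [mem_ofPred_eq, norm_scale] at hu
      rw [mem_closedBall_zero_iff, le_div_iff₀ hr]
      nlinarith [(P u).radius_pos]
  have hlim : Filter.Tendsto (fun r : ℝ =>
      (1 + r ^ 2 * ((P v).radius ^ 2 - Complex.normSq (P v).center)) / (2 * r * (P v).radius))
      (nhdsWithin 1 (Ioi 1)) (nhds (P v).curv) := by
    have : ContinuousAt (fun r : ℝ =>
      (1 + r ^ 2 * ((P v).radius ^ 2 - Complex.normSq (P v).center)) / (2 * r * (P v).radius)) 1 :=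
      ContinuousAt.div (by fun_prop) (by fun_prop) (by positivity)
    have h2 := this.tendsto.mono_left (nhdsWithin_le_nhds (s := Ioi 1))
    convert h2 using 2
    rw [ClosedDisk.curv]
    ring
  refine le_of_tendsto hlim ?_
  have hev : ∀ᶠ r : ℝ in nhds 1, r * (‖(P v).center‖ + (P v).radius) < 1 :=
    (continuous_id.mul continuous_const).continuousAt.eventually_lt continuousAt_const
      (by simpa using hv)
  filter_upwards [self_mem_nhdsWithin, nhdsWithin_le_nhds hev] with r h1 h2
  exact main r h1 h2

end DiskPatterns

namespace DiskPatterns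

open Set

/-! ### Minkowski space -/

/-- The Minkowski form of `ℝ^{2,1}`, positive on timelike vectors. -/
noncomputable def mink : LinearMap.BilinForm ℝ (Fin 3 → ℝ) :=
  LinearMap.mk₂ ℝ (fun X Y => X 2 * Y 2 - X 0 * Y 0 - X 1 * Y 1)
    (fun X X' Y => by simp only [Pi.add_apply]; ring)
    (fun r X Y => by simp only [Pi.smul_apply, smul_eq_mul]; ring)
    (fun X Y Y' => by simp only [Pi.add_apply]; ring)
    (fun r X Y => by simp only [Pi.smul_apply, smul_eq_mul]; ring)

theorem mink_apply (X Y : Fin 3 → ℝ) : mink X Y = X 2 * Y 2 - X 0 * Y 0 - X 1 * Y 1 := rfl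

/-- The determinant of three vectors. -/
noncomputable def vol (X Y Z : Fin 3 → ℝ) : ℝ := (Pi.basisFun ℝ (Fin 3)).det ![X, Y, Z]

theorem vol_apply (X Y Z : Fin 3 → ℝ) : vol X Y Z =
    X 0 * Y 1 * Z 2 - X 0 * Y 2 * Z 1 - X 1 * Y 0 * Z 2 + X 1 * Y 2 * Z 0 + X 2 * Y 0 * Z 1 -
      X 2 * Y 1 * Z 0 := by
  rw [vol, Pi.basisFun_det]
  exact Matrix.det_fin_three ![X, Y, Z]

theorem vol_map (L : (Fin 3 → ℝ) →ₗ[ℝ] Fin 3 → ℝ) (X Y Z : Fin 3 → ℝ) :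
    vol (L X) (L Y) (L Z) = LinearMap.det L * vol X Y Z := by
  rw [vol, vol, ← Module.Basis.det_comp]
  congr 1
  ext i
  fin_cases i <;> rfl

theorem vol_sq (X Y Z : Fin 3 → ℝ) : vol X Y Z ^ 2 = mink X X * mink Y Y * mink Z Z +
    2 * mink X Y * mink X Z * mink Y Z - mink X X * mink Y Z ^ 2 - mink Y Y * mink X Z ^ 2 -
      mink Z Z * mink X Y ^ 2 := by
  simp only [vol_apply, mink_apply]
  ring

/-- The plane of `X` and `Y` is nondegenerate, so it contains no nonzero vector orthogonal to
itself. -/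
theorem eq_zero_of_mink_of_vol {X Y N : Fin 3 → ℝ}
    (h : mink X X * mink Y Y - mink X Y ^ 2 ≠ 0) (hX : mink X N = 0) (hY : mink Y N = 0)
    (hv : vol X Y N = 0) : N = 0 := by
  have key : ∀ i, (mink X X * mink Y Y - mink X Y ^ 2) * N i = 0 := by
    simp only [mink_apply, vol_apply] at *
    intro i
    fin_cases i
    · simp only [Fin.zero_eta]
      linear_combination (-Y 1 * (X 0 * Y 1 - X 1 * Y 0) - Y 2 * (X 2 * Y 0 - X 0 * Y 2)) * hX -
        (-X 1 * (X 0 * Y 1 - X 1 * Y 0) - X 2 * (X 2 * Y 0 - X 0 * Y 2)) * hY -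
        (X 1 * Y 2 - X 2 * Y 1) * hv
    · simp only [Fin.mk_one]
      linear_combination (Y 2 * (X 1 * Y 2 - X 2 * Y 1) + Y 0 * (X 0 * Y 1 - X 1 * Y 0)) * hX -
        (X 2 * (X 1 * Y 2 - X 2 * Y 1) + X 0 * (X 0 * Y 1 - X 1 * Y 0)) * hY -
        (X 2 * Y 0 - X 0 * Y 2) * hv
    · simp only [Fin.reduceFinMk]
      linear_combination (Y 1 * (X 1 * Y 2 - X 2 * Y 1) - Y 0 * (X 2 * Y 0 - X 0 * Y 2)) * hX -
        (X 1 * (X 1 * Y 2 - X 2 * Y 1) - X 0 * (X 2 * Y 0 - X 0 * Y 2)) * hY +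
        (X 0 * Y 1 - X 1 * Y 0) * hv
  ext i
  exact (mul_eq_zero.1 (key i)).resolve_left h

/-- The products determine a vector up to reflection in the plane of `X` and `Y`; the sign of the
volume removes the ambiguity. -/
theorem eq_of_mink_of_vol {X Y Z U : Fin 3 → ℝ} (h : mink X X * mink Y Y - mink X Y ^ 2 ≠ 0)
    (hX : mink X U = mink X Z) (hY : mink Y U = mink Y Z) (hZ : mink U U = mink Z Z)
    (hv : 0 < vol X Y U * vol X Y Z) : U = Z := by
  have hsq : vol X Y U ^ 2 = vol X Y Z ^ 2 := by rw [vol_sq, vol_sq, hX, hY, hZ]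
  have hvol : vol X Y U = vol X Y Z := by
    rcases sq_eq_sq_iff_eq_or_eq_neg.1 hsq with e | e
    · exact e
    · rw [e] at hv
      nlinarith [sq_nonneg (vol X Y Z)]
  refine sub_eq_zero.1 (eq_zero_of_mink_of_vol h (by rw [map_sub, hX, sub_self])
    (by rw [map_sub, hY, sub_self]) ?_)
  simp only [vol_apply, Pi.sub_apply] at hvol ⊢
  linear_combination hvol

/-- Two triples of vectors with the same Gram matrix are related by an isometry. -/
theorem exists_isometry {X Y : Fin 3 → Fin 3 → ℝ} (hX : vol (X 0) (X 1) (X 2) ≠ 0)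
    (hY : vol (Y 0) (Y 1) (Y 2) ≠ 0) (h : ∀ i j, mink (X i) (X j) = mink (Y i) (Y j)) :
    ∃ L : (Fin 3 → ℝ) ≃ₗ[ℝ] Fin 3 → ℝ, (∀ i, L (X i) = Y i) ∧
      ∀ u v, mink (L u) (L v) = mink u v := by
  have basis : ∀ X : Fin 3 → Fin 3 → ℝ, vol (X 0) (X 1) (X 2) ≠ 0 →
      ∃ b : Module.Basis (Fin 3) ℝ (Fin 3 → ℝ), ∀ i, b i = X i := by
    intro X hX
    have e : ![X 0, X 1, X 2] = X := by ext i; fin_cases i <;> rfl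
    rw [vol, e] at hX
    obtain ⟨h1, h2⟩ := (Module.Basis.is_basis_iff_det (Pi.basisFun ℝ (Fin 3))).2
      (isUnit_iff_ne_zero.2 hX)
    exact ⟨Module.Basis.mk h1 h2.ge, fun i => Module.Basis.mk_apply h1 h2.ge i⟩
  obtain ⟨b, hb⟩ := basis X hX
  obtain ⟨b', hb'⟩ := basis Y hY
  let L := b.equiv b' (Equiv.refl _)
  have hL : ∀ i, L (b i) = b' i := fun i => by simp [L]
  refine ⟨L, fun i => by rw [← hb, ← hb', hL], fun u v => ?_⟩
  have : LinearMap.BilinForm.comp mink L.toLinearMap L.toLinearMap = mink := by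
    refine LinearMap.BilinForm.ext_basis b fun i j => ?_
    rw [LinearMap.BilinForm.comp_apply, LinearEquiv.coe_coe, hL, hL, hb', hb', hb, hb, h]
  conv_rhs => rw [← this]
  rfl

/-! ### The hyperboloid model -/

/-- The point of the hyperboloid that corresponds to a point of the unit disk. -/
noncomputable def lift (z : ℂ) : Fin 3 → ℝ :=
  ![2 * z.re / (1 - Complex.normSq z), 2 * z.im / (1 - Complex.normSq z),
    (1 + Complex.normSq z) / (1 - Complex.normSq z)]

/-- The stereographic projection of the hyperboloid to the unit disk. -/
noncomputable def proj (X : Fin 3 → ℝ) : ℂ := ⟨X 0 / (1 + X 2), X 1 / (1 + X 2)⟩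

theorem one_sub_normSq_pos {z : ℂ} (hz : z ∈ Metric.ball (0 : ℂ) 1) :
    0 < 1 - Complex.normSq z := by
  rw [mem_ball_zero_iff] at hz
  rw [Complex.normSq_eq_norm_sq]
  nlinarith [norm_nonneg z]

theorem proj_lift {z : ℂ} (hz : z ∈ Metric.ball (0 : ℂ) 1) : proj (lift z) = z := by
  have h := (one_sub_normSq_pos hz).ne'
  have h2 : 1 + (1 + Complex.normSq z) / (1 - Complex.normSq z) =
      2 / (1 - Complex.normSq z) := by
    field_simp
    ring
  apply Complex.ext
  · simp only [proj, lift, Matrix.cons_val, h2]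
    field_simp
  · simp only [proj, lift, Matrix.cons_val, h2]
    field_simp

theorem mink_lift_self {z : ℂ} (hz : z ∈ Metric.ball (0 : ℂ) 1) : mink (lift z) (lift z) = 1 := by
  have h := (one_sub_normSq_pos hz).ne'
  have hn := Complex.normSq_apply z
  simp only [mink_apply, lift, Matrix.cons_val]
  generalize Complex.normSq z = n at *
  field_simp
  linear_combination 4 * hn

theorem lift_time_pos {z : ℂ} (hz : z ∈ Metric.ball (0 : ℂ) 1) : 0 < lift z 2 := by
  have h := one_sub_normSq_pos hz
  have := Complex.normSq_nonneg z
  simp only [lift, Matrix.cons_val]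
  positivity

theorem proj_mem {X : Fin 3 → ℝ} (h : mink X X = 1) (h2 : 0 < X 2) :
    proj X ∈ Metric.ball (0 : ℂ) 1 ∧ lift (proj X) = X := by
  have h1 : 1 + X 2 ≠ 0 := by positivity
  rw [mink_apply] at h
  have hn : 1 - Complex.normSq (proj X) = 2 / (1 + X 2) := by
    simp only [proj, Complex.normSq_apply]
    field_simp
    linear_combination h
  have hpos : 0 < 2 / (1 + X 2) := by positivity
  refine ⟨?_, ?_⟩
  · rw [mem_ball_zero_iff]
    rw [Complex.normSq_eq_norm_sq] at hn
    nlinarith [norm_nonneg (proj X)]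
  · ext i
    fin_cases i
    · simp only [lift, Fin.zero_eta, Matrix.cons_val, hn]
      simp only [proj]
      field_simp
    · simp only [lift, Fin.mk_one, Matrix.cons_val, hn]
      simp only [proj]
      field_simp
    · simp only [lift, Fin.reduceFinMk, Matrix.cons_val, hn]
      have : 1 + Complex.normSq (proj X) = 2 - 2 / (1 + X 2) := by rw [← hn]; ring
      rw [this]
      field_simp
      ring

/-- On the hyperboloid the form is cosh of the distance, and sinh²(d/2) = (cosh d - 1)/2. -/
theorem hypDist_eq {z w : ℂ} (hz : z ∈ Metric.ball (0 : ℂ) 1) (hw : w ∈ Metric.ball (0 : ℂ) 1) :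
    hypDist z w = 2 * Real.arsinh √((mink (lift z) (lift w) - 1) / 2) := by
  have h1 := one_sub_normSq_pos hz
  have h2 := one_sub_normSq_pos hw
  have e : (mink (lift z) (lift w) - 1) / 2 =
      ‖z - w‖ ^ 2 / ((1 - ‖z‖ ^ 2) * (1 - ‖w‖ ^ 2)) := by
    rw [← Complex.normSq_eq_norm_sq, ← Complex.normSq_eq_norm_sq, ← Complex.normSq_eq_norm_sq]
    simp only [mink_apply, lift, Matrix.cons_val]
    have h1 := h1.ne'
    have h2 := h2.ne'
    have hn := Complex.normSq_apply z
    have hm := Complex.normSq_apply w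
    rw [Complex.normSq_apply (z - w), Complex.sub_re, Complex.sub_im]
    generalize Complex.normSq z = n at *
    generalize Complex.normSq w = m at *
    field_simp
    linear_combination 2 * hn + 2 * hm
  rw [e, Real.sqrt_div (sq_nonneg _), Real.sqrt_sq (norm_nonneg _), hypDist]

/-- Reversed Cauchy–Schwarz: two timelike vectors with positive time lie in the same cone. -/
theorem mink_pos_of_future {X Y : Fin 3 → ℝ} (hX : 0 < mink X X) (hY : 0 < mink Y Y)
    (hX2 : 0 < X 2) (hY2 : 0 < Y 2) : 0 < mink X Y := by
  simp only [mink_apply] at *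
  have h : (X 0 * Y 0 + X 1 * Y 1) ^ 2 < (X 2 * Y 2) ^ 2 := by
    have c : (X 0 * Y 0 + X 1 * Y 1) ^ 2 ≤ (X 0 ^ 2 + X 1 ^ 2) * (Y 0 ^ 2 + Y 1 ^ 2) := by
      nlinarith [sq_nonneg (X 0 * Y 1 - X 1 * Y 0)]
    have d : (X 0 ^ 2 + X 1 ^ 2) * (Y 0 ^ 2 + Y 1 ^ 2) < X 2 ^ 2 * Y 2 ^ 2 :=
      mul_lt_mul'' (by linarith) (by linarith) (by positivity) (by positivity)
    rw [mul_pow]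
    linarith
  have := (abs_lt_of_sq_lt_sq' h (by positivity)).2
  linarith

theorem future_of_mink_pos {X Y : Fin 3 → ℝ} (hX : 0 < mink X X) (hY : 0 < mink Y Y)
    (hY2 : 0 < Y 2) (h : 0 < mink X Y) : 0 < X 2 := by
  by_contra! hcon
  have hne : X 2 ≠ 0 := by
    intro h0
    rw [mink_apply, h0] at hX
    nlinarith [sq_nonneg (X 0), sq_nonneg (X 1)]
  have := mink_pos_of_future (X := -X) (Y := Y) (by simpa using hX) hY
    (by simpa using lt_of_le_of_ne hcon hne) hY2
  rw [map_neg, LinearMap.neg_apply] at this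
  linarith

/-- An isometry of Minkowski space that preserves the future acts on the unit disk. -/
theorem exists_lift_eq {L : (Fin 3 → ℝ) → Fin 3 → ℝ} (hL : ∀ u v, mink (L u) (L v) = mink u v)
    {W : Fin 3 → ℝ} (hW : 0 < mink W W) (hW2 : 0 < W 2) (hLW : 0 < L W 2) {z : ℂ}
    (hz : z ∈ Metric.ball (0 : ℂ) 1) :
    proj (L (lift z)) ∈ Metric.ball (0 : ℂ) 1 ∧ lift (proj (L (lift z))) = L (lift z) := by
  have h1 := mink_lift_self hz
  refine proj_mem (by rw [hL, h1]) (future_of_mink_pos (Y := L W) ?_ ?_ hLW ?_)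
  · rw [hL, h1]; exact one_pos
  · rw [hL]; exact hW
  · rw [hL]
    exact mink_pos_of_future (by rw [h1]; exact one_pos) hW (lift_time_pos hz) hW2

/-- The vector of Minkowski space that corresponds to a disk. -/
noncomputable def ClosedDisk.vec (D : ClosedDisk) : Fin 3 → ℝ :=
  ![D.center.re / D.radius, D.center.im / D.radius,
    (1 + Complex.normSq D.center - D.radius ^ 2) / (2 * D.radius)]

namespace ClosedDisk

theorem mink_vec_self (D : ClosedDisk) : mink D.vec D.vec = D.curv ^ 2 - 1 := by
  have := D.radius_pos.ne'
  simp only [mink_apply, vec, Matrix.cons_val, curv, Complex.normSq_apply]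
  field_simp
  ring

/-- The pair (`vec`, `curv`) is the vector of the disk in ℝ^{3,1}, where the form is the inversive
product. With the curvatures known, inversive products amount to Gram matrices in ℝ^{2,1}. -/
theorem mink_vec (D E : ClosedDisk) : mink D.vec E.vec = invProd D E + D.curv * E.curv := by
  have := D.radius_pos.ne'
  have := E.radius_pos.ne'
  simp only [mink_apply, vec, Matrix.cons_val, curv, invProd, Complex.normSq_apply,
    Complex.sub_re, Complex.sub_im]
  field_simp
  ring

theorem orient_eq (A B C : ClosedDisk) : orient A B C =
    2 * A.radius * B.radius * C.radius * vol A.vec B.vec C.vec := by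
  have := A.radius_pos.ne'
  have := B.radius_pos.ne'
  have := C.radius_pos.ne'
  simp only [vol_apply, vec, Matrix.cons_val, orient, cross]
  field_simp
  ring

theorem vol_pos {A B C : ClosedDisk} (h : 0 < orient A B C) : 0 < vol A.vec B.vec C.vec := by
  have := A.radius_pos
  have := B.radius_pos
  have := C.radius_pos
  rw [orient_eq] at h
  exact pos_of_mul_pos_right h (by positivity)

theorem vec_time_pos {D : ClosedDisk} (h : ‖D.center‖ + D.radius < 1) : 0 < D.vec 2 := by
  have := D.radius_pos
  have h1 : 0 < 1 + Complex.normSq D.center - D.radius ^ 2 := by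
    nlinarith [Complex.normSq_nonneg D.center, norm_nonneg D.center]
  simp only [vec, Matrix.cons_val]
  positivity

/-- On the hyperboloid a disk is cut out by a half-space given by `vec` and `curv`. A linear
isometry that matches these data therefore maps the disks as sets. -/
theorem mem_carrier_iff {D : ClosedDisk} {z : ℂ} (hz : z ∈ Metric.ball (0 : ℂ) 1) :
    z ∈ D.carrier ↔ mink (lift z) D.vec ≤ D.curv := by
  have h := one_sub_normSq_pos hz
  have hd := D.radius_pos
  have e : D.curv - mink (lift z) D.vec =
      (D.radius ^ 2 - Complex.normSq (z - D.center)) / ((1 - Complex.normSq z) * D.radius) := by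
    have h' := h.ne'
    have hn := Complex.normSq_apply z
    have hm := Complex.normSq_apply D.center
    simp only [mink_apply, lift, vec, Matrix.cons_val, curv]
    rw [Complex.normSq_apply (z - _), Complex.sub_re, Complex.sub_im]
    generalize Complex.normSq z = n at *
    generalize Complex.normSq D.center = m at *
    field_simp
    linear_combination -2 * hn - 2 * hm
  rw [← sub_nonneg, e, carrier, Metric.mem_closedBall, dist_eq_norm,
    le_div_iff₀ (by positivity), zero_mul, sub_nonneg, Complex.normSq_eq_norm_sq,
    sq_le_sq₀ (norm_nonneg _) hd.le]

end ClosedDisk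

end DiskPatterns

namespace DiskPatterns

open Set

/-! ### Rigidity -/

section Rigidity

variable {V : Type*} [DecidableEq V] {G : SimpleGraph V} {F : Set (Finset V)}
  {P P' : V → ClosedDisk}

/-- In `P'` too, the neighbors before and after `σ a` lie on opposite sides of the plane of `v` and
`σ a`, whichever way its flower runs around `v`. -/
theorem IsFlower.vol_mul_neg {v : V} {σ σ' : Equiv.Perm (Nbr G v)} (hF : IsTriangulation G F)
    (hP' : IsPacking G F P') (hin' : ∀ v, ‖(P' v).center‖ + (P' v).radius < 1)
    (hσ : IsFlower F (fun v => (P v).center) v σ) (hσ' : IsFlower F (fun v => (P' v).center) v σ')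
    (a : Nbr G v) : vol (P' v).vec (P' (σ a)).vec (P' a).vec *
      vol (P' v).vec (P' (σ a)).vec (P' (σ (σ a))).vec < 0 := by
  have swap : ∀ X Y Z, vol X Z Y = -vol X Y Z := fun X Y Z => by
    simp only [vol_apply]; ring
  have pos : ∀ a : Nbr G v, 0 < vol (P' v).vec (P' a).vec (P' (σ' a)).vec := fun a =>
    ClosedDisk.vol_pos (hP'.orient_pos hF hin' hσ' a)
  have ne : ∀ a : Nbr G v, a ≠ σ a := fun a e => (hσ.adj hF a).ne (congrArg Subtype.val e)
  have f1 := hσ'.eq_or_eq a (σ a) (ne a) (hσ.face a)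
  have f2 := hσ'.eq_or_eq (σ a) (σ (σ a)) (ne _) (hσ.face _)
  have hne := hσ.apply_apply_ne a
  rcases f1 with f1 | f1 <;> rcases f2 with f2 | f2
  · have h1 := pos a
    have h2 := pos (σ a)
    rw [← f1] at h1
    rw [← f2] at h2
    rw [swap]
    nlinarith
  · exact absurd (σ'.injective (f2.symm.trans f1)) hne
  · exact absurd (f2.trans f1.symm) hne
  · have h1 := pos (σ a)
    have h2 := pos (σ (σ a))
    rw [← f1] at h1
    rw [← f2] at h2
    rw [swap _ (P' (σ (σ a))).vec]
    nlinarith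

/-- An isometry that maps the vectors of two consecutive neighbors and of the central disk of a
flower to those of another pattern does so for the next neighbor. -/
theorem IsFlower.map_vec_next {v : V} {σ σ' : Equiv.Perm (Nbr G v)} (hF : IsTriangulation G F)
    (hP : IsPacking G F P) (hP' : IsPacking G F P')
    (hinv : ∀ u v, G.Adj u v → invProd (P u) (P v) = invProd (P' u) (P' v))
    (hcurv : ∀ v, (P v).curv = (P' v).curv) (hin : ∀ v, ‖(P v).center‖ + (P v).radius < 1)
    (hin' : ∀ v, ‖(P' v).center‖ + (P' v).radius < 1)
    (hσ : IsFlower F (fun v => (P v).center) v σ) (hσ' : IsFlower F (fun v => (P' v).center) v σ')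
    {L : (Fin 3 → ℝ) ≃ₗ[ℝ] Fin 3 → ℝ} (hL : ∀ u v, mink (L u) (L v) = mink u v)
    (hv : L (P v).vec = (P' v).vec) {a : Nbr G v} (h1 : L (P a).vec = (P' a).vec)
    (h2 : L (P (σ a)).vec = (P' (σ a)).vec) : L (P (σ (σ a))).vec = (P' (σ (σ a))).vec := by
  have hmink : ∀ u w, G.Adj u w → mink (P u).vec (P w).vec = mink (P' u).vec (P' w).vec := by
    intro u w h
    rw [ClosedDisk.mink_vec, ClosedDisk.mink_vec, hinv u w h, hcurv, hcurv]
  have hmap : ∀ X Y Z, vol (L X) (L Y) (L Z) = LinearMap.det L.toLinearMap * vol X Y Z :=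
    fun X Y Z => vol_map L.toLinearMap X Y Z
  have swap : ∀ X Y Z, vol X Z Y = -vol X Y Z := fun X Y Z => by
    simp only [vol_apply]; ring
  refine eq_of_mink_of_vol (X := (P' v).vec) (Y := (P' (σ a)).vec) ?_ ?_ ?_ ?_ ?_
  · rw [ClosedDisk.mink_vec_self, ClosedDisk.mink_vec_self, ClosedDisk.mink_vec]
    have k1 := ClosedDisk.one_lt_curv (hin' v)
    have k2 := ClosedDisk.one_lt_curv (hin' (σ a))
    have hc := (hP'.invProd_mem (σ a).2).1
    have := mul_nonneg hc (mul_pos (zero_lt_one.trans k1) (zero_lt_one.trans k2)).le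
    nlinarith
  · rw [← hv, hL, hmink _ _ (σ (σ a)).2, hv]
  · rw [← h2, hL, hmink _ _ (hσ.adj hF (σ a)), h2]
  · rw [hL, ClosedDisk.mink_vec_self, ClosedDisk.mink_vec_self, hcurv]
  · have n := hσ.vol_mul_neg hF hP' hin' hσ' a
    have p1 := ClosedDisk.vol_pos (hP.orient_pos hF hin hσ a)
    have p2 := ClosedDisk.vol_pos (hP.orient_pos hF hin hσ (σ a))
    rw [← hv, ← h1, ← h2, hmap, swap] at n
    rw [← hv, ← h2, hmap]
    generalize vol (L (P v).vec) (L (P (σ a)).vec) (P' (σ (σ a))).vec = d' at *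
    generalize vol (P v).vec (P (σ a)).vec (P (σ (σ a))).vec = d at *
    generalize vol (P v).vec (P a).vec (P (σ a)).vec = e at *
    generalize LinearMap.det L.toLinearMap = δ at *
    have : 0 < e * (δ * d') := by linarith
    have := (pos_iff_pos_of_mul_pos this).1 p1
    have := mul_pos p2 this
    linarith

/-- Two patterns in the unit disk with equal angles and curvatures differ by an isometry. -/
theorem IsPacking.exists_isometry (hF : IsTriangulation G F)
    (hP : IsPacking G F P) (hP' : IsPacking G F P')
    (hinv : ∀ u v, G.Adj u v → invProd (P u) (P v) = invProd (P' u) (P' v))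
    (hcurv : ∀ v, (P v).curv = (P' v).curv) (hin : ∀ v, ‖(P v).center‖ + (P v).radius < 1)
    (hin' : ∀ v, ‖(P' v).center‖ + (P' v).radius < 1) :
    ∃ L : (Fin 3 → ℝ) ≃ₗ[ℝ] Fin 3 → ℝ, (∀ u v, mink (L u) (L v) = mink u v) ∧
      ∀ v, L (P v).vec = (P' v).vec := by
  have := hF.infinite
  have v : V := Classical.arbitrary V
  obtain ⟨σ, hσ⟩ := hP.drawing.exists_isFlower hF v
  obtain ⟨σ', hσ'⟩ := hP'.drawing.exists_isFlower hF v
  obtain ⟨a⟩ : Nonempty (Nbr G v) := by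
    obtain ⟨x, hx⟩ := exists_ne v
    obtain ⟨p⟩ := hF.connected v x
    cases p with
    | nil => exact absurd rfl hx
    | cons h _ => exact ⟨_, h⟩
  have hmink : ∀ u w, u = w ∨ G.Adj u w →
      mink (P u).vec (P w).vec = mink (P' u).vec (P' w).vec := by
    rintro u w (rfl | h)
    · rw [ClosedDisk.mink_vec_self, ClosedDisk.mink_vec_self, hcurv]
    · rw [ClosedDisk.mink_vec, ClosedDisk.mink_vec, hinv u w h, hcurv, hcurv]
  let T : Fin 3 → V := ![v, a, σ a]
  have hvol : vol (P' v).vec (P' a).vec (P' (σ a)).vec ≠ 0 := by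
    intro h0
    have := hσ.vol_mul_neg hF hP' hin' hσ' a
    have swap : vol (P' v).vec (P' (σ a)).vec (P' a).vec =
        -vol (P' v).vec (P' a).vec (P' (σ a)).vec := by
      simp only [vol_apply]; ring
    rw [swap, h0] at this
    simp at this
  have hgram : ∀ i j, mink (P (T i)).vec (P (T j)).vec = mink (P' (T i)).vec (P' (T j)).vec := by
    intro i j
    have h1 := a.2
    have h2 := (σ a).2
    have h3 := hσ.adj hF a
    refine hmink _ _ ?_
    fin_cases i <;> fin_cases j <;> simp [T, h1, h2, h3, h1.symm, h2.symm, h3.symm]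
  obtain ⟨L, hLT, hL⟩ := DiskPatterns.exists_isometry (X := fun i => (P (T i)).vec)
    (Y := fun i => (P' (T i)).vec)
    (ClosedDisk.vol_pos (hP.orient_pos hF hin hσ a)).ne' hvol hgram
  refine ⟨L, hL, ?_⟩
  have around : ∀ (u : V) (τ : Equiv.Perm (Nbr G u)), IsFlower F (fun v => (P v).center) u τ →
      L (P u).vec = (P' u).vec → ∀ b : Nbr G u, L (P b).vec = (P' b).vec →
      L (P (τ b)).vec = (P' (τ b)).vec → ∀ c : Nbr G u, L (P c).vec = (P' c).vec := by
    intro u τ hτ hu b hb hb' c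
    have : Fintype (Nbr G u) := (hF.finite_nbrs u).fintype
    obtain ⟨τ', hτ'⟩ := hP'.drawing.exists_isFlower hF u
    exact (hτ.induction hP.drawing (p := fun c => L (P c).vec = (P' c).vec ∧
      L (P (τ c)).vec = (P' (τ c)).vec)
      (fun c hc => ⟨hc.2, hτ.map_vec_next hF hP hP' hinv hcurv hin hin' hτ' hL hu hc.1 hc.2⟩)
      ⟨hb, hb'⟩ c).1
  have start : L (P v).vec = (P' v).vec ∧ ∀ c : Nbr G v, L (P c).vec = (P' c).vec :=
    ⟨hLT 0, around v σ hσ (hLT 0) a (hLT 1) (hLT 2)⟩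
  have walk : ∀ (x y : V) (p : G.Walk x y),
      (L (P x).vec = (P' x).vec ∧ ∀ c : Nbr G x, L (P c).vec = (P' c).vec) →
      L (P y).vec = (P' y).vec := by
    intro x y p
    induction p with
    | nil => exact fun h => h.1
    | @cons x u y hxu p ih =>
      intro h
      obtain ⟨τ, hτ⟩ := hP.drawing.exists_isFlower hF u
      -- The flower of `u` is entered at `x`; the next neighbor there is also adjacent to `x`, so it
      -- is already matched.
      refine ih ⟨h.2 ⟨u, hxu⟩, around u τ hτ (h.2 ⟨u, hxu⟩) ⟨x, hxu.symm⟩ h.1 ?_⟩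
      exact h.2 ⟨(τ ⟨x, hxu.symm⟩).1, hτ.adj hF ⟨x, hxu.symm⟩⟩
  intro w
  obtain ⟨p⟩ := hF.connected v w
  exact walk v w p start

end Rigidity

/-- An isometry of Minkowski space that maps the vectors of a family of disks to those of another
family induces a hyperbolic isometry between them. -/
theorem exists_isHyperbolicIsometry {V : Type*} [Nonempty V] {P P' : V → ClosedDisk}
    (hP : ∀ v, (P v).carrier ⊆ Metric.ball 0 1) (hP' : ∀ v, (P' v).carrier ⊆ Metric.ball 0 1)
    (hcurv : ∀ v, (P v).curv = (P' v).curv) {L : (Fin 3 → ℝ) ≃ₗ[ℝ] Fin 3 → ℝ}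
    (hL : ∀ u v, mink (L u) (L v) = mink u v) (hLP : ∀ v, L (P v).vec = (P' v).vec) :
    ∃ f : ℂ → ℂ, IsHyperbolicIsometry f ∧ ∀ v : V, (P' v).carrier = f '' (P v).carrier := by
  obtain ⟨v₀⟩ := ‹Nonempty V›
  have hin := fun v => ClosedDisk.norm_add_radius_lt_one (hP v)
  have hin' := fun v => ClosedDisk.norm_add_radius_lt_one (hP' v)
  have time : ∀ D : ClosedDisk, ‖D.center‖ + D.radius < 1 → 0 < mink D.vec D.vec := by
    intro D hD
    rw [ClosedDisk.mink_vec_self]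
    nlinarith [ClosedDisk.one_lt_curv hD]
  have hL' : ∀ u v, mink (L.symm u) (L.symm v) = mink u v := fun u v => by
    rw [← hL, L.apply_symm_apply, L.apply_symm_apply]
  have hf := fun z (hz : z ∈ Metric.ball (0 : ℂ) 1) => exists_lift_eq hL (time _ (hin v₀))
    (ClosedDisk.vec_time_pos (hin v₀)) (by rw [hLP]; exact ClosedDisk.vec_time_pos (hin' v₀)) hz
  have hg := fun z (hz : z ∈ Metric.ball (0 : ℂ) 1) => exists_lift_eq hL' (time _ (hin' v₀))
    (ClosedDisk.vec_time_pos (hin' v₀)) (by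
      rw [← hLP, L.symm_apply_apply]; exact ClosedDisk.vec_time_pos (hin v₀)) hz
  have left : ∀ z ∈ Metric.ball (0 : ℂ) 1,
      proj (L.symm (lift (proj (L (lift z))))) = z := fun z hz => by
    rw [(hf z hz).2, L.symm_apply_apply, proj_lift hz]
  have right : ∀ z ∈ Metric.ball (0 : ℂ) 1,
      proj (L (lift (proj (L.symm (lift z))))) = z := fun z hz => by
    rw [(hg z hz).2, L.apply_symm_apply, proj_lift hz]
  have mem : ∀ v, ∀ z ∈ Metric.ball (0 : ℂ) 1,
      proj (L (lift z)) ∈ (P' v).carrier ↔ z ∈ (P v).carrier := fun v z hz => by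
    rw [ClosedDisk.mem_carrier_iff hz, ClosedDisk.mem_carrier_iff (hf z hz).1, (hf z hz).2, ← hLP,
      hL, hcurv]
  refine ⟨fun z => proj (L (lift z)), ⟨⟨fun z hz => (hf z hz).1, ?_, ?_⟩, ?_⟩, fun v => ?_⟩
  · intro z hz w hw e
    rw [← left z hz, ← left w hw]
    simp only at e
    rw [e]
  · exact fun z hz => ⟨_, (hg z hz).1, right z hz⟩
  · intro z hz w hw
    rw [hypDist_eq (hf z hz).1 (hf w hw).1, (hf z hz).2, (hf w hw).2, hL, hypDist_eq hz hw]
  · ext w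
    constructor
    · intro hw
      have hwU := hP' v hw
      refine ⟨_, (mem v _ (hg w hwU).1).1 ?_, right w hwU⟩
      rwa [right w hwU]
    · rintro ⟨z, hz, rfl⟩
      exact (mem v z (hP v hz)).2 hz

end DiskPatterns

/-! ### The rigidity theorem -/

theorem mainTheorem2 {V : Type*} (G : SimpleGraph V) (Θ : Sym2 V → ℝ)
    (hG : DiskPatterns.IsDiskTriangulationGraph G)
    (hΘ : ∀ e ∈ G.edgeSet, Θ e ∈ Set.Icc 0 (Real.pi / 2))
    (hsep : DiskPatterns.SeparatingTriangleCondition G Θ)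
    (P Pstar : V → DiskPatterns.ClosedDisk)
    (hP : DiskPatterns.Realizes P G Θ)
    (hPstar : DiskPatterns.Realizes Pstar G Θ)
    (hPfin : DiskPatterns.IsLocallyFiniteIn P (Metric.ball 0 1))
    (hPstarfin : DiskPatterns.IsLocallyFiniteIn Pstar (Metric.ball 0 1)) :
    ∃ f : ℂ → ℂ, DiskPatterns.IsHyperbolicIsometry f ∧
      ∀ v : V, (Pstar v).carrier = f '' (P v).carrier := by
  classical
  obtain ⟨F, hF, hpack⟩ := DiskPatterns.exists_isTriangulation hG hΘ hsep
  have h := hpack P hP hPfin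
  have h' := hpack Pstar hPstar hPstarfin
  have hinv : ∀ u v, G.Adj u v → DiskPatterns.invProd (P u) (P v) =
      DiskPatterns.invProd (Pstar u) (Pstar v) := fun u v huv => by
    rw [hP.invProd_eq huv, hPstar.invProd_eq huv]
  have hcurv : ∀ v, (P v).curv = (Pstar v).curv := fun v =>
    le_antisymm (h.curv_le_of_locallyFinite hF h' hinv hPfin hPstarfin v)
      (h'.curv_le_of_locallyFinite hF h (fun u v huv => (hinv u v huv).symm) hPstarfin hPfin v)
  have hin := fun v => DiskPatterns.ClosedDisk.norm_add_radius_lt_one (hPfin.1 v)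
  have hin' := fun v => DiskPatterns.ClosedDisk.norm_add_radius_lt_one (hPstarfin.1 v)
  obtain ⟨L, hL, hLP⟩ := h.exists_isometry hF h' hinv hcurv hin hin'
  have := hF.infinite
  exact DiskPatterns.exists_isHyperbolicIsometry hPfin.1 hPstarfin.1 hcurv hL hLP
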